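/- Work over an algebraically closed field of characteristic $0$ (for example $\mathbb{C}$). Let $d,m_0,n,m\ge 0$ be integers and let $p_0,p_1,\dots,p_n$ be general points of $\mathbb{P}^2$. Let $\mathcal{L}=\mathcal{L}(d,m_0,n,m)$ be the linear system of plane curves of degree $d$ having multiplicity at least $m_0$ at $p_0$ and at least $m$ at each of $p_1,\dots,p_n$. Its dimension $\ell$ is the minimum, over all $(n+1)$-tuples of distinct points, of the projective dimension of this system ($-1$ if empty); its virtual dimension is $$v=\frac{d(d+3)}2-\frac{m_0(m_0+1)}2-n\,\frac{m(m+1)}2 ;$$ $\mathcal{L}$ is *special* if $\ell>\max\{-1,v\}$. For classes $D=(\delta;\mu_0,\dots,\mu_n)$ and $D'=(\delta';\mu_0',\dots,\mu_n')$ (degree and multiplicities at $p_0,\dots,p_n$) put $D\cdot D'=\delta\delta'-\sum_i\mu_i\mu_i'$ and $v(D)=\frac{\delta(\delta+3)}2-\sum_i\frac{\mu_i(\mu_i+1)}2$. A *$(-1)$-curve* is an irreducible rational plane curve whose proper transform on the blow-up of $\mathbb{P}^2$ at the general points $p_0,\dots,p_n$ is smooth of self-intersection $-1$; its class consists of its degree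 and its multiplicities at the $p_i$. The system $\mathcal{L}$, of class $(d;m_0,m,\dots,m)$, is *$(-1)$-special* if there are distinct $(-1)$-curves $A_1,\dots,A_r$ with $\mathcal{L}\cdot A_j=-N_j$, $N_j\ge1$ for all $j$ and $N_j\ge 2$ for some $j$, such that the residual system $\mathcal{M}=\mathcal{L}-\sum_jN_jA_j$ has degree $\ge 0$, satisfies $v(\mathcal{M})\ge0$, and has non-negative intersection number with every $(-1)$-curve. **Corollary.** Let $m\in\{2,3\}$ and $m_0\ge d-m-1$. Then $\mathcal{L}(d,m_0,n,m)$ is special if and only if it is $(-1)$-special. -/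

import Mathlib

open scoped LinearAlgebra.Projectivization

noncomputable section

namespace PlaneSystem

/-! ## Numerical classes on the blow-up of the plane at `n + 1` points -/

/-- The class `(d; m₀, …, mₙ)`, i.e. `d H - ∑ mᵢ Eᵢ`, on the blow-up of the plane at `n + 1`
points. -/
abbrev PlaneClass (n : ℕ) : Type := ℤ × (Fin (n + 1) → ℤ)

namespace PlaneClass

variable {n : ℕ}

/-- Degree. -/
def deg (D : PlaneClass n) : ℤ := D.1

/-- Multiplicity at the point `pᵢ`. -/
def mult (D : PlaneClass n) (i : Fin (n + 1)) : ℤ := D.2 i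

/-- Intersection number `d d' - ∑ mᵢ mᵢ'`. -/
def inter (D D' : PlaneClass n) : ℤ := D.deg * D'.deg - ∑ i, D.mult i * D'.mult i

/-- Virtual dimension `d(d+3)/2 - ∑ mᵢ(mᵢ+1)/2` (the divisions are exact). -/
def vdim (D : PlaneClass n) : ℤ :=
  D.deg * (D.deg + 3) / 2 - ∑ i, D.mult i * (D.mult i + 1) / 2

/-- Arithmetic genus `(d-1)(d-2)/2 - ∑ mᵢ(mᵢ-1)/2` (the divisions are exact). -/
def genus (D : PlaneClass n) : ℤ :=
  (D.deg - 1) * (D.deg - 2) / 2 - ∑ i, D.mult i * (D.mult i - 1) / 2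

/-- A `(-1)`-class: self-intersection `-1` and genus `0`. -/
def IsNegOneClass (D : PlaneClass n) : Prop := inter D D = -1 ∧ genus D = 0

end PlaneClass

/-! ## Plane curves with prescribed multiplicities -/

variable {K : Type*} [Field K] {n : ℕ}

/-- The substitution `F(X) ↦ F(v + X)`. -/
def translateAt (v : Fin 3 → K) : MvPolynomial (Fin 3) K →ₐ[K] MvPolynomial (Fin 3) K :=
  MvPolynomial.aeval fun i => MvPolynomial.C (v i) + MvPolynomial.X i

/-- The polynomials `F` with multiplicity at least `m` at the vector `v`: the expansion of `F`
around `v` has no term of degree less than `m`. For a form `F` and `v ≠ 0`, this says that the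
plane curve `F = 0` has multiplicity at least `m` at the point `[v]`. -/
def multGE (v : Fin 3 → K) (m : ℕ) : Submodule K (MvPolynomial (Fin 3) K) where
  carrier := {F | ∀ k < m, MvPolynomial.homogeneousComponent k (translateAt v F) = 0}
  zero_mem' := by intro k _; simp
  add_mem' := by
    intro F G hF hG k hk
    simp [hF k hk, hG k hk]
  smul_mem' := by
    intro c F hF k hk
    simp [hF k hk]

/-- The forms of degree `d` (and zero) with multiplicity at least `m i` at each `p i`. -/
def linearSystem (d : ℕ) (m : Fin (n + 1) → ℕ) (p : Fin (n + 1) → ℙ K (Fin 3 → K)) :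
    Submodule K (MvPolynomial (Fin 3) K) :=
  MvPolynomial.homogeneousSubmodule (Fin 3) K d ⊓ ⨅ i, multGE (p i).rep (m i)

variable (K) in
/-- The (projective) dimension of the system of plane curves of degree `d` with multiplicities
`m i` at `n + 1` general points: the minimum over all tuples of distinct points. The value `-1`
means that the system is empty. -/
def dimension (d : ℕ) (m : Fin (n + 1) → ℕ) : ℤ :=
  (sInf {r : ℕ | ∃ p : Fin (n + 1) → ℙ K (Fin 3 → K), Function.Injective p ∧
    Module.finrank K (linearSystem d m p) = r} : ℕ) - 1

/-- The multiplicities `(m₀, m, …, m)`. -/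
def quasiHomMult (m₀ n m : ℕ) : Fin (n + 1) → ℕ := Fin.cons m₀ fun _ => m

/-- The class `(d; m₀, m, …, m)` of the quasi-homogeneous system `𝓛(d, m₀, n, m)`. -/
def quasiHomClass (d m₀ n m : ℕ) : PlaneClass n :=
  ((d : ℤ), fun i => (quasiHomMult m₀ n m i : ℤ))

/-- The expected dimension `max {-1, v}` of `𝓛(d, m₀, n, m)`. -/
def expectedDimension (d m₀ n m : ℕ) : ℤ := max (-1) (quasiHomClass d m₀ n m).vdim

variable (K) in
/-- `𝓛(d, m₀, n, m)` is special: its dimension exceeds the expected one. -/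
def IsSpecial (d m₀ n m : ℕ) : Prop :=
  expectedDimension d m₀ n m < dimension K d (quasiHomMult m₀ n m)

/-! ## `(-1)`-curves -/

/-- The property `P` holds for general `(n+1)`-tuples of points of the plane, i.e. on a nonempty
Zariski open set of tuples: there is a nonzero polynomial `Φ` in the homogeneous coordinates of
`n + 1` points such that `P` holds at all tuples with coordinates where `Φ` does not vanish. -/
def ForGeneralPoints (P : (Fin (n + 1) → ℙ K (Fin 3 → K)) → Prop) : Prop :=
  ∃ Φ : MvPolynomial (Fin (n + 1) × Fin 3) K, Φ ≠ 0 ∧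
    ∀ (v : Fin (n + 1) → Fin 3 → K) (hv : ∀ i, v i ≠ 0),
      MvPolynomial.eval (fun ij => v ij.1 ij.2) Φ ≠ 0 →
        P fun i => Projectivization.mk K (v i) (hv i)

/-- The irreducible plane curve `F = 0` is rational: it has a parametrization
`t ↦ (G₀(t) : G₁(t) : G₂(t))` with rational inverse `H / H'`. -/
def IsRationalCurve (F : MvPolynomial (Fin 3) K) : Prop :=
  ∃ (G : Fin 3 → Polynomial K) (e : ℕ) (H H' : MvPolynomial (Fin 3) K),
    H.IsHomogeneous e ∧ H'.IsHomogeneous e ∧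
    MvPolynomial.aeval G F = 0 ∧ MvPolynomial.aeval G H' ≠ 0 ∧
    MvPolynomial.aeval G H = Polynomial.X * MvPolynomial.aeval G H'

/-- `F(v + s (w + t u))` as a polynomial in `s = X 0` and `t = X 1`. When `v, w, u` is a basis,
`(s, t)` are local coordinates on the blow-up of the plane at `[v]`, at the point of the
exceptional curve `s = 0` given by the tangent direction `w`. -/
def blowupPullback (F : MvPolynomial (Fin 3) K) (v w u : Fin 3 → K) : MvPolynomial (Fin 2) K :=
  MvPolynomial.aeval
    (fun i => MvPolynomial.C (v i) +
      MvPolynomial.X 0 * (MvPolynomial.C (w i) + MvPolynomial.X 1 * MvPolynomial.C (u i))) F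

/-- The strict transform of `F = 0`, a curve of multiplicity `μ` at `[v]`, is smooth at every
point over `[v]` of the blow-up at `[v]`. Its local equation is `g = F(v + s(w + tu)) / s^μ`, and
one of `g`, `∂g/∂s`, `∂g/∂t` has to be nonzero at `s = t = 0`. -/
def StrictTransformSmoothOver (F : MvPolynomial (Fin 3) K) (v : Fin 3 → K) (μ : ℕ) : Prop :=
  ∀ w u : Fin 3 → K, LinearIndependent K ![v, w, u] →
    (blowupPullback F v w u).coeff (Finsupp.single 0 μ) ≠ 0 ∨
    (blowupPullback F v w u).coeff (Finsupp.single 0 (μ + 1)) ≠ 0 ∨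
    (blowupPullback F v w u).coeff (Finsupp.single 0 μ + Finsupp.single 1 1) ≠ 0

/-- The form `F` defines a `(-1)`-curve of class `A` on the blow-up of the plane at the points
`p i`: an irreducible rational plane curve of degree `A.deg`, with multiplicity exactly `A.mult i`
at `p i`, whose strict transform on the blow-up is smooth with self-intersection `-1`. -/
structure IsNegOneCurve (p : Fin (n + 1) → ℙ K (Fin 3 → K)) (F : MvPolynomial (Fin 3) K)
    (A : PlaneClass n) : Prop where
  irreducible : Irreducible F
  degree : ∃ δ : ℕ, A.deg = δ ∧ F.IsHomogeneous δ
  rational : IsRationalCurve F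
  smooth_away : ∀ q : ℙ K (Fin 3 → K), (∀ i, q ≠ p i) → F ∉ multGE q.rep 2
  smooth_over : ∀ i, ∃ μ : ℕ, A.mult i = μ ∧ F ∈ multGE (p i).rep μ ∧
    F ∉ multGE (p i).rep (μ + 1) ∧ StrictTransformSmoothOver F (p i).rep μ
  self_inter : A.inter A = -1

variable (K) in
/-- An irreducible `(-1)`-class: a `(-1)`-class which, for general points, contains a
`(-1)`-curve. Since a `(-1)`-curve is the only effective divisor in its class, these are exactly
the classes of the `(-1)`-curves on the blow-up at general points. -/
def IsIrreducibleNegOneClass (A : PlaneClass n) : Prop :=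
  A.IsNegOneClass ∧
    ForGeneralPoints (K := K) fun p => ∃ F : MvPolynomial (Fin 3) K, IsNegOneCurve p F A

variable (K) in
/-- The system of class `L` is `(-1)`-special: there are finitely many (distinct) `(-1)`-curves
`A` with `L · A = -N_A`, all `N_A ≥ 1` and some `N_A ≥ 2`, such that the residual system
`M = L - ∑ N_A A` (a system of plane curves, of degree `≥ 0`) has virtual dimension `≥ 0` and
meets every `(-1)`-curve non-negatively. -/
def IsNegOneSpecialClass (L : PlaneClass n) : Prop :=
  ∃ (S : Finset (PlaneClass n)) (N : PlaneClass n → ℕ) (M : PlaneClass n),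
    (∀ A ∈ S, IsIrreducibleNegOneClass K A ∧ 1 ≤ N A ∧ L.inter A = -(N A : ℤ)) ∧
    (∃ A ∈ S, 2 ≤ N A) ∧
    M = L - ∑ A ∈ S, N A • A ∧
    0 ≤ M.deg ∧ 0 ≤ M.vdim ∧
    ∀ A : PlaneClass n, IsIrreducibleNegOneClass K A → 0 ≤ M.inter A

variable (K) in
/-- The quasi-homogeneous system `𝓛(d, m₀, n, m)` is `(-1)`-special. -/
def IsNegOneSpecial (d m₀ n m : ℕ) : Prop :=
  IsNegOneSpecialClass K (quasiHomClass d m₀ n m)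

end PlaneSystem

end

open scoped LinearAlgebra.Projectivization

noncomputable section

namespace PlaneSystem

open MvPolynomial

variable {K : Type*} [Field K]

/-! The proof goes around a cycle: a special system occurs in the explicit list `Listed`, a listed
system is `(-1)`-special, and a `(-1)`-special system is special.

Special implies listed (`listed_of_isSpecial`, from the contrapositive `gen_of_not_listed`).
Dimensions are upper semicontinuous, so one tuple of points with a small system bounds the dimension
for general points; this is `Gen`. Put `k = d - m₀`. If `k < m`, the lines through `p₀` and the
other points are split off until these points have multiplicity `k` (`Gen.mfun_lines`). If `k` is
`m` or `m + 1`, or after this reduction, a quadratic Cremona transformation centred at `p₀` and two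
further points (`Gen.cremona`) preserves `k` and removes these two points, or makes them simple when
`k = m + 1`. The induction ends with systems whose dimension is known. The expected dimension is
lost only when a line is split off at least twice, or when the multiplicity at `p₀` drops to `-2` or
less and is replaced by `0`. Such losses that leave more than the expected dimension give the list.

Listed implies `(-1)`-special (`isNegOneSpecial_of_listed`). The fixed part consists of lines
through `p₀` and of the curve of degree `e` with multiplicity `e - 1` at `p₀` through all `n = 2e`
other points. That curve exists by counting conditions; it contains no line through `p₀`, and this
alone makes it irreducible, rational and smooth after blowing up (`IsMonoidal`). The residual system
is a sum of `(-1)`-curves that it meets non-negatively and of lines through `p₀`, or `p₀` is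
absorbed similarly, so it meets all `(-1)`-curves non-negatively.

`(-1)`-special implies special (`IsNegOneSpecialClass.vdim_lt_dimension`). Distinct `(-1)`-curves
meet non-negatively by Bézout's inequality `sum_mul_le_of_coprime`. Riemann-Roch arithmetic then
gives `v(L) < v(M)` for the residual class `M` (`vdim_lt_of_inter`), and multiplication by the
equations of the fixed curves embeds the system of `M` into that of `L`. -/

/-! ## Multiplicity and powers of maximal ideals -/

/-- The maximal ideal of the polynomials vanishing at `v`. -/
abbrev idealAt {σ : Type*} (v : σ → K) : Ideal (MvPolynomial σ K) := RingHom.ker (eval v)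

theorem idealAt_zero {σ : Type*} : idealAt (0 : σ → K) = idealOfVars σ K := by
  apply le_antisymm
  · intro F hF
    rw [← pow_one (idealOfVars σ K), mem_pow_idealOfVars_iff']
    intro x hx
    have hx0 : x = 0 := by
      have : x.degree = 0 := by omega
      simpa [Finsupp.degree_eq_zero_iff] using this
    have h : eval (0 : σ → K) F = 0 := hF
    rw [hx0]
    rw [← constantCoeff_eq]
    simpa [constantCoeff_eq, eval_zero] using h
  · rw [Ideal.span_le]
    rintro _ ⟨i, rfl⟩
    simp [RingHom.mem_ker]

/-- A substitution taking the point `u` to the point `v` pulls back the powers of the maximal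
ideal of `v` into those of `u`. -/
theorem map_mem_idealAt_pow {σ τ : Type*} {u : σ → K} {v : τ → K}
    (φ : MvPolynomial τ K →ₐ[K] MvPolynomial σ K) (h : ∀ i, eval u (φ (X i)) = v i)
    {F : MvPolynomial τ K} {m : ℕ} (hF : F ∈ idealAt v ^ m) : φ F ∈ idealAt u ^ m := by
  have h1 : (aeval u).comp φ = aeval v := by
    apply MvPolynomial.algHom_ext
    intro i
    simpa [aeval_eq_eval] using h i
  have h2 : (idealAt v).map φ.toRingHom ≤ idealAt u := by
    rw [Ideal.map_le_iff_le_comap]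
    intro G hG
    have := congrArg (fun f => f G) h1
    simp only [AlgHom.comp_apply, aeval_eq_eval] at this
    rw [Ideal.mem_comap, RingHom.mem_ker]
    rw [RingHom.mem_ker] at hG
    exact this.trans hG
  have h3 := Ideal.mem_map_of_mem φ.toRingHom hF
  rw [Ideal.map_pow] at h3
  exact Ideal.pow_right_mono h2 m h3

theorem isMaximal_idealAt {σ : Type*} (v : σ → K) : (idealAt v).IsMaximal :=
  RingHom.ker_isMaximal_of_surjective _ fun c => ⟨C c, by simp⟩

/-- A polynomial not vanishing at `v` generates, together with any power of the maximal ideal, the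
whole ring, so it can be cancelled. -/
theorem mem_idealAt_pow_of_mul_mem {σ : Type*} {v : σ → K} {m : ℕ} {H F : MvPolynomial σ K}
    (hH : eval v H ≠ 0) (h : H * F ∈ idealAt v ^ m) : F ∈ idealAt v ^ m := by
  have hmax := isMaximal_idealAt v
  have h1 : IsCoprime (Ideal.span {H}) (idealAt v) := by
    rw [Ideal.isCoprime_iff_sup_eq, sup_comm]
    exact hmax.out.2 _
      (lt_of_le_of_ne le_sup_left fun e => hH (by
        have : H ∈ idealAt v := by
          rw [e]; exact Ideal.mem_sup_right (Ideal.mem_span_singleton_self H)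
        exact this))
  have h2 := h1.pow_right (n := m)
  rw [Ideal.isCoprime_iff_exists] at h2
  obtain ⟨a, ha, b, hb, hab⟩ := h2
  obtain ⟨c, rfl⟩ := Ideal.mem_span_singleton'.1 ha
  have : F = c * (H * F) + F * b := by linear_combination (-F) * hab
  rw [this]
  exact add_mem (Ideal.mul_mem_left _ _ h) (Ideal.mul_mem_left _ _ hb)

/-- Translations by `v` and `-v` are inverse substitutions exchanging `v` and the origin. The
ideal-theoretic form is what makes multiplicities compatible with products and substitutions. -/
theorem mem_multGE_iff {v : Fin 3 → K} {m : ℕ} {F : MvPolynomial (Fin 3) K} :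
    F ∈ multGE v m ↔ F ∈ idealAt v ^ m := by
  have h1 : F ∈ multGE v m ↔ translateAt v F ∈ idealAt (0 : Fin 3 → K) ^ m := by
    rw [idealAt_zero, mem_pow_idealOfVars_iff']
    constructor
    · intro h x hx
      have := congrArg (coeff x) (h _ hx)
      simpa [coeff_homogeneousComponent] using this
    · intro h k hk
      ext x
      rw [coeff_homogeneousComponent]
      split_ifs with hx
      · simpa using h x (by omega)
      · simp
  rw [h1]
  constructor
  · intro h
    have h2 := map_mem_idealAt_pow (u := v) (translateAt (-v)) (by simp [translateAt]) h
    have h3 : (translateAt (-v)).comp (translateAt v) = AlgHom.id K _ := by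
      apply MvPolynomial.algHom_ext
      intro i
      simp [translateAt, algebraMap_eq]
    have h4 := congrArg (fun f => f F) h3
    simp only [AlgHom.comp_apply, AlgHom.id_apply] at h4
    rwa [h4] at h2
  · exact map_mem_idealAt_pow _ (by simp [translateAt])

theorem multGE_antitone (v : Fin 3 → K) {m m' : ℕ} (h : m ≤ m') : multGE v m' ≤ multGE v m :=
  fun F hF => by
    rw [mem_multGE_iff] at hF ⊢
    exact Ideal.pow_le_pow_right h hF

theorem mul_mem_multGE {v : Fin 3 → K} {a b : ℕ} {F G : MvPolynomial (Fin 3) K}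
    (hF : F ∈ multGE v a) (hG : G ∈ multGE v b) : F * G ∈ multGE v (a + b) := by
  rw [mem_multGE_iff] at *
  rw [pow_add]
  exact Ideal.mul_mem_mul hF hG

theorem mem_multGE_zero {v : Fin 3 → K} {F : MvPolynomial (Fin 3) K} : F ∈ multGE v 0 := by
  simp [mem_multGE_iff]

theorem mem_multGE_one {v : Fin 3 → K} {F : MvPolynomial (Fin 3) K} :
    F ∈ multGE v 1 ↔ eval v F = 0 := by
  rw [mem_multGE_iff, pow_one, RingHom.mem_ker]

theorem mem_multGE_of_mul_mem {v : Fin 3 → K} {m : ℕ} {H F : MvPolynomial (Fin 3) K}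
    (hH : eval v H ≠ 0) (h : H * F ∈ multGE v m) : F ∈ multGE v m := by
  rw [mem_multGE_iff] at *
  exact mem_idealAt_pow_of_mul_mem hH h

/-! ## Linear changes of coordinates -/

/-- The substitution `F ↦ F ∘ g` for a linear automorphism `g`. -/
def linSubst (g : (Fin 3 → K) ≃ₗ[K] (Fin 3 → K)) :
    MvPolynomial (Fin 3) K →ₐ[K] MvPolynomial (Fin 3) K :=
  aeval fun i => ∑ j, C (g (Pi.single j 1) i) * X j

theorem sum_apply_single (g : (Fin 3 → K) ≃ₗ[K] (Fin 3 → K)) (u : Fin 3 → K) (i : Fin 3) :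
    ∑ j, g (Pi.single j 1) i * u j = g u i := by
  have h : u = ∑ j, u j • (Pi.single j (1 : K) : Fin 3 → K) := by
    ext k
    simp [Finset.sum_apply, Pi.single_apply]
  conv_rhs => rw [h]
  simp [map_sum, Finset.sum_apply, mul_comm]

/-- Evaluation of `F ∘ g` in an arbitrary algebra. -/
theorem aeval_linSubst {A : Type*} [CommRing A] [Algebra K A]
    (g : (Fin 3 → K) ≃ₗ[K] (Fin 3 → K)) (x : Fin 3 → A) (F : MvPolynomial (Fin 3) K) :
    aeval x (linSubst g F) =
      aeval (fun i => ∑ j, algebraMap K A (g (Pi.single j 1) i) * x j) F := by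
  rw [linSubst, ← AlgHom.comp_apply]
  congr 1
  apply MvPolynomial.algHom_ext
  intro i
  simp

theorem eval_linSubst (g : (Fin 3 → K) ≃ₗ[K] (Fin 3 → K)) (u : Fin 3 → K)
    (F : MvPolynomial (Fin 3) K) : eval u (linSubst g F) = eval (g u) F := by
  have := aeval_linSubst g u F
  simp only [Algebra.algebraMap_self, RingHom.id_apply, sum_apply_single, aeval_eq_eval] at this
  exact this

theorem linSubst_symm_linSubst (g : (Fin 3 → K) ≃ₗ[K] (Fin 3 → K)) (F : MvPolynomial (Fin 3) K) :
    linSubst g.symm (linSubst g F) = F := by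
  have h : (linSubst g.symm).comp (linSubst g) = AlgHom.id K _ := by
    apply MvPolynomial.algHom_ext
    intro i
    rw [AlgHom.comp_apply, AlgHom.id_apply, linSubst, linSubst, aeval_X, map_sum]
    simp only [map_mul, aeval_X, algHom_C, algebraMap_eq, Finset.mul_sum]
    rw [Finset.sum_comm]
    have h2 : ∀ k : Fin 3, ∑ j, g (Pi.single j 1) i * g.symm (Pi.single k 1) j =
        if i = k then 1 else 0 := by
      intro k
      rw [sum_apply_single, LinearEquiv.apply_symm_apply, Pi.single_apply]
    calc ∑ k, ∑ j, C (g (Pi.single j 1) i) * (C (g.symm (Pi.single k 1) j) * X k)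
        = ∑ k, C (∑ j, g (Pi.single j 1) i * g.symm (Pi.single k 1) j) * X k := by
          refine Finset.sum_congr rfl fun k _ => ?_
          rw [map_sum, Finset.sum_mul]
          refine Finset.sum_congr rfl fun j _ => ?_
          rw [map_mul, mul_assoc]
      _ = X i := by simp [h2]
  exact congrArg (fun f => f F) h

theorem linSubst_linSubst_symm (g : (Fin 3 → K) ≃ₗ[K] (Fin 3 → K)) (F : MvPolynomial (Fin 3) K) :
    linSubst g (linSubst g.symm F) = F := linSubst_symm_linSubst g.symm F

/-- A linear change of coordinates as an automorphism of the polynomial ring. -/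
def linSubstEquiv (g : (Fin 3 → K) ≃ₗ[K] (Fin 3 → K)) :
    MvPolynomial (Fin 3) K ≃ₐ[K] MvPolynomial (Fin 3) K :=
  AlgEquiv.ofAlgHom (linSubst g) (linSubst g.symm)
    (AlgHom.ext fun F => linSubst_symm_linSubst g.symm F)
    (AlgHom.ext fun F => linSubst_symm_linSubst g F)

theorem linSubst_injective (g : (Fin 3 → K) ≃ₗ[K] (Fin 3 → K)) :
    Function.Injective (linSubst g) := (linSubstEquiv g).injective

theorem isHomogeneous_linSubst (g : (Fin 3 → K) ≃ₗ[K] (Fin 3 → K)) {d : ℕ}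
    {F : MvPolynomial (Fin 3) K} (hF : F.IsHomogeneous d) : (linSubst g F).IsHomogeneous d := by
  have := hF.aeval (fun i => ∑ j, C (g (Pi.single j 1) i) * X j : Fin 3 → MvPolynomial (Fin 3) K)
    (n := 1) fun i => IsHomogeneous.sum _ _ _ fun j _ => isHomogeneous_C_mul_X _ _
  simpa [linSubst] using this

theorem linSubst_mem_multGE_iff (g : (Fin 3 → K) ≃ₗ[K] (Fin 3 → K)) {v : Fin 3 → K} {m : ℕ}
    {F : MvPolynomial (Fin 3) K} : linSubst g F ∈ multGE v m ↔ F ∈ multGE (g v) m := by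
  rw [mem_multGE_iff, mem_multGE_iff]
  constructor
  · intro h
    have := map_mem_idealAt_pow (u := g v) (linSubst g.symm)
      (fun i => by rw [eval_linSubst]; simp) h
    rwa [linSubst_symm_linSubst] at this
  · exact map_mem_idealAt_pow (linSubst g) fun i => by rw [eval_linSubst]; simp

/-- Given three independent vectors, the linear automorphism taking the standard basis to them. -/
theorem exists_linearEquiv {v w u : Fin 3 → K} (h : LinearIndependent K ![v, w, u]) :
    ∃ g : (Fin 3 → K) ≃ₗ[K] (Fin 3 → K), g (Pi.single 0 1) = v ∧ g (Pi.single 1 1) = w ∧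
      g (Pi.single 2 1) = u := by
  let b := basisOfLinearIndependentOfCardEqFinrank h (by simp)
  have hb : ∀ i, b i = ![v, w, u] i := fun i => by simp [b]
  refine ⟨(Pi.basisFun K (Fin 3)).equiv b (Equiv.refl _), ?_, ?_, ?_⟩ <;>
  · rw [← Pi.basisFun_apply, Module.Basis.equiv_apply]
    simp [hb]

/-- Two independent vectors of `K³` extend to a basis. -/
theorem exists_linearIndependent_three {v w : Fin 3 → K} (h : LinearIndependent K ![v, w]) :
    ∃ u, LinearIndependent K ![v, w, u] := by
  have h1 : Submodule.span K (Set.range ![v, w]) ≠ ⊤ := by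
    intro e
    have h2 := finrank_span_eq_card h
    rw [e, finrank_top] at h2
    simp at h2
  obtain ⟨u, hu⟩ := SetLike.exists_not_mem_of_ne_top _ h1
  refine ⟨u, ?_⟩
  have := LinearIndependent.finSnoc h hu
  convert! this using 1
  ext i j
  fin_cases i <;> rfl

theorem exists_linearIndependent_two {v : Fin 3 → K} (h : v ≠ 0) :
    ∃ w, LinearIndependent K ![v, w] := by
  have h1 : Submodule.span K {v} ≠ ⊤ := by
    intro e
    have h2 := finrank_span_singleton (K := K) h
    rw [e, finrank_top] at h2
    simp at h2
  obtain ⟨w, hw⟩ := SetLike.exists_not_mem_of_ne_top _ h1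
  refine ⟨w, ?_⟩
  rw [LinearIndependent.pair_iff' h]
  intro a ha
  exact hw (Submodule.mem_span_singleton.2 ⟨a, ha⟩)

/-! ## Multiplicities of forms -/

theorem aeval_mul_of_isHomogeneous {σ A : Type*} [CommRing A] [Algebra K A]
    {F : MvPolynomial σ K} {d : ℕ} (hF : F.IsHomogeneous d) (a : A) (x : σ → A) :
    aeval (fun i => a * x i) F = a ^ d * aeval x F := by
  rw [F.as_sum, map_sum, map_sum, Finset.mul_sum]
  refine Finset.sum_congr rfl fun s hs => ?_
  rw [aeval_monomial, aeval_monomial]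
  simp only [mul_pow, Finsupp.prod_mul]
  have h : (s.prod fun _ k => a ^ k) = a ^ d := by
    rw [hF.degree_eq_sum_deg_support hs, Finsupp.prod, Finset.prod_pow_eq_pow_sum]
  rw [h]; ring

/-- Scaling the variables multiplies a form by a nonzero constant. Hence multiplicities of forms do
not depend on the vector representing a projective point. -/
theorem mem_multGE_smul {F : MvPolynomial (Fin 3) K} {d : ℕ} (hF : F.IsHomogeneous d) {c : K}
    (hc : c ≠ 0) (v : Fin 3 → K) (m : ℕ) : F ∈ multGE (c • v) m ↔ F ∈ multGE v m := by
  have key : ∀ {c : K} (_ : c ≠ 0) (v : Fin 3 → K), F ∈ multGE (c • v) m → F ∈ multGE v m := by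
    intro c hc v h
    have h1 := (linSubst_mem_multGE_iff (LinearEquiv.smulOfNeZero K (Fin 3 → K) c hc)).2 h
    have h2 : linSubst (LinearEquiv.smulOfNeZero K (Fin 3 → K) c hc) F = C (c ^ d) * F := by
      have h3 : (fun i => ∑ j, C ((LinearEquiv.smulOfNeZero K (Fin 3 → K) c hc)
          (Pi.single j 1) i) * X j : Fin 3 → MvPolynomial (Fin 3) K) = fun i => C c * X i := by
        ext1 i
        rw [Finset.sum_eq_single i]
        · simp
        · intro j _ hj
          simp [hj.symm]
        · simp
      rw [linSubst, h3, aeval_mul_of_isHomogeneous hF, aeval_X_left_apply, map_pow]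
    rw [h2] at h1
    exact mem_multGE_of_mul_mem (by simpa using pow_ne_zero d hc) h1
  refine ⟨key hc v, fun h => key (inv_ne_zero hc) (c • v) ?_⟩
  rwa [smul_smul, inv_mul_cancel₀ hc, one_smul]

/-- The factors of a form are forms. -/
theorem isHomogeneous_factors {σ : Type*} {F G : MvPolynomial σ K} (hF : F ≠ 0) (hG : G ≠ 0)
    {n : ℕ} (h : (F * G).IsHomogeneous n) :
    ∃ a b, a + b = n ∧ F.IsHomogeneous a ∧ G.IsHomogeneous b := by
  classical
  -- This substitution records the degree in a new variable. A form is recognised by equality of the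
  -- largest and smallest exponents of that variable; both are additive over a domain, so equality
  -- for the product forces equality for the factors.
  let φ : MvPolynomial σ K →ₐ[K] Polynomial (MvPolynomial σ K) :=
    aeval fun i => Polynomial.X * Polynomial.C (X i)
  have hmon : ∀ (s : σ →₀ ℕ) (c : K),
      φ (monomial s c) = Polynomial.C (monomial s c) * Polynomial.X ^ s.degree := by
    intro s c
    have h1 := aeval_mul_of_isHomogeneous (isHomogeneous_monomial (n := s.degree) c rfl)
      (Polynomial.X : Polynomial (MvPolynomial σ K)) (fun i => Polynomial.C (X i))
    have h2 : aeval (fun i => (Polynomial.C (X i) : Polynomial (MvPolynomial σ K)))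
        (monomial s c) = Polynomial.C (monomial s c) := by
      have : (aeval fun i => (Polynomial.C (X i) : Polynomial (MvPolynomial σ K))) =
          (Polynomial.CAlgHom : MvPolynomial σ K →ₐ[K] Polynomial (MvPolynomial σ K)) := by
        apply MvPolynomial.algHom_ext
        intro i
        simp
      rw [this]; rfl
    rw [h2, mul_comm] at h1
    exact h1
  have hφ : ∀ (H : MvPolynomial σ K) (s : σ →₀ ℕ) (k : ℕ),
      coeff s ((φ H).coeff k) = if s.degree = k then coeff s H else 0 := by
    intro H s k
    induction H using MvPolynomial.induction_on' with
    | monomial t c =>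
      rw [hmon, Polynomial.coeff_C_mul, Polynomial.coeff_X_pow, coeff_monomial]
      by_cases ht : t = s
      · subst ht
        by_cases hk : t.degree = k
        · simp [hk]
        · simp [hk, Ne.symm hk]
      · by_cases hk : k = t.degree <;> simp [ht, hk, coeff_monomial]
    | add p q hp hq =>
      rw [map_add, Polynomial.coeff_add, coeff_add, hp, hq, coeff_add]
      split_ifs <;> simp
  have hinj : ∀ H : MvPolynomial σ K, H ≠ 0 → φ H ≠ 0 := by
    intro H hH e
    apply hH
    ext s
    have := hφ H s s.degree
    rw [e] at this
    simpa using this.symm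
  have hhom : ∀ (H : MvPolynomial σ K), (φ H).natTrailingDegree = (φ H).natDegree →
      H.IsHomogeneous (φ H).natDegree := by
    intro H e s hs
    by_contra hne
    have hne' : s.degree ≠ (φ H).natDegree := by
      rwa [Finsupp.degree_eq_weight_one]
    have h1 := hφ H s s.degree
    rw [if_pos rfl] at h1
    rcases lt_or_gt_of_ne hne' with h2 | h2
    · rw [Polynomial.coeff_eq_zero_of_lt_natTrailingDegree (by omega), coeff_zero] at h1
      exact hs h1.symm
    · rw [Polynomial.coeff_eq_zero_of_natDegree_lt h2, coeff_zero] at h1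
      exact hs h1.symm
  have hprod : φ (F * G) = Polynomial.C (F * G) * Polynomial.X ^ n := by
    ext k s
    rw [hφ, Polynomial.coeff_C_mul, Polynomial.coeff_X_pow]
    by_cases hs : coeff s (F * G) = 0
    · by_cases hk : k = n <;> simp [hk, hs]
    · have h3 : s.degree = n := by
        rw [Finsupp.degree_eq_weight_one]; exact h hs
      by_cases hk : k = n
      · simp [hk, h3]
      · simp [hk, h3, Ne.symm hk]
  have hFG := mul_ne_zero hF hG
  have d1 : (φ (F * G)).natDegree = n := by
    rw [hprod, Polynomial.natDegree_C_mul_X_pow _ _ hFG]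
  have d2 : (φ (F * G)).natTrailingDegree = n := by
    rw [hprod, Polynomial.natTrailingDegree_mul_X_pow (Polynomial.C_ne_zero.2 hFG),
      Polynomial.natTrailingDegree_C, zero_add]
  rw [map_mul, Polynomial.natDegree_mul (hinj F hF) (hinj G hG)] at d1
  rw [map_mul, Polynomial.natTrailingDegree_mul (hinj F hF) (hinj G hG)] at d2
  have t1 := Polynomial.natTrailingDegree_le_natDegree (φ F)
  have t2 := Polynomial.natTrailingDegree_le_natDegree (φ G)
  exact ⟨_, _, d1, hhom F (by omega), hhom G (by omega)⟩

theorem isHomogeneous_of_mul_left {σ : Type*} {F G : MvPolynomial σ K} (hF : F ≠ 0) {a b : ℕ}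
    (ha : F.IsHomogeneous a) (h : (F * G).IsHomogeneous (a + b)) : G.IsHomogeneous b := by
  by_cases hG : G = 0
  · rw [hG]; exact isHomogeneous_zero _ _ _
  · obtain ⟨a', b', e, h1, h2⟩ := isHomogeneous_factors hF hG h
    have := h1.inj_right ha hF
    rwa [show b = b' by omega]

theorem degree_fin_three (s : Fin 3 →₀ ℕ) : s.degree = s 0 + s 1 + s 2 := by
  rw [Finsupp.degree_eq_sum, Fin.sum_univ_three]

theorem sum_of_mem_support {F : MvPolynomial (Fin 3) K} {d : ℕ} (hF : F.IsHomogeneous d)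
    {s : Fin 3 →₀ ℕ} (hs : s ∈ F.support) : s 0 + s 1 + s 2 = d := by
  rw [← degree_fin_three, hF.degree_eq_sum_deg_support hs]; rfl

/-- Multiplicity of a form at a vertex of the coordinate triangle. -/
theorem mem_multGE_single_iff {F : MvPolynomial (Fin 3) K} {d : ℕ} (hF : F.IsHomogeneous d)
    (i : Fin 3) {m : ℕ} :
    F ∈ multGE (Pi.single i 1) m ↔ ∀ s ∈ F.support, s i + m ≤ d := by
  rw [mem_multGE_iff]
  constructor
  · intro h s hs
    -- Setting the `i`-th variable to `1` makes the vertex the origin of an affine chart. As `F` is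
    -- a form, the lost exponent is determined by the others, so no two monomials merge.
    let φ : MvPolynomial (Fin 3) K →ₐ[K] MvPolynomial (Fin 3) K :=
      aeval fun j => if j = i then 1 else X j
    have h1 := map_mem_idealAt_pow (u := (0 : Fin 3 → K)) φ
      (fun j => by by_cases hj : j = i <;> simp [φ, hj]) h
    rw [idealAt_zero, mem_pow_idealOfVars_iff] at h1
    have hmon : ∀ t : Fin 3 →₀ ℕ, ∀ c : K, φ (monomial t c) = monomial (t.erase i) c := by
      intro t c
      rw [aeval_monomial, monomial_eq, algebraMap_eq, Finsupp.prod_fintype _ _ (by simp),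
        Finsupp.prod_fintype _ _ (by simp)]
      congr 1
      refine Finset.prod_congr rfl fun j _ => ?_
      by_cases hj : j = i <;> simp [hj, Finsupp.erase_ne]
    have h2 : coeff (s.erase i) (φ F) = coeff s F := by
      conv_lhs => rw [F.as_sum]
      rw [map_sum, coeff_sum, Finset.sum_eq_single s]
      · rw [hmon, coeff_monomial, if_pos rfl]
      · intro t ht hts
        rw [hmon, coeff_monomial, if_neg]
        intro e
        apply hts
        have h3 := sum_of_mem_support hF hs
        have h4 := sum_of_mem_support hF ht
        have h5 : ∀ j, j ≠ i → t j = s j := fun j hj => by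
          have := congrArg (fun f => f j) e
          simpa [Finsupp.erase_ne hj] using this
        ext j
        by_cases hj : j = i
        · subst hj
          fin_cases j <;> simp_all <;> omega
        · exact h5 j hj
      · intro h; exact absurd hs h
    have h3 := h1 (s.erase i) (by rw [mem_support_iff, h2]; exact mem_support_iff.1 hs)
    have h4 := sum_of_mem_support hF hs
    rw [degree_fin_three] at h3
    fin_cases i <;> simp [Finsupp.erase] at h3 ⊢ <;> omega
  · intro h
    rw [F.as_sum]
    refine Ideal.sum_mem _ fun s hs => ?_
    have h1 := h s hs
    have h4 := sum_of_mem_support hF hs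
    have hX : ∀ j, j ≠ i → (X j : MvPolynomial (Fin 3) K) ∈ idealAt (Pi.single i 1 : Fin 3 → K) := by
      intro j hj
      simp [RingHom.mem_ker, hj]
    rw [monomial_eq]
    apply Ideal.mul_mem_left
    rw [Finsupp.prod_fintype _ _ (by simp)]
    have key : ∀ a b c : Fin 3, b ≠ i → c ≠ i → (∏ j, (X j : MvPolynomial (Fin 3) K) ^ s j) =
        X a ^ s a * (X b ^ s b * X c ^ s c) → m ≤ s b + s c →
        ∏ j, (X j : MvPolynomial (Fin 3) K) ^ s j ∈ idealAt (Pi.single i 1 : Fin 3 → K) ^ m := by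
      intro a b c hb hc e hm
      rw [e]
      apply Ideal.mul_mem_left
      apply Ideal.pow_le_pow_right hm
      rw [pow_add]
      exact Ideal.mul_mem_mul (Ideal.pow_mem_pow (hX b hb) _) (Ideal.pow_mem_pow (hX c hc) _)
    rw [Fin.prod_univ_three] at key ⊢
    fin_cases i
    · exact key 0 1 2 (by simp) (by simp) (by ring) (by simp at h1; omega)
    · exact key 1 0 2 (by simp) (by simp) (by ring) (by simp at h1; omega)
    · exact key 2 0 1 (by simp) (by simp) (by ring) (by simp at h1; omega)

/-! ## Linear systems at tuples of vectors -/

/-- The forms of degree `d` with multiplicity at least `m i` at each vector `v i`. -/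
def sys {ι : Type*} (d : ℕ) (m : ι → ℕ) (v : ι → Fin 3 → K) :
    Submodule K (MvPolynomial (Fin 3) K) :=
  homogeneousSubmodule (Fin 3) K d ⊓ ⨅ i, multGE (v i) (m i)

theorem mem_sys {ι : Type*} {d : ℕ} {m : ι → ℕ} {v : ι → Fin 3 → K} {F : MvPolynomial (Fin 3) K} :
    F ∈ sys d m v ↔ F.IsHomogeneous d ∧ ∀ i, F ∈ multGE (v i) (m i) := by
  simp [sys, Submodule.mem_iInf]

theorem linearSystem_eq_sys {n d : ℕ} (m : Fin (n + 1) → ℕ) (p : Fin (n + 1) → ℙ K (Fin 3 → K)) :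
    linearSystem d m p = sys d m fun i => (p i).rep := rfl

instance finiteDimensional_homogeneousSubmodule (d : ℕ) :
    FiniteDimensional K (homogeneousSubmodule (Fin 3) K d) :=
  Module.Finite.iff_fg.2 (homogeneousSubmodule_fg (σ := Fin 3) (R := K) d)

instance finiteDimensional_sys {ι : Type*} (d : ℕ) (m : ι → ℕ) (v : ι → Fin 3 → K) :
    FiniteDimensional K (sys d m v) :=
  Submodule.finiteDimensional_of_le (S₂ := homogeneousSubmodule (Fin 3) K d) inf_le_left

theorem sys_antitone {ι : Type*} {d : ℕ} {m m' : ι → ℕ} (h : m ≤ m') (v : ι → Fin 3 → K) :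
    sys d m' v ≤ sys d m v := fun F hF => by
  rw [mem_sys] at *
  exact ⟨hF.1, fun i => multGE_antitone _ (h i) (hF.2 i)⟩

theorem sys_smul {ι : Type*} (d : ℕ) (m : ι → ℕ) (v : ι → Fin 3 → K) {c : ι → K}
    (hc : ∀ i, c i ≠ 0) : sys d m (fun i => c i • v i) = sys d m v := by
  ext F
  rw [mem_sys, mem_sys]
  refine and_congr_right fun h => forall_congr' fun i => mem_multGE_smul h (hc i) _ _

theorem map_linSubst_sys {ι : Type*} (d : ℕ) (m : ι → ℕ) (v : ι → Fin 3 → K)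
    (g : (Fin 3 → K) ≃ₗ[K] (Fin 3 → K)) :
    (sys d m fun i => g (v i)).map (linSubstEquiv g).toLinearMap = sys d m v := by
  ext F
  constructor
  · rintro ⟨G, hG, rfl⟩
    rw [SetLike.mem_coe, mem_sys] at hG
    rw [mem_sys]
    exact ⟨isHomogeneous_linSubst g hG.1, fun i => (linSubst_mem_multGE_iff g).2 (hG.2 i)⟩
  · intro hF
    rw [mem_sys] at hF
    have hF' : linSubst g (linSubst g.symm F) = F := linSubst_symm_linSubst g.symm F
    refine ⟨linSubst g.symm F, ?_, hF'⟩
    rw [SetLike.mem_coe, mem_sys]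
    refine ⟨isHomogeneous_linSubst g.symm hF.1, fun i => ?_⟩
    rw [linSubst_mem_multGE_iff]
    simpa using hF.2 i

/-- This allows three independent vectors to be moved to the coordinate vertices, where
multiplicities are read off from exponents. -/
theorem finrank_sys_linearEquiv {ι : Type*} (d : ℕ) (m : ι → ℕ) (v : ι → Fin 3 → K)
    (g : (Fin 3 → K) ≃ₗ[K] (Fin 3 → K)) :
    Module.finrank K (sys d m fun i => g (v i)) = Module.finrank K (sys d m v) := by
  rw [← map_linSubst_sys d m v g]
  exact (LinearEquiv.finrank_map_eq (linSubstEquiv g).toLinearEquiv _).symm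

/-! ## General tuples of vectors -/

/-- `P` holds on a nonempty Zariski open set of tuples of vectors. -/
def Generic {ι : Type*} (P : (ι → Fin 3 → K) → Prop) : Prop :=
  ∃ Φ : MvPolynomial (ι × Fin 3) K, Φ ≠ 0 ∧
    ∀ v : ι → Fin 3 → K, eval (fun ij => v ij.1 ij.2) Φ ≠ 0 → P v

namespace Generic

variable {ι : Type*} {P Q : (ι → Fin 3 → K) → Prop}

theorem mono (hP : Generic P) (h : ∀ v, P v → Q v) : Generic Q :=
  let ⟨Φ, h0, h1⟩ := hP
  ⟨Φ, h0, fun v hv => h v (h1 v hv)⟩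

theorem and (hP : Generic P) (hQ : Generic Q) : Generic fun v => P v ∧ Q v := by
  obtain ⟨Φ, h0, h1⟩ := hP
  obtain ⟨Ψ, h2, h3⟩ := hQ
  refine ⟨Φ * Ψ, mul_ne_zero h0 h2, fun v hv => ?_⟩
  rw [map_mul] at hv
  exact ⟨h1 v (left_ne_zero_of_mul hv), h3 v (right_ne_zero_of_mul hv)⟩

theorem of_forall (h : ∀ v, P v) : Generic P := ⟨1, one_ne_zero, fun v _ => h v⟩

theorem ball {α : Type*} {R : α → (ι → Fin 3 → K) → Prop} (s : Finset α)
    (h : ∀ a ∈ s, Generic (R a)) : Generic fun v => ∀ a ∈ s, R a v := by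
  classical
  induction s using Finset.induction_on with
  | empty => exact of_forall (by simp)
  | insert a s ha ih =>
    refine ((h a (by simp)).and (ih fun b hb => h b (by simp [hb]))).mono fun v hv b hb => ?_
    rcases Finset.mem_insert.1 hb with rfl | hb
    · exact hv.1
    · exact hv.2 b hb

theorem all {α : Type*} [Finite α] {R : α → (ι → Fin 3 → K) → Prop}
    (h : ∀ a, Generic (R a)) : Generic fun v => ∀ a, R a v := by
  have := Fintype.ofFinite α
  exact (ball Finset.univ fun a _ => h a).mono fun v hv a => hv a (Finset.mem_univ a)

theorem imp {p : Prop} (h : p → Generic P) : Generic fun v => p → P v := by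
  by_cases hp : p
  · exact (h hp).mono fun v hv _ => hv
  · exact of_forall fun v h => absurd h hp

theorem exists_vec [Infinite K] (hP : Generic P) : ∃ v, P v := by
  obtain ⟨Φ, h0, h1⟩ := hP
  by_contra! hn
  apply h0
  apply MvPolynomial.funext
  intro x
  by_contra hx
  exact hn (fun i j => x (i, j)) (h1 _ (by simpa using hx))

/-- A polynomial condition that holds somewhere holds in general. -/
theorem of_eval_ne_zero (Φ : MvPolynomial (ι × Fin 3) K) (v₀ : ι → Fin 3 → K)
    (h₀ : eval (fun ij => v₀ ij.1 ij.2) Φ ≠ 0)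
    (h : ∀ v : ι → Fin 3 → K, eval (fun ij => v ij.1 ij.2) Φ ≠ 0 → P v) : Generic P :=
  ⟨Φ, by rintro rfl; simp at h₀, h⟩

theorem forGeneralPoints {n : ℕ} {Q : (Fin (n + 1) → ℙ K (Fin 3 → K)) → Prop}
    {P : (Fin (n + 1) → Fin 3 → K) → Prop} (hP : Generic P)
    (h : ∀ v (hv : ∀ i, v i ≠ 0), P v → Q fun i => Projectivization.mk K (v i) (hv i)) :
    ForGeneralPoints Q :=
  let ⟨Φ, h0, h1⟩ := hP
  ⟨Φ, h0, fun v hv hΦ => h v hv (h1 v hΦ)⟩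

theorem linearIndependent_three [DecidableEq ι] {i j k : ι} (hij : i ≠ j) (hik : i ≠ k)
    (hjk : j ≠ k) :
    Generic fun v : ι → Fin 3 → K => LinearIndependent K ![v i, v j, v k] := by
  let M : Matrix (Fin 3) (Fin 3) (MvPolynomial (ι × Fin 3) K) :=
    Matrix.of fun a b => X (![i, j, k] a, b)
  have hM : ∀ v : ι → Fin 3 → K, eval (fun ij => v ij.1 ij.2) M.det =
      (Matrix.of ![v i, v j, v k]).det := by
    intro v
    rw [RingHom.map_det]
    congr 1
    ext a b
    fin_cases a <;> simp [M]
  obtain ⟨v₀, h0, h1, h2⟩ : ∃ v₀ : ι → Fin 3 → K, v₀ i = Pi.single 0 1 ∧ v₀ j = Pi.single 1 1 ∧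
      v₀ k = Pi.single 2 1 :=
    ⟨fun l => if l = i then Pi.single 0 1 else if l = j then Pi.single 1 1 else Pi.single 2 1,
      by simp, by simp [hij.symm], by simp [hik.symm, hjk.symm]⟩
  refine of_eval_ne_zero M.det v₀ ?_ ?_
  · rw [hM, h0, h1, h2, Matrix.det_fin_three]
    simp
  · intro v hv
    rw [hM] at hv
    exact Matrix.linearIndependent_rows_iff_isUnit.2
      ((Matrix.isUnit_iff_isUnit_det _).2 (isUnit_iff_ne_zero.2 hv))

theorem linearIndependent_two [DecidableEq ι] {i j : ι} (hij : i ≠ j) :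
    Generic fun v : ι → Fin 3 → K => LinearIndependent K ![v i, v j] := by
  refine of_eval_ne_zero (X (i, 0) * X (j, 1) - X (i, 1) * X (j, 0))
    (fun l => if l = i then Pi.single 0 1 else Pi.single 1 1) ?_ ?_
  · simp [hij.symm]
  · intro v hv
    rw [LinearIndependent.pair_iff]
    intro s t h
    have h0 := congrFun h 0
    have h1 := congrFun h 1
    simp at h0 h1 hv
    constructor
    · have : s * (v i 0 * v j 1 - v i 1 * v j 0) = 0 := by
        linear_combination v j 1 * h0 - v j 0 * h1
      exact (mul_eq_zero.1 this).resolve_right hv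
    · have : t * (v i 0 * v j 1 - v i 1 * v j 0) = 0 := by
        linear_combination v i 0 * h1 - v i 1 * h0
      exact (mul_eq_zero.1 this).resolve_right hv

theorem ne_zero [DecidableEq ι] (i : ι) : Generic fun v : ι → Fin 3 → K => v i ≠ 0 := by
  refine of_eval_ne_zero (X (i, 0)) (fun _ => Pi.single 0 1) (by simp) fun v hv h => hv ?_
  simp [h]

end Generic

/-! ## Semicontinuity -/

/-- In a polynomial family of linear maps, the dimension of the kernel is upper semicontinuous. -/
theorem exists_polynomial_finrank_ker_le {V J σ : Type*} [AddCommGroup V] [Module K V]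
    [FiniteDimensional K V] [Finite J] (E : (σ → K) → V →ₗ[K] (J → K))
    (hE : ∀ x j, ∃ P : MvPolynomial σ K, ∀ v, E v x j = eval v P) {r : ℕ} (v₀ : σ → K)
    (h₀ : Module.finrank K (LinearMap.ker (E v₀)) ≤ r) :
    ∃ Φ : MvPolynomial σ K, Φ ≠ 0 ∧
      ∀ v, eval v Φ ≠ 0 → Module.finrank K (LinearMap.ker (E v)) ≤ r := by
  classical
  have := Fintype.ofFinite J
  -- With `W` a complement of the kernel at `v₀` and `L` a left inverse of `E v₀` on `W`, the
  -- determinant of `L ∘ E v` on `W` is a polynomial in `v` with value `1` at `v₀`. Where it is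
  -- nonzero, the kernel of `E v` meets `W` trivially, so its dimension is at most the codimension
  -- of `W`.
  obtain ⟨W, hW⟩ := Submodule.exists_isCompl (LinearMap.ker (E v₀))
  have hinj : LinearMap.ker ((E v₀).comp W.subtype) = ⊥ := by
    rw [LinearMap.ker_eq_bot']
    intro x hx
    have h1 : (x : V) ∈ LinearMap.ker (E v₀) ⊓ W := ⟨hx, x.2⟩
    rw [hW.inf_eq_bot] at h1
    simpa using h1
  obtain ⟨L, hL⟩ := LinearMap.exists_leftInverse_of_injective _ hinj
  let b := Module.finBasis K W
  choose P hP using hE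
  let M : Matrix _ _ (MvPolynomial σ K) := Matrix.of fun a c =>
    ∑ j, C (b.repr (L (Pi.single j 1)) a) * P (b c) j
  have hM : ∀ v, eval v M.det =
      (LinearMap.toMatrix b b (L ∘ₗ (E v).comp W.subtype)).det := by
    intro v
    rw [RingHom.map_det]
    congr 1
    ext a c
    have h1 : E v (b c) = ∑ j, E v (b c) j • (Pi.single j (1 : K) : J → K) := by
      ext k
      simp [Finset.sum_apply, Pi.single_apply]
    rw [LinearMap.toMatrix_apply, LinearMap.comp_apply, LinearMap.comp_apply,
      Submodule.subtype_apply, h1]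
    simp [M, map_sum, hP, mul_comm]
  refine ⟨M.det, ?_, ?_⟩
  · intro h
    have h1 := hM v₀
    rw [h, hL, LinearMap.toMatrix_id] at h1
    simp at h1
  · intro v hv
    rw [hM, LinearMap.det_toMatrix] at hv
    have hdisj : LinearMap.ker (E v) ⊓ W = ⊥ := by
      rw [eq_bot_iff]
      rintro x ⟨hx, hxW⟩
      have h1 : LinearMap.ker (L ∘ₗ (E v).comp W.subtype) = ⊥ :=
        LinearMap.ker_eq_bot_of_injective
          ((LinearMap.equivOfDetNeZero _ hv).injective)
      have h2 : (⟨x, hxW⟩ : W) ∈ LinearMap.ker (L ∘ₗ (E v).comp W.subtype) := by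
        have : E v x = 0 := hx
        simp [LinearMap.mem_ker, this]
      rw [h1] at h2
      simpa using h2
    have h1 := Submodule.finrank_sup_add_finrank_inf_eq (LinearMap.ker (E v)) W
    rw [hdisj, finrank_bot, add_zero] at h1
    have h2 := Submodule.finrank_le (LinearMap.ker (E v) ⊔ W)
    have h3 := Submodule.finrank_add_eq_of_isCompl hW
    omega

/-- The expansion is carried out once around a point with indeterminate coordinates, and specialised
afterwards. -/
theorem exists_polynomial_coeff_translateAt {ι : Type*} (F : MvPolynomial (Fin 3) K) (i : ι)
    (x : Fin 3 →₀ ℕ) : ∃ P : MvPolynomial (ι × Fin 3) K, ∀ v : ι × Fin 3 → K,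
      coeff x (translateAt (fun j => v (i, j)) F) = eval v P := by
  let Ψ : MvPolynomial (Fin 3) K →+* MvPolynomial (Fin 3) (MvPolynomial (ι × Fin 3) K) :=
    eval₂Hom (C.comp C) fun j => C (X (i, j)) + X j
  refine ⟨coeff x (Ψ F), fun v => ?_⟩
  rw [← coeff_map]
  congr 1
  have : (translateAt (fun j => v (i, j))).toRingHom = (MvPolynomial.map (eval v)).comp Ψ := by
    apply MvPolynomial.ringHom_ext
    · intro c
      simp [Ψ, algebraMap_eq]
    · intro j
      simp [Ψ, translateAt]
  exact congrArg (fun f => f F) this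

/-- The dimension of a linear system is minimal at general points. -/
theorem generic_finrank_sys_le {ι : Type*} [Finite ι] {d : ℕ} {m : ι → ℕ} {r : ℕ}
    (v₀ : ι → Fin 3 → K) (h₀ : Module.finrank K (sys d m v₀) ≤ r) :
    Generic fun v : ι → Fin 3 → K => Module.finrank K (sys d m v) ≤ r := by
  let J := Σ i : ι, {x : Fin 3 →₀ ℕ // x.degree < m i}
  have hfin : ∀ i, Finite {x : Fin 3 →₀ ℕ // x.degree < m i} := fun i =>
    ((Finsupp.finite_of_degree_le (σ := Fin 3) (m i)).subset fun x hx =>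
      show x.degree ≤ m i from le_of_lt hx)
  have : Finite J := inferInstance
  let V := homogeneousSubmodule (Fin 3) K d
  -- The system is the kernel of the map sending a form to its Taylor coefficients of order below
  -- the prescribed multiplicities.
  obtain ⟨E, hE⟩ : ∃ E : (ι × Fin 3 → K) → V →ₗ[K] (J → K), ∀ v F j,
      E v F j = coeff j.2.1 (translateAt (fun k => v (j.1, k)) (F : MvPolynomial (Fin 3) K)) :=
    ⟨fun v => LinearMap.pi fun j =>
      (lcoeff K j.2.1).comp ((translateAt fun k => v (j.1, k)).toLinearMap.comp V.subtype),
      fun v F j => by simp⟩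
  have hker : ∀ v : ι → Fin 3 → K, Module.finrank K (sys d m v) =
      Module.finrank K (LinearMap.ker (E fun ij => v ij.1 ij.2)) := by
    intro v
    have : sys d m v = (LinearMap.ker (E fun ij => v ij.1 ij.2)).map V.subtype := by
      ext F
      rw [mem_sys]
      constructor
      · rintro ⟨h1, h2⟩
        refine ⟨⟨F, h1⟩, ?_, rfl⟩
        rw [SetLike.mem_coe, LinearMap.mem_ker]
        ext ⟨i, x, hx⟩
        have h3 := congrArg (coeff x) (h2 i _ hx)
        simpa [hE, coeff_homogeneousComponent] using h3
      · rintro ⟨⟨G, hG⟩, h2, rfl⟩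
        refine ⟨hG, fun i k hk => ?_⟩
        rw [SetLike.mem_coe, LinearMap.mem_ker] at h2
        ext x
        rw [coeff_homogeneousComponent]
        split_ifs with hx
        · have h3 := congrFun h2 ⟨i, x, by omega⟩
          simpa [hE] using h3
        · simp
    rw [this, Submodule.finrank_map_subtype_eq]
  obtain ⟨Φ, h1, h2⟩ := exists_polynomial_finrank_ker_le (r := r) E
    (fun F j => by
      obtain ⟨P, hP⟩ := exists_polynomial_coeff_translateAt (F : MvPolynomial (Fin 3) K) j.1 j.2.1
      exact ⟨P, fun v => (hE v F j).trans (hP v)⟩)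
    (fun ij => v₀ ij.1 ij.2) ((hker v₀).symm.trans_le h₀)
  exact ⟨Φ, h1, fun v hv => (hker v).trans_le (h2 _ hv)⟩

/-! ## Counting conditions -/

/-- The triangular number `m (m + 1) / 2`: the number of conditions imposed by a point of
multiplicity `m`. -/
def tri (m : ℕ) : ℕ := m * (m + 1) / 2

theorem two_mul_tri (m : ℕ) : 2 * tri m = m * (m + 1) :=
  Nat.two_mul_div_two_of_even (Nat.even_mul_succ_self m)

theorem two_mul_tri_int (m : ℕ) : 2 * (tri m : ℤ) = m * (m + 1) := by exact_mod_cast two_mul_tri m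

theorem tri_mono : Monotone tri := fun a b h =>
  Nat.div_le_div_right (Nat.mul_le_mul h (by omega))

theorem tri_add (a b : ℕ) : tri (a + b) = tri a + tri b + a * b := by
  have h1 := two_mul_tri a
  have h2 := two_mul_tri b
  have h3 := two_mul_tri (a + b)
  have h4 : (a + b) * (a + b + 1) = a * (a + 1) + b * (b + 1) + 2 * (a * b) := by ring
  omega

/-- This is the numerical statement that, in degree `a + b + c`, the ideal generated by two coprime
forms of degrees `a` and `b` has codimension `a * b`. -/
theorem tri_add_add (a b c : ℕ) :
    tri (a + b + c + 1) + tri (c + 1) = tri (b + c + 1) + tri (a + c + 1) + a * b := by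
  rw [show a + b + c + 1 = a + (b + (c + 1)) by ring, show b + c + 1 = b + (c + 1) by ring,
    show a + c + 1 = a + (c + 1) by ring]
  simp only [tri_add]
  ring

@[simp] theorem tri_zero : tri 0 = 0 := rfl

theorem sum_range_succ_eq_tri (m : ℕ) : ∑ c ∈ Finset.range m, (c + 1) = tri m := by
  induction m with
  | zero => rfl
  | succ k ih =>
    rw [Finset.sum_range_succ, ih]
    have h1 := two_mul_tri k
    have h2 := two_mul_tri (k + 1)
    nlinarith

/-- The exponents of degree `d` for which the exponents of the last two variables add up to less
than `m`, for `m ≤ d + 1`. -/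
def lowExponents (d m : ℕ) : Finset (Fin 3 →₀ ℕ) :=
  ((Finset.range m).sigma fun c => Finset.HasAntidiagonal.antidiagonal c).image fun x =>
    Finsupp.equivFunOnFinite.symm ![d - x.1, x.2.1, x.2.2]

theorem card_lowExponents (d m : ℕ) : (lowExponents d m).card = tri m := by
  rw [lowExponents, Finset.card_image_of_injOn, Finset.card_sigma]
  · simp [sum_range_succ_eq_tri]
  · rintro ⟨c, a, b⟩ h ⟨c', a', b'⟩ h' e
    simp at h h' e
    obtain ⟨-, rfl, rfl⟩ := e
    obtain ⟨-, rfl⟩ := h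
    obtain ⟨-, rfl⟩ := h'
    rfl

theorem mem_lowExponents {d m : ℕ} (hm : m ≤ d + 1) (s : Fin 3 →₀ ℕ) :
    s ∈ lowExponents d m ↔ s 0 + s 1 + s 2 = d ∧ d < s 0 + m := by
  simp only [lowExponents, Finset.mem_image, Finset.mem_sigma, Finset.mem_range,
    Finset.HasAntidiagonal.mem_antidiagonal]
  constructor
  · rintro ⟨⟨c, a, b⟩, ⟨h1, h2⟩, rfl⟩
    simp at h1 h2 ⊢
    omega
  · rintro ⟨h1, h2⟩
    refine ⟨⟨s 1 + s 2, s 1, s 2⟩, ⟨by simp; omega, rfl⟩, ?_⟩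
    ext i
    fin_cases i <;> simp
    omega

theorem finrank_restrictSupport (T : Finset (Fin 3 →₀ ℕ)) :
    Module.finrank K (restrictSupport K (T : Set (Fin 3 →₀ ℕ))) = T.card := by
  rw [Module.finrank_eq_card_basis (basisRestrictSupport K (T : Set (Fin 3 →₀ ℕ)))]
  simp

theorem homogeneousSubmodule_eq_restrictSupport (d : ℕ) :
    homogeneousSubmodule (Fin 3) K d =
      restrictSupport K (lowExponents d (d + 1) : Set (Fin 3 →₀ ℕ)) := by
  ext F
  rw [mem_restrictSupport_iff, mem_homogeneousSubmodule]
  constructor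
  · intro h s hs
    have := sum_of_mem_support h hs
    rw [Finset.mem_coe, mem_lowExponents le_rfl]
    omega
  · intro h s hs
    have := h (mem_support_iff.2 hs)
    rw [Finset.mem_coe, mem_lowExponents le_rfl] at this
    rw [← this.1, Finsupp.weight_apply, Finsupp.sum_fintype _ _ (by simp), Fin.sum_univ_three]
    simp

theorem finrank_homogeneousSubmodule (d : ℕ) :
    Module.finrank K (homogeneousSubmodule (Fin 3) K d) = tri (d + 1) := by
  rw [homogeneousSubmodule_eq_restrictSupport, finrank_restrictSupport, card_lowExponents]

theorem finrank_inf_multGE_single {d m : ℕ} (hm : m ≤ d + 1) :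
    Module.finrank K ↥(homogeneousSubmodule (Fin 3) K d ⊓ multGE (Pi.single 0 1) m) + tri m =
      tri (d + 1) := by
  have h : homogeneousSubmodule (Fin 3) K d ⊓ multGE (Pi.single 0 1) m =
      restrictSupport K ((lowExponents d (d + 1) \ lowExponents d m : Finset _) : Set _) := by
    ext F
    rw [Submodule.mem_inf, homogeneousSubmodule_eq_restrictSupport]
    constructor
    · rintro ⟨h1, h2⟩
      have h1' : F.IsHomogeneous d := by
        rwa [← homogeneousSubmodule_eq_restrictSupport, mem_homogeneousSubmodule] at h1
      rw [mem_multGE_single_iff h1'] at h2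
      intro s hs
      have := h2 s hs
      rw [Finset.mem_coe, Finset.mem_sdiff, mem_lowExponents hm]
      exact ⟨h1 hs, by omega⟩
    · intro h1
      have h1' : F ∈ restrictSupport K (lowExponents d (d + 1) : Set (Fin 3 →₀ ℕ)) :=
        fun s hs => by
          have := h1 hs
          rw [Finset.mem_coe, Finset.mem_sdiff] at this
          exact this.1
      refine ⟨h1', ?_⟩
      rw [← homogeneousSubmodule_eq_restrictSupport, mem_homogeneousSubmodule] at h1'
      rw [mem_multGE_single_iff h1']
      intro s hs
      have := h1 hs
      rw [Finset.mem_coe, Finset.mem_sdiff, mem_lowExponents hm] at this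
      have h3 := sum_of_mem_support h1' hs
      omega
  have hsub : lowExponents d m ⊆ lowExponents d (d + 1) := by
    intro s hs
    rw [mem_lowExponents hm] at hs
    rw [mem_lowExponents le_rfl]
    omega
  rw [h, finrank_restrictSupport, Finset.card_sdiff_of_subset hsub, card_lowExponents,
    card_lowExponents]
  have := tri_mono hm
  omega

theorem exists_linearEquiv_apply_single {v : Fin 3 → K} (hv : v ≠ 0) :
    ∃ g : (Fin 3 → K) ≃ₗ[K] (Fin 3 → K), g (Pi.single 0 1) = v := by
  obtain ⟨w, hw⟩ := exists_linearIndependent_two hv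
  obtain ⟨u, hu⟩ := exists_linearIndependent_three hw
  obtain ⟨g, hg, -, -⟩ := exists_linearEquiv hu
  exact ⟨g, hg⟩

/-- A point of multiplicity `m ≤ d + 1` imposes `m (m + 1) / 2` conditions on forms of
degree `d`. -/
theorem finrank_inf_multGE {v : Fin 3 → K} (hv : v ≠ 0) {d m : ℕ} (hm : m ≤ d + 1) :
    Module.finrank K ↥(homogeneousSubmodule (Fin 3) K d ⊓ multGE v m) + tri m = tri (d + 1) := by
  obtain ⟨g, rfl⟩ := exists_linearEquiv_apply_single hv
  have h := finrank_sys_linearEquiv d (fun _ : Unit => m) (fun _ => Pi.single 0 1) g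
  have hs : ∀ w : Fin 3 → K, sys d (fun _ : Unit => m) (fun _ => w) =
      homogeneousSubmodule (Fin 3) K d ⊓ multGE w m := fun w => by
    ext F
    simp [mem_sys]
  rw [hs, hs] at h
  rw [h]
  exact finrank_inf_multGE_single hm

theorem tri_le_finrank_inf_multGE {v : Fin 3 → K} (hv : v ≠ 0) (d m : ℕ) :
    tri (d + 1) ≤ Module.finrank K ↥(homogeneousSubmodule (Fin 3) K d ⊓ multGE v m) + tri m := by
  by_cases hm : m ≤ d + 1
  · exact (finrank_inf_multGE hv hm).ge
  · exact (tri_mono (by omega)).trans (Nat.le_add_left _ _)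

theorem sys_indicator_insert {ι : Type*} [DecidableEq ι] (d : ℕ) (m : ι → ℕ) (v : ι → Fin 3 → K)
    {i : ι} {s : Finset ι} :
    sys d (fun j => if j ∈ insert i s then m j else 0) v =
      sys d (fun j => if j ∈ s then m j else 0) v ⊓
        (homogeneousSubmodule (Fin 3) K d ⊓ multGE (v i) (m i)) := by
  ext F
  simp only [Submodule.mem_inf, mem_sys, mem_homogeneousSubmodule]
  constructor
  · rintro ⟨h1, h2⟩
    refine ⟨⟨h1, fun j => ?_⟩, h1, by simpa using h2 i⟩
    by_cases hj : j ∈ s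
    · simpa [hj] using h2 j
    · simp [hj, mem_multGE_zero]
  · rintro ⟨⟨h1, h2⟩, -, h3⟩
    refine ⟨h1, fun j => ?_⟩
    by_cases hj : j = i
    · subst hj; simpa using h3
    · simpa [hj] using h2 j

theorem sys_of_mult_eq_zero {ι : Type*} (d : ℕ) {m : ι → ℕ} (hm : ∀ i, m i = 0)
    (v : ι → Fin 3 → K) : sys d m v = homogeneousSubmodule (Fin 3) K d := by
  ext F
  simp [mem_sys, hm, mem_multGE_zero]

/-- The dimension of a linear system is at least the expected one. -/
theorem tri_le_finrank_sys {ι : Type*} [Fintype ι] (d : ℕ) (m : ι → ℕ) {v : ι → Fin 3 → K}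
    (hv : ∀ i, v i ≠ 0) : tri (d + 1) ≤ Module.finrank K (sys d m v) + ∑ i, tri (m i) := by
  classical
  have key : ∀ s : Finset ι, tri (d + 1) ≤
      Module.finrank K (sys d (fun j => if j ∈ s then m j else 0) v) + ∑ i ∈ s, tri (m i) := by
    intro s
    induction s using Finset.induction_on with
    | empty =>
      rw [sys_of_mult_eq_zero d (by simp), finrank_homogeneousSubmodule]
      simp
    | insert i s hi ih =>
      rw [sys_indicator_insert, Finset.sum_insert hi]
      have h1 := Submodule.finrank_sup_add_finrank_inf_eq
        (sys d (fun j => if j ∈ s then m j else 0) v)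
        (homogeneousSubmodule (Fin 3) K d ⊓ multGE (v i) (m i))
      have h2 : Module.finrank K ↥(sys d (fun j => if j ∈ s then m j else 0) v ⊔
          (homogeneousSubmodule (Fin 3) K d ⊓ multGE (v i) (m i))) ≤ tri (d + 1) := by
        rw [← finrank_homogeneousSubmodule (K := K)]
        exact Submodule.finrank_mono (sup_le inf_le_left inf_le_left)
      have h3 := tri_le_finrank_inf_multGE (hv i) d (m i)
      omega
  have := key Finset.univ
  have e : (fun j => if j ∈ Finset.univ then m j else 0) = m := by simp
  rwa [e] at this

theorem finrank_map_mulLeft {F : MvPolynomial (Fin 3) K} (hF : F ≠ 0)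
    (S : Submodule K (MvPolynomial (Fin 3) K)) :
    Module.finrank K (S.map (LinearMap.mulLeft K F)) = Module.finrank K S :=
  (Submodule.equivMapOfInjective _ (mul_right_injective₀ hF) S).finrank_eq.symm

instance finiteDimensional_inf_multGE (d m : ℕ) (v : Fin 3 → K) :
    FiniteDimensional K ↥(homogeneousSubmodule (Fin 3) K d ⊓ multGE v m) :=
  Submodule.finiteDimensional_of_le (S₂ := homogeneousSubmodule (Fin 3) K d) inf_le_left

theorem exists_linear_form {v w : Fin 3 → K} (h : LinearIndependent K ![v, w]) :
    ∃ l : MvPolynomial (Fin 3) K, l.IsHomogeneous 1 ∧ eval v l = 0 ∧ eval w l ≠ 0 := by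
  obtain ⟨u, hu⟩ := exists_linearIndependent_three h
  obtain ⟨g, rfl, rfl, -⟩ := exists_linearEquiv hu
  refine ⟨linSubst g.symm (X 1), isHomogeneous_linSubst _ (isHomogeneous_X _ _), ?_, ?_⟩ <;>
  · rw [eval_linSubst]
    simp

/-- Points impose independent conditions on forms of large degree. -/
theorem finrank_sys_of_sum_le {ι : Type*} [Fintype ι] {d : ℕ} {m : ι → ℕ} {v : ι → Fin 3 → K}
    (hv : ∀ i, v i ≠ 0) (hind : ∀ i j, i ≠ j → LinearIndependent K ![v i, v j])
    (hd : ∑ i, m i ≤ d + 1) :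
    Module.finrank K (sys d m v) + ∑ i, tri (m i) = tri (d + 1) := by
  classical
  have key : ∀ s : Finset ι, ∑ i ∈ s, m i ≤ d + 1 →
      Module.finrank K (sys d (fun j => if j ∈ s then m j else 0) v) + ∑ i ∈ s, tri (m i) =
        tri (d + 1) := by
    intro s
    induction s using Finset.induction_on with
    | empty =>
      intro _
      rw [sys_of_mult_eq_zero d (by simp), finrank_homogeneousSubmodule]
      simp
    | insert i s hi ih =>
      intro hd
      rw [Finset.sum_insert hi] at hd
      have ih := ih (by omega)
      rw [sys_indicator_insert, Finset.sum_insert hi]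
      set A := sys d (fun j => if j ∈ s then m j else 0) v with hA
      set B := homogeneousSubmodule (Fin 3) K d ⊓ multGE (v i) (m i) with hB
      have h1 := Submodule.finrank_sup_add_finrank_inf_eq A B
      have h3 := finrank_inf_multGE (hv i) (d := d) (m := m i) (by omega)
      rw [← hB] at h3
      have h2 : Module.finrank K ↥(A ⊔ B) = tri (d + 1) := by
        apply le_antisymm
        · rw [← finrank_homogeneousSubmodule (K := K)]
          exact Submodule.finrank_mono (sup_le inf_le_left inf_le_left)
        -- For `m i = 0` the subspace `B` contains all forms. Otherwise `q ≤ d`, so that `d - q` is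
        -- a genuine difference and multiples of `Q` have degree `d`.
        by_cases hmi : m i = 0
        · have : Module.finrank K B ≤ Module.finrank K ↥(A ⊔ B) :=
            Submodule.finrank_mono le_sup_right
          rw [hmi, tri_zero] at h3
          omega
        have hl : ∀ j, ∃ l : MvPolynomial (Fin 3) K, l.IsHomogeneous 1 ∧
            (j ∈ s → eval (v j) l = 0 ∧ eval (v i) l ≠ 0) := by
          intro j
          by_cases hj : j ∈ s
          · obtain ⟨l, h1, h2⟩ := exists_linear_form (hind j i (by rintro rfl; exact hi hj))
            exact ⟨l, h1, fun _ => h2⟩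
          · exact ⟨0, isHomogeneous_zero _ _ _, fun h => absurd h hj⟩
        choose l hl1 hl2 using hl
        -- Multiples of this product of lines lie in `A`, and it does not vanish at `v i`. On these
        -- multiples the condition at `v i` concerns only the cofactor of degree `d - q ≥ m i - 1`,
        -- where it costs the full `tri (m i)`. So the multiples of `Q` and `B` already span all
        -- forms.
        set Q := ∏ j ∈ s, l j ^ m j with hQ
        set q := ∑ j ∈ s, m j with hq
        have hQhom : Q.IsHomogeneous q := by
          have := IsHomogeneous.prod s (fun j => l j ^ m j) (fun j => 1 * m j)
            fun j _ => (hl1 j).pow (m j)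
          simpa using this
        have hQi : eval (v i) Q ≠ 0 := by
          rw [hQ, map_prod]
          exact Finset.prod_ne_zero_iff.2 fun j hj => by
            rw [map_pow]; exact pow_ne_zero _ (hl2 j hj).2
        have hQ0 : Q ≠ 0 := by rintro h; simp [h] at hQi
        set A' := (homogeneousSubmodule (Fin 3) K (d - q)).map (LinearMap.mulLeft K Q) with hA'
        have hAA : A' ≤ A := by
          rintro _ ⟨G, hG, rfl⟩
          rw [hA, mem_sys]
          refine ⟨?_, fun j => ?_⟩
          · have := hQhom.mul (show G.IsHomogeneous (d - q) from hG)
            rwa [Nat.add_sub_cancel' (by omega)] at this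
          · split_ifs with hj
            · rw [mem_multGE_iff, LinearMap.mulLeft_apply, hQ, ← Finset.mul_prod_erase s _ hj,
                mul_assoc]
              exact Ideal.mul_mem_right _ _ (Ideal.pow_mem_pow
                (show l j ∈ idealAt (v j) from (hl2 j hj).1) _)
            · exact mem_multGE_zero
        have hinf : A' ⊓ B = (homogeneousSubmodule (Fin 3) K (d - q) ⊓ multGE (v i) (m i)).map
            (LinearMap.mulLeft K Q) := by
          ext G
          constructor
          · rintro ⟨⟨G, hG, rfl⟩, -, h5⟩
            exact ⟨G, ⟨hG, mem_multGE_of_mul_mem hQi h5⟩, rfl⟩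
          · rintro ⟨G, ⟨hG, h5⟩, rfl⟩
            refine ⟨⟨G, hG, rfl⟩, ?_, ?_⟩
            · have := hQhom.mul (show G.IsHomogeneous (d - q) from hG)
              rwa [Nat.add_sub_cancel' (by omega)] at this
            · have := mul_mem_multGE (mem_multGE_zero (v := v i) (F := Q)) h5
              rwa [zero_add] at this
        have h5 := Submodule.finrank_sup_add_finrank_inf_eq A' B
        rw [hinf, finrank_map_mulLeft hQ0, hA', finrank_map_mulLeft hQ0,
          finrank_homogeneousSubmodule, ← hA'] at h5
        have h6 := finrank_inf_multGE (hv i) (d := d - q) (m := m i) (by omega)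
        have h7 : Module.finrank K ↥(A' ⊔ B) ≤ Module.finrank K ↥(A ⊔ B) :=
          Submodule.finrank_mono (sup_le_sup_right hAA _)
        omega
      omega
  have := key Finset.univ hd
  have e : (fun j => if j ∈ Finset.univ then m j else 0) = m := by simp
  rwa [e] at this

/-- A form of degree `d` has no point of multiplicity larger than `d`. -/
theorem mult_le_degree {F : MvPolynomial (Fin 3) K} (hF : F ≠ 0) {d m : ℕ}
    (hd : F.IsHomogeneous d) {v : Fin 3 → K} (hv : v ≠ 0) (h : F ∈ multGE v m) : m ≤ d := by
  obtain ⟨g, rfl⟩ := exists_linearEquiv_apply_single hv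
  rw [← linSubst_mem_multGE_iff, mem_multGE_single_iff (isHomogeneous_linSubst g hd)] at h
  obtain ⟨s, hs⟩ := support_nonempty.2
    (fun e => hF ((linSubst_injective g) (e.trans (map_zero _).symm)))
  have := h s hs
  omega

/-! ## Bézout's inequality -/

/-- Two plane curves without common component, of degrees `a` and `b` and with multiplicities
`μ i` and `ν i` at distinct points, satisfy `∑ μ i * ν i ≤ a * b`. -/
theorem sum_mul_le_of_coprime {ι : Type*} [Fintype ι] {a b : ℕ} {μ ν : ι → ℕ}
    {v : ι → Fin 3 → K} (hv : ∀ i, v i ≠ 0)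
    (hind : ∀ i j, i ≠ j → LinearIndependent K ![v i, v j])
    {F G : MvPolynomial (Fin 3) K} (hF : F ∈ sys a μ v) (hG : G ∈ sys b ν v) (hF0 : F ≠ 0)
    (hG0 : G ≠ 0) (hrel : IsRelPrime F G) : ∑ i, μ i * ν i ≤ a * b := by
  rw [mem_sys] at hF hG
  -- In a degree `t` this large the points impose independent conditions. There the multiples of `F`
  -- and `G` span a space of codimension `a * b`. Add the space `I` of forms with multiplicities `μ
  -- i + ν i`: it contains `F` times forms with multiplicities `ν i` and `G` times forms with
  -- multiplicities `μ i`. Hence the enlarged span still has codimension at least the sum of the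
  -- `tri (μ i + ν i) - tri (μ i) - tri (ν i)`, which are the products `μ i * ν i`.
  obtain ⟨t, ht⟩ : ∃ t, t = ∑ i, (μ i + ν i) + a + b := ⟨_, rfl⟩
  obtain ⟨U, hU⟩ : ∃ U, U = (homogeneousSubmodule (Fin 3) K (t - a)).map (LinearMap.mulLeft K F) :=
    ⟨_, rfl⟩
  obtain ⟨W, hW⟩ : ∃ W, W = (homogeneousSubmodule (Fin 3) K (t - b)).map (LinearMap.mulLeft K G) :=
    ⟨_, rfl⟩
  obtain ⟨I, hI⟩ : ∃ I, I = sys t (fun i => μ i + ν i) v := ⟨_, rfl⟩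
  have hUt : U ≤ homogeneousSubmodule (Fin 3) K t := by
    rw [hU]
    rintro _ ⟨A, hA, rfl⟩
    have := hF.1.mul (show A.IsHomogeneous (t - a) from hA)
    rwa [Nat.add_sub_cancel' (by omega)] at this
  have hWt : W ≤ homogeneousSubmodule (Fin 3) K t := by
    rw [hW]
    rintro _ ⟨A, hA, rfl⟩
    have := hG.1.mul (show A.IsHomogeneous (t - b) from hA)
    rwa [Nat.add_sub_cancel' (by omega)] at this
  have hUW : U ⊓ W = (homogeneousSubmodule (Fin 3) K (t - a - b)).map
      (LinearMap.mulLeft K (F * G)) := by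
    rw [hU, hW]
    ext H
    constructor
    · rintro ⟨⟨A, hA, rfl⟩, B, hB, e⟩
      simp only [LinearMap.mulLeft_apply] at e
      have h1 : G ∣ A := (hrel.symm.dvd_of_dvd_mul_left ⟨B, e.symm⟩)
      obtain ⟨A', rfl⟩ := h1
      refine ⟨A', ?_, by simp⟩
      rw [SetLike.mem_coe, mem_homogeneousSubmodule] at hA ⊢
      refine isHomogeneous_of_mul_left hG0 hG.1 ?_
      rwa [show b + (t - a - b) = t - a by omega]
    · rintro ⟨A, hA, rfl⟩
      refine ⟨⟨G * A, ?_, by simp⟩, ⟨F * A, ?_, by simp; ring⟩⟩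
      · have := hG.1.mul (show A.IsHomogeneous (t - a - b) from hA)
        rwa [Nat.add_sub_cancel' (by omega)] at this
      · have := hF.1.mul (show A.IsHomogeneous (t - a - b) from hA)
        rwa [show a + (t - a - b) = t - b by omega] at this
  have : FiniteDimensional K U := Submodule.finiteDimensional_of_le hUt
  have : FiniteDimensional K W := Submodule.finiteDimensional_of_le hWt
  have : FiniteDimensional K I := hI ▸ finiteDimensional_sys _ _ _
  have hUI : (sys (t - a) ν v).map (LinearMap.mulLeft K F) ≤ U ⊓ I := by
    rintro _ ⟨A, hA, rfl⟩
    rw [SetLike.mem_coe, mem_sys] at hA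
    have hmem := Submodule.mem_map_of_mem (f := LinearMap.mulLeft K F)
      ((mem_homogeneousSubmodule _ _).2 hA.1)
    rw [← hU] at hmem
    refine ⟨hmem, ?_⟩
    rw [hI, SetLike.mem_coe, mem_sys]
    exact ⟨hUt hmem, fun i => mul_mem_multGE (hF.2 i) (hA.2 i)⟩
  have hWI : (sys (t - b) μ v).map (LinearMap.mulLeft K G) ≤ W ⊓ I := by
    rintro _ ⟨A, hA, rfl⟩
    rw [SetLike.mem_coe, mem_sys] at hA
    have hmem := Submodule.mem_map_of_mem (f := LinearMap.mulLeft K G)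
      ((mem_homogeneousSubmodule _ _).2 hA.1)
    rw [← hW] at hmem
    refine ⟨hmem, ?_⟩
    rw [hI, SetLike.mem_coe, mem_sys]
    exact ⟨hWt hmem, fun i => by
      have := mul_mem_multGE (hG.2 i) (hA.2 i); rwa [add_comm] at this⟩
  have e1 := Submodule.finrank_sup_add_finrank_inf_eq U W
  rw [hUW, finrank_map_mulLeft (mul_ne_zero hF0 hG0), finrank_homogeneousSubmodule] at e1
  have e2 := Submodule.finrank_sup_add_finrank_inf_eq U I
  have e3 := Submodule.finrank_sup_add_finrank_inf_eq (U ⊔ I) W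
  have e4 : Module.finrank K (sys (t - a) ν v) ≤ Module.finrank K ↥(U ⊓ I) := by
    rw [← finrank_map_mulLeft hF0]; exact Submodule.finrank_mono hUI
  have e5 : Module.finrank K (sys (t - b) μ v) ≤ Module.finrank K ↥((U ⊔ I) ⊓ W) := by
    rw [← finrank_map_mulLeft hG0]
    refine Submodule.finrank_mono (hWI.trans ?_)
    rw [inf_comm]
    exact inf_le_inf_right _ le_sup_right
  have e6 : Module.finrank K ↥(U ⊔ W) ≤ Module.finrank K ↥(U ⊔ I ⊔ W) :=
    Submodule.finrank_mono (sup_le_sup_right le_sup_left _)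
  have e7 := tri_le_finrank_sys (t - a) ν hv
  have e8 := tri_le_finrank_sys (t - b) μ hv
  have e9 := finrank_sys_of_sum_le (d := t) (m := fun i => μ i + ν i) hv hind (by omega)
  have eU : Module.finrank K U = tri (t - a + 1) := by
    rw [hU, finrank_map_mulLeft hF0, finrank_homogeneousSubmodule]
  have eW : Module.finrank K W = tri (t - b + 1) := by
    rw [hW, finrank_map_mulLeft hG0, finrank_homogeneousSubmodule]
  rw [← hI] at e9
  have e10 : ∑ i, tri (μ i + ν i) = ∑ i, tri (μ i) + ∑ i, tri (ν i) + ∑ i, μ i * ν i := by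
    rw [← Finset.sum_add_distrib, ← Finset.sum_add_distrib]
    refine Finset.sum_congr rfl fun i _ => ?_
    exact tri_add _ _
  obtain ⟨c, hc⟩ : ∃ c, t = a + b + c := ⟨t - a - b, by omega⟩
  have e11 : tri (t + 1) + tri (t - a - b + 1) = tri (t - a + 1) + tri (t - b + 1) + a * b := by
    rw [show t - a - b = c by omega, show t - a = b + c by omega, show t - b = a + c by omega, hc]
    exact tri_add_add a b c
  omega

/-! ## The quadratic Cremona transformation -/

/-- The substitution `(x : y : z) ↦ (y z : x z : x y)`. -/
def cremona : MvPolynomial (Fin 3) K →ₐ[K] MvPolynomial (Fin 3) K :=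
  aeval ![X 1 * X 2, X 0 * X 2, X 0 * X 1]

theorem cremona_monomial {s : Fin 3 →₀ ℕ} {c : K} :
    cremona (monomial s c) =
      monomial (Finsupp.equivFunOnFinite.symm ![s 1 + s 2, s 0 + s 2, s 0 + s 1]) c := by
  rw [cremona, aeval_monomial, monomial_eq, algebraMap_eq, Finsupp.prod_fintype _ _ (by simp),
    Finsupp.prod_fintype _ _ (by simp), Fin.prod_univ_three, Fin.prod_univ_three]
  simp
  left
  ring

theorem cremona_cremona {d : ℕ} {F : MvPolynomial (Fin 3) K} (hF : F.IsHomogeneous d) :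
    cremona (cremona F) = (X 0 * X 1 * X 2) ^ d * F := by
  rw [← AlgHom.comp_apply]
  have : (cremona : MvPolynomial (Fin 3) K →ₐ[K] _).comp cremona =
      aeval (fun i => (X 0 * X 1 * X 2 : MvPolynomial (Fin 3) K) * X i) := by
    apply MvPolynomial.algHom_ext
    intro i
    fin_cases i <;> simp [cremona] <;> ring
  rw [this, aeval_mul_of_isHomogeneous hF, aeval_X_left_apply]

/-- The effect of the Cremona transformation on a form with assigned multiplicities at the
vertices of the coordinate triangle. -/
theorem exists_cremona_factor {F : MvPolynomial (Fin 3) K} {d d' : ℕ} {m : Fin 3 → ℕ}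
    (hF : F.IsHomogeneous d) (hm : ∀ i, m i ≤ d) (hv : ∀ i, F ∈ multGE (Pi.single i 1) (m i))
    (hd : d' + m 0 + m 1 + m 2 = 2 * d) :
    ∃ F' : MvPolynomial (Fin 3) K,
      cremona F = (X 0 ^ m 0 * X 1 ^ m 1 * X 2 ^ m 2) * F' ∧ F'.IsHomogeneous d' ∧
      F' ∈ multGE (Pi.single 0 1) (d - m 1 - m 2) ∧
      F' ∈ multGE (Pi.single 1 1) (d - m 0 - m 2) ∧
      F' ∈ multGE (Pi.single 2 1) (d - m 0 - m 1) := by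
  have hs : ∀ s ∈ F.support, s 0 + m 0 ≤ d ∧ s 1 + m 1 ≤ d ∧ s 2 + m 2 ≤ d ∧
      s 0 + s 1 + s 2 = d := fun s h =>
    ⟨(mem_multGE_single_iff hF 0).1 (hv 0) s h, (mem_multGE_single_iff hF 1).1 (hv 1) s h,
      (mem_multGE_single_iff hF 2).1 (hv 2) s h, sum_of_mem_support hF h⟩
  -- For a monomial of degree `d`, the transformed exponents `s 1 + s 2`, `s 0 + s 2`, `s 0 + s 1`
  -- are `d - s i`; dividing by the fixed monomial subtracts `m i`.
  let e : (Fin 3 →₀ ℕ) → (Fin 3 →₀ ℕ) := fun s =>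
    Finsupp.equivFunOnFinite.symm ![d - m 0 - s 0, d - m 1 - s 1, d - m 2 - s 2]
  have hhom : ∀ s ∈ F.support, (monomial (e s) (coeff s F)).IsHomogeneous d' := by
    intro s h
    apply isHomogeneous_monomial
    have := hs s h
    rw [degree_fin_three]
    simp [e]
    omega
  have hmult : ∀ i : Fin 3, ∀ k, (∀ s ∈ F.support, e s i + k ≤ d') →
      (∑ s ∈ F.support, monomial (e s) (coeff s F)) ∈ multGE (Pi.single i 1) k := by
    intro i k h
    refine Submodule.sum_mem _ fun s h1 => ?_
    rw [mem_multGE_single_iff (hhom s h1)]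
    intro t ht
    rw [Finset.mem_singleton.1 (support_monomial_subset ht)]
    exact h s h1
  refine ⟨∑ s ∈ F.support, monomial (e s) (coeff s F), ?_, IsHomogeneous.sum _ _ _ hhom,
    hmult 0 _ fun s h => ?_, hmult 1 _ fun s h => ?_, hmult 2 _ fun s h => ?_⟩
  · have hX : (X 0 ^ m 0 * X 1 ^ m 1 * X 2 ^ m 2 : MvPolynomial (Fin 3) K) =
        monomial (Finsupp.equivFunOnFinite.symm m) 1 := by
      rw [monomial_eq, Finsupp.prod_fintype _ _ (by simp), Fin.prod_univ_three]
      simp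
    rw [hX, Finset.mul_sum]
    conv_lhs => rw [F.as_sum]
    rw [map_sum]
    refine Finset.sum_congr rfl fun s h => ?_
    rw [cremona_monomial, monomial_mul, one_mul]
    congr 2
    have := hs s h
    ext i
    fin_cases i <;> simp [e] <;> omega
  all_goals
    have := hs s h
    have := hm 0
    have := hm 1
    have := hm 2
    simp [e]
    omega

/-- The value at `w` of the quadratic transformation. -/
def cremonaPt (w : Fin 3 → K) : Fin 3 → K := ![w 1 * w 2, w 0 * w 2, w 0 * w 1]

/-- On forms the substitution is an involution up to a power of the product of the variables. -/
theorem cremona_injOn_homogeneous {d : ℕ} {F : MvPolynomial (Fin 3) K} (hF : F.IsHomogeneous d)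
    (h : cremona F = 0) : F = 0 := by
  have h1 := cremona_cremona hF
  rw [h, map_zero, eq_comm, mul_eq_zero] at h1
  exact h1.resolve_left (pow_ne_zero _ (by simp [X_ne_zero]))

/-! ### Upper bounds for dimensions at general points -/

/-- Some tuple of vectors has a system of vectorial dimension at most `r`, so that the same holds
for general tuples. -/
def Gen (K : Type*) [Field K] {ι : Type*} (d : ℕ) (m : ι → ℕ) (r : ℕ) : Prop :=
  ∃ v : ι → Fin 3 → K, Module.finrank K (sys d m v) ≤ r

theorem Gen.mono {ι : Type*} {d : ℕ} {m m' : ι → ℕ} {r r' : ℕ} (h : Gen K d m r) (hm : m ≤ m')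
    (hr : r ≤ r') : Gen K d m' r' :=
  let ⟨v, hv⟩ := h
  ⟨v, (Submodule.finrank_mono (sys_antitone hm v)).trans (hv.trans hr)⟩

theorem Gen.generic {ι : Type*} [Finite ι] {d : ℕ} {m : ι → ℕ} {r : ℕ} (h : Gen K d m r) :
    Generic fun v : ι → Fin 3 → K => Module.finrank K (sys d m v) ≤ r :=
  let ⟨v, hv⟩ := h
  generic_finrank_sys_le v hv

/-- Dropping a point without multiplicity. -/
theorem Gen.of_option {ι : Type*} {d : ℕ} {m : Option ι → ℕ} {r : ℕ} (h : Gen K d m r)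
    (hm : m none = 0) : Gen K d (fun i => m (some i)) r := by
  obtain ⟨v, hv⟩ := h
  refine ⟨fun i => v (some i), le_trans (le_of_eq ?_) hv⟩
  have : sys d (fun i => m (some i)) (fun i => v (some i)) = sys d m v := by
    ext F
    simp only [mem_sys]
    refine and_congr_right fun _ => ⟨fun h i => ?_, fun h i => h _⟩
    cases i with
    | none => rw [hm]; exact mem_multGE_zero
    | some i => exact h i
  rw [this]

/-- `Gen` does not require distinct points, so a tuple of coinciding vectors serves as witness: a
nonzero form has no point of multiplicity above its degree. -/
theorem Gen.of_degree_lt {ι : Type*} {d : ℕ} {m : ι → ℕ} {i : ι} (h : d < m i) (r : ℕ) :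
    Gen K d m r := by
  refine ⟨fun _ => Pi.single 0 1, ?_⟩
  have : sys d m (fun _ => Pi.single 0 (1 : K)) = ⊥ := by
    rw [eq_bot_iff]
    intro F hF
    rw [mem_sys] at hF
    by_contra hne
    have := mult_le_degree hne hF.1 (by simp) (hF.2 i)
    omega
  rw [this]
  simp

/-- A general simple point imposes one condition on a nonempty system. -/
theorem Gen.update_one [Infinite K] {ι : Type*} [DecidableEq ι] {d : ℕ} {m : ι → ℕ} {i : ι}
    {r : ℕ} (h : Gen K d (Function.update m i 0) (r + 1)) : Gen K d (Function.update m i 1) r := by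
  obtain ⟨v, hv⟩ := h
  by_cases hb : sys d (Function.update m i 0) v = ⊥
  · refine ⟨v, ?_⟩
    have : sys d (Function.update m i 1) v ≤ sys d (Function.update m i 0) v :=
      sys_antitone (by intro j; by_cases hj : j = i <;> simp [hj]) v
    rw [hb, le_bot_iff] at this
    rw [this]
    simp
  · obtain ⟨F, hF, hF0⟩ := (Submodule.ne_bot_iff _).1 hb
    obtain ⟨q, hq⟩ : ∃ q : Fin 3 → K, eval q F ≠ 0 := by
      by_contra! hn
      exact hF0 (MvPolynomial.funext fun x => by rw [hn, map_zero])
    refine ⟨Function.update v i q, ?_⟩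
    have hlt : sys d (Function.update m i 1) (Function.update v i q) <
        sys d (Function.update m i 0) v := by
      refine lt_of_le_of_ne (fun G hG => ?_) fun e => ?_
      · rw [mem_sys] at hG ⊢
        refine ⟨hG.1, fun j => ?_⟩
        by_cases hj : j = i
        · subst hj
          simpa using mem_multGE_zero
        · simpa [hj] using hG.2 j
      · rw [← e, mem_sys] at hF
        have := hF.2 i
        rw [Function.update_self, Function.update_self, mem_multGE_one] at this
        exact hq this
    have := Submodule.finrank_lt_finrank_of_lt hlt
    omega

theorem linearIndependent_of_apply (g : (Fin 3 → K) ≃ₗ[K] (Fin 3 → K)) {x y z : Fin 3 → K}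
    (h : LinearIndependent K ![g x, g y, g z]) : LinearIndependent K ![x, y, z] := by
  have h1 : ![g x, g y, g z] = g ∘ ![x, y, z] := by
    ext a
    fin_cases a <;> rfl
  rw [h1] at h
  exact LinearIndependent.of_comp g.toLinearMap h

theorem apply_ne_zero_of_linearIndependent_zero {w : Fin 3 → K}
    (h : LinearIndependent K ![w, Pi.single 1 1, Pi.single 2 1]) : w 0 ≠ 0 := by
  intro hw
  have h1 := Fintype.linearIndependent_iff.1 h ![1, -w 1, -w 2] (by
    ext b; fin_cases b <;> simp [Fin.sum_univ_three, hw]) 0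
  simp at h1

theorem apply_ne_zero_of_linearIndependent_one {w : Fin 3 → K}
    (h : LinearIndependent K ![Pi.single 0 1, w, Pi.single 2 1]) : w 1 ≠ 0 := by
  intro hw
  have h1 := Fintype.linearIndependent_iff.1 h ![-w 0, 1, -w 2] (by
    ext b; fin_cases b <;> simp [Fin.sum_univ_three, hw]) 1
  simp at h1

theorem apply_ne_zero_of_linearIndependent_two {w : Fin 3 → K}
    (h : LinearIndependent K ![Pi.single 0 1, Pi.single 1 1, w]) : w 2 ≠ 0 := by
  intro hw
  have h1 := Fintype.linearIndependent_iff.1 h ![-w 0, -w 1, 1] (by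
    ext b; fin_cases b <;> simp [Fin.sum_univ_three, hw]) 2
  simp at h1

/-- **Cremona transformations.** A bound for the dimension of the transformed system bounds the
dimension of the original one. -/
theorem Gen.cremona [Infinite K] {ι : Type*} [Finite ι] [DecidableEq ι] {d d' : ℕ}
    {m m' : ι → ℕ} {i j k : ι} (hij : i ≠ j) (hik : i ≠ k) (hjk : j ≠ k) (hi : m i ≤ d)
    (hj : m j ≤ d) (hk : m k ≤ d) (hd : d' + m i + m j + m k = 2 * d)
    (hi' : m' i ≤ d - m j - m k) (hj' : m' j ≤ d - m i - m k) (hk' : m' k ≤ d - m i - m j)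
    (hm' : ∀ l, l ≠ i → l ≠ j → l ≠ k → m' l ≤ m l) {r : ℕ} (h : Gen K d' m' r) :
    Gen K d m r := by
  have hgen := h.generic
  have hpos : Generic fun v : ι → Fin 3 → K => ∀ l, l ≠ i ∧ l ≠ j ∧ l ≠ k →
      LinearIndependent K ![v l, v j, v k] ∧ LinearIndependent K ![v i, v l, v k] ∧
        LinearIndependent K ![v i, v j, v l] :=
    Generic.all fun l => Generic.imp fun hl =>
      (Generic.linearIndependent_three hl.2.1 hl.2.2 hjk).and
        ((Generic.linearIndependent_three hl.1.symm hik hl.2.2).and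
          (Generic.linearIndependent_three hij hl.1.symm hl.2.1.symm))
  -- The tuple has a small transformed system, its three base points are not collinear, and no other
  -- point lies on a side of their triangle.
  obtain ⟨v, ⟨hv, hind⟩, hpos⟩ :=
    ((hgen.and (Generic.linearIndependent_three hij hik hjk)).and hpos).exists_vec
  obtain ⟨g, hgi, hgj, hgk⟩ := exists_linearEquiv hind
  obtain ⟨w, hgw⟩ : ∃ w : ι → Fin 3 → K, ∀ l, g (w l) = v l :=
    ⟨fun l => g.symm (v l), fun l => by simp⟩
  have hwi : w i = Pi.single 0 1 := g.injective (by rw [hgw, hgi])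
  have hwj : w j = Pi.single 1 1 := g.injective (by rw [hgw, hgj])
  have hwk : w k = Pi.single 2 1 := g.injective (by rw [hgw, hgk])
  have hw : Module.finrank K (sys d' m' w) ≤ r := by
    have e := finrank_sys_linearEquiv d' m' w g
    rw [show (fun l => g (w l)) = v from funext hgw] at e
    rw [← e]
    exact hv
  have hwl : ∀ l, l ≠ i → l ≠ j → l ≠ k → ∀ a, w l a ≠ 0 := by
    intro l h1 h2 h3
    obtain ⟨p1, p2, p3⟩ := hpos l ⟨h1, h2, h3⟩
    have q1 : LinearIndependent K ![g (w l), g (Pi.single 1 1), g (Pi.single 2 1)] := by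
      simpa only [hgw, hgj, hgk] using p1
    have q2 : LinearIndependent K ![g (Pi.single 0 1), g (w l), g (Pi.single 2 1)] := by
      simpa only [hgw, hgi, hgk] using p2
    have q3 : LinearIndependent K ![g (Pi.single 0 1), g (Pi.single 1 1), g (w l)] := by
      simpa only [hgw, hgi, hgj] using p3
    rw [Fin.forall_fin_succ, Fin.forall_fin_two]
    exact ⟨apply_ne_zero_of_linearIndependent_zero (linearIndependent_of_apply g q1),
      apply_ne_zero_of_linearIndependent_one (linearIndependent_of_apply g q2),
      apply_ne_zero_of_linearIndependent_two (linearIndependent_of_apply g q3)⟩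
  -- The witness keeps the base points and replaces the others by their images. Pulling back a form
  -- of the system at `u` gives `mono` times a form of the transformed system at `w`. This injection
  -- is all that is needed, so lowering the multiplicities of the transformed system, in particular
  -- truncating negative ones to `0`, is harmless.
  let u : ι → Fin 3 → K := fun l => if l = i ∨ l = j ∨ l = k then w l else cremonaPt (w l)
  have hui : u i = Pi.single 0 1 := by simp [u, hwi]
  have huj : u j = Pi.single 1 1 := by simp [u, hwj]
  have huk : u k = Pi.single 2 1 := by simp [u, hwk]
  refine ⟨u, ?_⟩
  let mono : MvPolynomial (Fin 3) K := X 0 ^ m i * X 1 ^ m j * X 2 ^ m k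
  have hle : (sys d m u).map (PlaneSystem.cremona (K := K)).toLinearMap ≤
      (sys d' m' w).map (LinearMap.mulLeft K mono) := by
    rintro _ ⟨F, hF, rfl⟩
    rw [SetLike.mem_coe, mem_sys] at hF
    obtain ⟨F', e, h1, h2, h3, h4⟩ := exists_cremona_factor (m := ![m i, m j, m k]) (d' := d') hF.1
      (by intro a; fin_cases a <;> simpa)
      (by
        intro a
        fin_cases a
        · simpa [hui] using hF.2 i
        · simpa [huj] using hF.2 j
        · simpa [huk] using hF.2 k) (by simpa using hd)
    simp at e h2 h3 h4
    refine ⟨F', ?_, e.symm⟩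
    rw [SetLike.mem_coe, mem_sys]
    refine ⟨h1, fun l => ?_⟩
    by_cases hli : l = i
    · subst hli; rw [hwi]; exact multGE_antitone _ hi' h2
    by_cases hlj : l = j
    · subst hlj; rw [hwj]; exact multGE_antitone _ hj' h3
    by_cases hlk : l = k
    · subst hlk; rw [hwk]; exact multGE_antitone _ hk' h4
    have hwl := hwl l hli hlj hlk
    apply multGE_antitone _ (hm' l hli hlj hlk)
    have h5 := hF.2 l
    simp only [u, hli, hlj, hlk, or_self, if_false] at h5
    refine mem_multGE_of_mul_mem (H := mono) ?_ ?_
    · simp [mono, hwl]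
    · rw [← e, mem_multGE_iff]
      rw [mem_multGE_iff] at h5
      refine map_mem_idealAt_pow PlaneSystem.cremona (fun a => ?_) h5
      fin_cases a <;> simp [PlaneSystem.cremona, cremonaPt]
  have hinj : Module.finrank K ((sys d m u).map (PlaneSystem.cremona (K := K)).toLinearMap) =
      Module.finrank K (sys d m u) := by
    let f := (PlaneSystem.cremona (K := K)).toLinearMap.comp (sys d m u).subtype
    have hf : Function.Injective f := by
      rw [← LinearMap.ker_eq_bot, LinearMap.ker_eq_bot']
      rintro ⟨F, hF⟩ h0
      exact Subtype.ext (cremona_injOn_homogeneous (mem_sys.1 hF).1 h0)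
    have : (sys d m u).map (PlaneSystem.cremona (K := K)).toLinearMap = LinearMap.range f := by
      rw [LinearMap.range_comp, Submodule.range_subtype]
    rw [this, LinearMap.finrank_range_of_inj hf]
  have hmono : mono ≠ 0 := by simp [mono, X_ne_zero]
  rw [← hinj]
  refine (Submodule.finrank_mono hle).trans ?_
  rwa [finrank_map_mulLeft hmono]

/-! ## Bounds for the dimension of quasi-homogeneous systems -/

section Bounds

variable {ι : Type*} [DecidableEq ι]

/-- Multiplicity `m₀` at `o`, `m` on `T`, `k` on `U` and `0` elsewhere. -/
def mfun (o : ι) (m₀ : ℕ) (T : Finset ι) (m : ℕ) (U : Finset ι) (k : ℕ) : ι → ℕ :=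
  fun i => if i = o then m₀ else if i ∈ T then m else if i ∈ U then k else 0

theorem sum_mfun [Fintype ι] (f : ℕ → ℕ) (hf : f 0 = 0) {o : ι} (m₀ : ℕ) {T : Finset ι} (m : ℕ)
    (hT : o ∉ T) : ∑ i, f (mfun o m₀ T m ∅ 0 i) = f m₀ + T.card * f m := by
  have h : ∀ i, f (mfun o m₀ T m ∅ 0 i) =
      (if i = o then f m₀ else 0) + (if i ∈ T then f m else 0) := by
    intro i
    by_cases h1 : i = o
    · subst h1; simp [mfun, hT]
    · by_cases h2 : i ∈ T <;> simp [mfun, h1, h2, hf]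
  rw [Finset.sum_congr rfl fun i _ => h i, Finset.sum_add_distrib, Finset.sum_ite_eq']
  simp

theorem Gen.of_sum_le [Infinite K] [Fintype ι] {d : ℕ} {m : ι → ℕ} (h : ∑ i, m i ≤ d + 1) {r : ℕ}
    (hr : tri (d + 1) ≤ r + ∑ i, tri (m i)) : Gen K d m r := by
  have h1 : Generic fun v : ι → Fin 3 → K => (∀ i, v i ≠ 0) ∧
      ∀ i j, i ≠ j → LinearIndependent K ![v i, v j] :=
    (Generic.all Generic.ne_zero).and
      (Generic.all fun i => Generic.all fun j => Generic.imp fun hij =>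
        Generic.linearIndependent_two hij)
  obtain ⟨v, h2, h3⟩ := h1.exists_vec
  refine ⟨v, ?_⟩
  have := finrank_sys_of_sum_le h2 h3 h
  omega

theorem Gen.mfun_base [Infinite K] [Fintype ι] {d m₀ m : ℕ} {o : ι} {T : Finset ι} (hT : o ∉ T)
    (h : m₀ + T.card * m ≤ d + 1) {r : ℕ} (hr : tri (d + 1) ≤ r + tri m₀ + T.card * tri m) :
    Gen K d (mfun o m₀ T m ∅ 0) r := by
  have h1 := sum_mfun id rfl m₀ m hT
  simp only [id] at h1
  apply Gen.of_sum_le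
  · rw [h1]; exact h
  · rw [sum_mfun tri rfl m₀ m hT]; omega

/-- General simple points impose independent conditions. -/
theorem Gen.mfun_simple [Infinite K] {d m₀ m : ℕ} {o : ι} {T : Finset ι} {r : ℕ}
    (h : Gen K d (mfun o m₀ T m ∅ 0) r) (U : Finset ι) (hU : o ∉ U) (hTU : Disjoint T U) :
    Gen K d (mfun o m₀ T m U 1) (r - U.card) := by
  induction U using Finset.induction_on with
  | empty =>
    refine h.mono (fun i => ?_) (by simp)
    simp [mfun]
  | insert x U hx ih =>
    rw [Finset.disjoint_insert_right] at hTU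
    simp only [Finset.mem_insert, not_or] at hU
    have ih := ih hU.2 hTU.2
    have e0 : mfun o m₀ T m U 1 = Function.update (mfun o m₀ T m U 1) x 0 := by
      rw [eq_comm, Function.update_eq_self_iff]
      simp [mfun, Ne.symm hU.1, hTU.1, hx]
    have e1 : mfun o m₀ T m (insert x U) 1 = Function.update (mfun o m₀ T m U 1) x 1 := by
      ext i
      by_cases hi : i = x
      · subst hi
        simp [mfun, Ne.symm hU.1, hTU.1]
      · simp [mfun, hi]
    rw [Finset.card_insert_of_notMem hx, e1]
    rw [e0] at ih
    -- If the bound has reached `0`, the system is empty and stays so; otherwise the bound is a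
    -- successor and the new point lowers it by one.
    by_cases hr : r - U.card = 0
    · refine ih.mono (fun i => ?_) (by omega)
      by_cases hi : i = x
      · subst hi; simp
      · simp [hi]
    · exact Gen.update_one (ih.mono le_rfl (by omega))

/-- Two lines through the base point and a point of `T` are contracted by a Cremona
transformation. -/
theorem Gen.mfun_cremona [Infinite K] [Finite ι] {d d' m₀ m₀' m : ℕ} {o i j : ι} {T U U' : Finset ι}
    (hT : o ∉ T) (hij : i ≠ j) (hi : i ∈ T) (hj : j ∈ T) (h0 : m₀ ≤ d) (hm : m ≤ d)
    (hd : d' + m₀ + 2 * m = 2 * d) (h0' : m₀' ≤ d - 2 * m) (hUo : o ∉ U')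
    (hU' : U' ⊆ insert i (insert j U)) (hU1 : (i ∈ U' ∨ j ∈ U') → m₀ + m + 1 ≤ d) {r : ℕ}
    (h : Gen K d' (mfun o m₀' ((T.erase i).erase j) m U' 1) r) :
    Gen K d (mfun o m₀ T m U 1) r := by
  have hio : i ≠ o := by rintro rfl; exact hT hi
  have hjo : j ≠ o := by rintro rfl; exact hT hj
  have v0 : mfun o m₀ T m U 1 o = m₀ := by simp [mfun]
  have vi : mfun o m₀ T m U 1 i = m := by simp [mfun, hio, hi]
  have vj : mfun o m₀ T m U 1 j = m := by simp [mfun, hjo, hj]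
  refine Gen.cremona (i := o) (j := i) (k := j) hio.symm hjo.symm hij (d' := d')
    (by rw [v0]; exact h0) (by rw [vi]; exact hm) (by rw [vj]; exact hm)
    (by rw [v0, vi, vj]; omega) ?_ ?_ ?_ ?_ h
  · rw [vi, vj]
    simp only [mfun, if_true]
    omega
  · rw [v0, vj]
    by_cases h1 : i ∈ U'
    · have := hU1 (Or.inl h1)
      simp [mfun, hio, h1]
      omega
    · simp [mfun, hio, h1]
  · rw [v0, vi]
    by_cases h1 : j ∈ U'
    · have := hU1 (Or.inr h1)
      simp [mfun, hjo, h1]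
      omega
    · simp [mfun, hjo, h1]
  · intro l hlo hli hlj
    by_cases h1 : l ∈ T
    · simp [mfun, hlo, hli, hlj, h1]
    · by_cases h2 : l ∈ U'
      · have h3 : l ∈ U := by simpa [hli, hlj] using hU' h2
        simp [mfun, hlo, h1, h2, h3]
      · simp [mfun, hlo, h1, h2]

/-- Curves of degree `c` with two points of multiplicity `c` do not pass through a further general
point. -/
theorem Gen.mfun_eq_zero [Infinite K] [Fintype ι] {c m₀ : ℕ} {o : ι} {T U : Finset ι} (hT : o ∉ T)
    (hU : o ∉ U) (hTU : Disjoint T U) (h2 : 2 ≤ T.card) (h1 : 1 ≤ U.card) :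
    Gen K c (mfun o m₀ T c U 1) 0 := by
  obtain ⟨i, hi, j, hj, hij⟩ := Finset.one_lt_card.1 h2
  have hio : i ≠ o := by rintro rfl; exact hT hi
  have hjo : j ≠ o := by rintro rfl; exact hT hj
  -- The Cremona transformation centred at `o`, `i`, `j` lowers the degree to `0`, leaving only
  -- constants. Geometrically the sole curve with just these two points is `c` times the line
  -- joining them, and a general simple point misses it.
  have h : Gen K c (mfun o 0 T c ∅ 0) 1 := by
    refine Gen.cremona (i := o) (j := i) (k := j) (d' := 0) (m' := fun _ => 0) hio.symm hjo.symm
      hij ?_ ?_ ?_ ?_ (Nat.zero_le _) (Nat.zero_le _) (Nat.zero_le _) (fun _ _ _ _ => Nat.zero_le _)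
      (Gen.of_sum_le (by simp) (by simp [tri]))
    · simp [mfun]
    · simp [mfun, hio, hi]
    · simp [mfun, hjo, hj]
    · simp [mfun, hio, hjo, hi, hj]
      omega
  have h3 := h.mfun_simple U hU hTU
  refine h3.mono (fun l => ?_) (by omega)
  by_cases hl : l = o <;> simp [mfun, hl]

theorem Finset.card_erase_erase {T : Finset ι} {i j : ι} (hij : i ≠ j) (hi : i ∈ T) (hj : j ∈ T) :
    ((T.erase i).erase j).card = T.card - 2 := by
  rw [Finset.card_erase_of_mem (Finset.mem_erase.2 ⟨hij.symm, hj⟩), Finset.card_erase_of_mem hi]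
  omega

theorem tri_one : tri 1 = 1 := rfl
theorem tri_two : tri 2 = 3 := rfl
theorem tri_three : tri 3 = 6 := rfl
theorem tri_four : tri 4 = 10 := rfl
theorem tri_five : tri 5 = 15 := rfl

/-- The systems `𝓛(d, d - μ, t, μ)`. -/
theorem gen_sub_eq [Infinite K] [Fintype ι] {μ : ℕ} (hμ : μ = 1 ∨ μ = 2 ∨ μ = 3) (o : ι) (t : ℕ) :
    ∀ (T : Finset ι), T.card = t → o ∉ T → ∀ d r : ℕ, μ ≤ d →
      d * (1 + μ) + 1 ≤ r + tri (μ - 1) + t * tri μ →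
      (∀ e, t = 2 * e → ¬ (μ * e ≤ d ∧ d + 2 ≤ μ * e + μ)) →
      Gen K d (mfun o (d - μ) T μ ∅ 1) r := by
  -- The numerical hypothesis says that `r` is at least the virtual dimension plus one. The Cremona
  -- transformation at `o` and two points of `T` replaces `d` by `d - μ`, keeps the difference `μ`
  -- between degree and multiplicity at `o`, and frees the two points; the hypothesis is invariant.
  -- The excluded range is where, after `e` such steps, the multiplicity at `o` would be at most
  -- `-2`.
  induction t using Nat.strong_induction_on with
  | _ t ih =>
    intro T hTc hT d r hd hr hns
    have hbase : ∀ (d m₀ m k : ℕ) (T : Finset ι) (r : ℕ), Gen K d (mfun o m₀ T m ∅ 0) r →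
        Gen K d (mfun o m₀ T m ∅ k) r :=
      fun d m₀ m k T r h => h.mono (fun i => by simp [mfun]) le_rfl
    rcases Nat.lt_or_ge t 2 with h2 | h2
    · obtain ⟨c, rfl⟩ : ∃ c, d = c + μ := ⟨d - μ, by omega⟩
      apply hbase
      apply Gen.mfun_base hT
      · rw [hTc]
        interval_cases t <;> omega
      · rw [hTc, Nat.add_sub_cancel, add_assoc c, tri_add c]
        interval_cases t <;> rcases hμ with rfl | rfl | rfl <;>
          simp [tri_one, tri_two, tri_three, tri_four] at hr ⊢ <;> omega
    · obtain ⟨i, hi, j, hj, hij⟩ := Finset.one_lt_card.1 (show 1 < T.card by omega)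
      have hcard := Finset.card_erase_erase hij hi hj
      have hT' : o ∉ (T.erase i).erase j := fun h => hT (Finset.mem_of_mem_erase
        (Finset.mem_of_mem_erase h))
      refine Gen.mfun_cremona (U' := ∅) (d' := d - μ) (m₀' := d - μ - μ) hT hij hi hj (by omega) hd
        (by omega) (by omega) (by simp) (by simp) (by simp) ?_
      -- The transformed degree `d - μ` is now below `μ`. A third point of multiplicity `μ` empties
      -- the system. For `t = 2` the exclusion leaves `d = 2 * μ - 1`, where the multiplicity `-1`
      -- at `o` is replaced by `0` at no cost, since neither imposes a condition.
      rcases Nat.lt_or_ge d (2 * μ) with h3 | h3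
      · rcases Nat.lt_or_ge t 3 with h4 | h4
        · obtain rfl : t = 2 := by omega
          have h5 := hns 1 rfl
          have h6 : d = 2 * μ - 1 := by omega
          apply hbase
          have h7 : d - μ - μ = 0 := by omega
          apply Gen.mfun_base hT'
          · rw [hcard, hTc, h7]; omega
          · rw [hcard, hTc, h7, show d - μ + 1 = μ by omega]
            rcases hμ with rfl | rfl | rfl <;>
              simp [tri_one, tri_two, tri_three, h6] at hr ⊢ <;> omega
        · obtain ⟨l, hl⟩ := Finset.card_pos.1
            (show 0 < ((T.erase i).erase j).card by omega)
          have hlo : l ≠ o := by rintro rfl; exact hT' hl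
          refine Gen.of_degree_lt (i := l) ?_ r
          simp only [mfun, hlo, if_false, hl, if_true]
          omega
      · refine ih (t - 2) (by omega) _ (by rw [hcard, hTc]) hT' _ _ (by omega) ?_ ?_
        · obtain ⟨c, rfl⟩ : ∃ c, d = c + μ := ⟨d - μ, by omega⟩
          obtain ⟨s, rfl⟩ : ∃ s, t = s + 2 := ⟨t - 2, by omega⟩
          rcases hμ with rfl | rfl | rfl <;>
              simp [tri_one, tri_two, tri_three] at hr ⊢ <;> omega
        · intro e he
          have := hns (e + 1) (by omega)
          rw [Nat.mul_add, Nat.mul_one] at this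
          omega

/-- The systems `𝓛(d, d - 3, t, 2)` with additional simple points. -/
theorem gen_sub_three_two [Infinite K] [Fintype ι] (o : ι) (t : ℕ) :
    ∀ (T U : Finset ι), T.card = t → o ∉ T → o ∉ U → Disjoint T U → ∀ d r : ℕ, 3 ≤ d →
      4 * d ≤ r + 2 + 3 * t + U.card → Gen K d (mfun o (d - 3) T 2 U 1) r := by
  -- Here the Cremona transformation lowers `d` by `1`, keeps the difference `3`, and turns two
  -- double points into simple ones. The numerical hypothesis, again a bound for `r` by the virtual
  -- dimension plus one, is invariant.
  induction t using Nat.strong_induction_on with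
  | _ t ih =>
    intro T U hTc hT hU hTU d r hd hr
    rcases Nat.lt_or_ge t 2 with h2 | h2
    · obtain ⟨c, rfl⟩ : ∃ c, d = c + 3 := ⟨d - 3, by omega⟩
      refine (Gen.mfun_simple (r := r + U.card) (Gen.mfun_base hT ?_ ?_) U hU hTU).mono le_rfl
        (by omega)
      · rw [hTc]; omega
      · rw [hTc, Nat.add_sub_cancel, add_assoc c, tri_add c, tri_two, tri_four]; omega
    · obtain ⟨i, hi, j, hj, hij⟩ := Finset.one_lt_card.1 (show 1 < T.card by omega)
      have hcard := Finset.card_erase_erase hij hi hj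
      have hT' : o ∉ (T.erase i).erase j := fun h => hT (Finset.mem_of_mem_erase
        (Finset.mem_of_mem_erase h))
      have hiU : i ∉ U := Finset.disjoint_left.1 hTU hi
      have hjU : j ∉ U := Finset.disjoint_left.1 hTU hj
      have hio : i ≠ o := by rintro rfl; exact hT hi
      have hjo : j ≠ o := by rintro rfl; exact hT hj
      have hUc : (insert i (insert j U)).card = U.card + 2 := by
        rw [Finset.card_insert_of_notMem (by simp [hij, hiU]), Finset.card_insert_of_notMem hjU]
      have hU' : o ∉ insert i (insert j U) := by simp [hio.symm, hjo.symm, hU]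
      have hTU' : Disjoint ((T.erase i).erase j) (insert i (insert j U)) := by
        rw [Finset.disjoint_left] at hTU ⊢
        intro a ha
        simp only [Finset.mem_erase] at ha
        simp [ha.1, ha.2.1, hTU ha.2.2]
      refine Gen.mfun_cremona (U' := insert i (insert j U)) (d' := d - 1) (m₀' := d - 1 - 3) hT hij
        hi hj (by omega) (by omega) (by omega) (by omega) hU' subset_rfl (by omega) ?_
      -- For `d = 3` conics are reached, and the multiplicity `-1` at `o` becomes `0` without loss.
      -- With two or more double points left, only a double line could survive, and it misses the
      -- new simple points.
      rcases Nat.lt_or_ge d 4 with h3 | h3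
      · obtain rfl : d = 3 := by omega
        rcases Nat.lt_or_ge t 4 with h4 | h4
        · refine (Gen.mfun_simple (r := r + (U.card + 2)) (Gen.mfun_base hT' ?_ ?_) _ hU' hTU').mono
            le_rfl (by omega)
          · rw [hcard, hTc]; omega
          · rw [hcard, hTc]
            simp only [tri_two, tri_three, Nat.reduceAdd, Nat.reduceSub, tri_zero]
            omega
        · exact (Gen.mfun_eq_zero (c := 2) hT' hU' hTU' (by omega) (by omega)).mono le_rfl (by omega)
      · exact ih (t - 2) (by omega) _ _ (by rw [hcard, hTc]) hT' hU' hTU' _ _ (by omega)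
          (by omega)

/-- The systems `𝓛(d, d - 4, t, 3)` with additional simple points. -/
theorem gen_sub_four_three [Infinite K] [Fintype ι] (o : ι) (t : ℕ) :
    ∀ (T U : Finset ι), T.card = t → o ∉ T → o ∉ U → Disjoint T U → ∀ d r : ℕ, 4 ≤ d →
      5 * d ≤ r + 5 + 6 * t + U.card →
      ¬ (2 ≤ t ∧ Even t ∧ d = t + 2 ∧ U.card + t < 6) → Gen K d (mfun o (d - 4) T 3 U 1) r := by
  -- The transformation lowers `d` by `2`, keeps the difference `4`, and turns two triple points
  -- into simple ones. The excluded systems end at conics with multiplicity `-2` at `o`; truncating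
  -- this to `0` loses one dimension. The loss does not matter once there are six simple points,
  -- since no conic passes through them; hence the bound on `U.card + t`.
  induction t using Nat.strong_induction_on with
  | _ t ih =>
    intro T U hTc hT hU hTU d r hd hr hns
    rcases Nat.lt_or_ge t 2 with h2 | h2
    · obtain ⟨c, rfl⟩ : ∃ c, d = c + 4 := ⟨d - 4, by omega⟩
      refine (Gen.mfun_simple (r := r + U.card) (Gen.mfun_base hT ?_ ?_) U hU hTU).mono le_rfl
        (by omega)
      · rw [hTc]; omega
      · rw [hTc, Nat.add_sub_cancel, add_assoc c, tri_add c, tri_three, tri_five]; omega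
    · obtain ⟨i, hi, j, hj, hij⟩ := Finset.one_lt_card.1 (show 1 < T.card by omega)
      have hcard := Finset.card_erase_erase hij hi hj
      have hT' : o ∉ (T.erase i).erase j := fun h => hT (Finset.mem_of_mem_erase
        (Finset.mem_of_mem_erase h))
      have hiU : i ∉ U := Finset.disjoint_left.1 hTU hi
      have hjU : j ∉ U := Finset.disjoint_left.1 hTU hj
      have hio : i ≠ o := by rintro rfl; exact hT hi
      have hjo : j ≠ o := by rintro rfl; exact hT hj
      have hUc : (insert i (insert j U)).card = U.card + 2 := by
        rw [Finset.card_insert_of_notMem (by simp [hij, hiU]), Finset.card_insert_of_notMem hjU]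
      have hU' : o ∉ insert i (insert j U) := by simp [hio.symm, hjo.symm, hU]
      have hTU' : Disjoint ((T.erase i).erase j) (insert i (insert j U)) := by
        rw [Finset.disjoint_left] at hTU ⊢
        intro a ha
        simp only [Finset.mem_erase] at ha
        simp [ha.1, ha.2.1, hTU ha.2.2]
      refine Gen.mfun_cremona (U' := insert i (insert j U)) (d' := d - 2) (m₀' := d - 2 - 4) hT hij
        hi hj (by omega) (by omega) (by omega) (by omega) hU' subset_rfl (by omega) ?_
      -- The remaining degrees are `4` and `5`, transformed into `2` and `3`. A triple point empties
      -- the conics; two triple points of a cubic leave only a triple line, which misses the simple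
      -- points; otherwise the conditions are independent.
      rcases Nat.lt_or_ge d 6 with h3 | h3
      · rcases Nat.lt_or_ge t 3 with h4 | h4
        · obtain rfl : t = 2 := by omega
          have hns' : ¬ (d = 4 ∧ U.card < 4) := fun h => hns ⟨le_rfl, even_two, by omega, by omega⟩
          refine (Gen.mfun_simple (r := r + (U.card + 2)) (Gen.mfun_base hT' ?_ ?_) _ hU' hTU').mono
            le_rfl (by omega)
          · rw [hcard, hTc]; omega
          · rw [hcard, hTc]
            interval_cases d
            · simp only [tri_three, Nat.reduceAdd, Nat.reduceSub, tri_zero]; omega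
            · simp only [tri_four, Nat.reduceAdd, Nat.reduceSub, tri_zero]; omega
        · obtain rfl | rfl : d = 4 ∨ d = 5 := by omega
          · obtain ⟨l, hl⟩ := Finset.card_pos.1
              (show 0 < ((T.erase i).erase j).card by omega)
            have hlo : l ≠ o := by rintro rfl; exact hT' hl
            refine Gen.of_degree_lt (i := l) ?_ r
            simp [mfun, hlo, hl]
          · rcases Nat.lt_or_ge t 4 with h5 | h5
            · refine (Gen.mfun_simple (r := r + (U.card + 2)) (Gen.mfun_base hT' ?_ ?_) _ hU'
                hTU').mono le_rfl (by omega)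
              · rw [hcard, hTc]; omega
              · rw [hcard, hTc]
                simp only [tri_four, tri_three, Nat.reduceAdd, Nat.reduceSub, tri_zero]
                omega
            · exact (Gen.mfun_eq_zero (c := 3) hT' hU' hTU' (by omega) (by omega)).mono le_rfl
                (by omega)
      · refine ih (t - 2) (by omega) _ _ (by rw [hcard, hTc]) hT' hU' hTU' _ _ (by omega)
          (by omega) ?_
        rintro ⟨h5, h6, h7, h8⟩
        refine hns ⟨h2, ?_, by omega, by omega⟩
        obtain ⟨e, he⟩ := h6
        exact ⟨e + 1, by omega⟩

/-- Removing the line through the base point and a point of `T`. -/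
theorem Gen.mfun_line [Infinite K] [Finite ι] {d m k : ℕ} {o i x : ι} {T S : Finset ι}
    (hT : o ∉ T) (hi : i ∈ T) (hxo : x ≠ o) (hxT : x ∉ T) (hkm : k ≤ m) (hm : m ≤ d) {r : ℕ}
    (h : Gen K (d - (m - k)) (mfun o (d - m) (T.erase i) m (insert i S) k) r) (hxS : x ∉ S) :
    Gen K d (mfun o (d - k) T m S k) r := by
  have hio : i ≠ o := by rintro rfl; exact hT hi
  have hix : i ≠ x := by rintro rfl; exact hxT hi
  have v0 : mfun o (d - k) T m S k o = d - k := by simp [mfun]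
  have vi : mfun o (d - k) T m S k i = m := by simp [mfun, hio, hi]
  have vx : mfun o (d - k) T m S k x = 0 := by simp [mfun, hxo, hxT, hxS]
  -- The third centre is an auxiliary point without multiplicity. The line through `o` and `i` is
  -- contracted to it with new multiplicity `k - m`; truncating this to `0` splits the line off `m -
  -- k` times.
  refine Gen.cremona (i := o) (j := i) (k := x) hio.symm hxo.symm hix
    (by rw [v0]; omega) (by rw [vi]; exact hm) (by rw [vx]; omega)
    (by rw [v0, vi, vx]; omega) ?_ ?_ ?_ ?_ h
  · rw [vi, vx]; simp [mfun]
  · rw [v0, vx]; simp [mfun, hio]; omega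
  · simp [mfun, hxo, hxT, hxS, hix.symm]
  · intro l hlo hli hlx
    simp [mfun, hlo, hli]

/-- Each line through `o` and a point of `T` is split off `m - k` times, which lowers the
multiplicity there to `k`. If the degree falls below `m` while a point of `T` remains, the system is
empty, so the residual bound is needed only in the guarded range. -/
theorem Gen.mfun_lines [Infinite K] [Finite ι] {m k : ℕ} {o x : ι} (hxo : x ≠ o) (hkm : k ≤ m)
    (t : ℕ) : ∀ (T S : Finset ι), T.card = t → o ∉ T → x ∉ T → x ∉ S → ∀ d r : ℕ, k ≤ d →
      (k + t * (m - k) ≤ d → Gen K (d - t * (m - k))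
        (mfun o (d - t * (m - k) - k) ∅ m (S ∪ T) k) r) →
      Gen K d (mfun o (d - k) T m S k) r := by
  induction t with
  | zero =>
    intro T S hTc hT hxT hxS d r hd h
    obtain rfl := Finset.card_eq_zero.1 hTc
    simpa [hd] using h
  | succ t ih =>
    intro T S hTc hT hxT hxS d r hd h
    obtain ⟨i, hi⟩ := Finset.card_pos.1 (show 0 < T.card by omega)
    have hio : i ≠ o := by rintro rfl; exact hT hi
    have hix : i ≠ x := by rintro rfl; exact hxT hi
    rcases Nat.lt_or_ge d m with h1 | h1
    · refine Gen.of_degree_lt (i := i) ?_ r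
      simpa [mfun, hio, hi] using h1
    · refine Gen.mfun_line hT hi hxo hxT hkm h1 ?_ hxS
      have := ih (T.erase i) (insert i S) (by rw [Finset.card_erase_of_mem hi, hTc]; rfl)
        (fun h => hT (Finset.mem_of_mem_erase h)) (fun h => hxT (Finset.mem_of_mem_erase h))
        (by simp [hix.symm, hxS]) (d - (m - k)) r (by omega) (fun h2 => ?_)
      · rwa [show d - (m - k) - k = d - m by omega] at this
      · have h3 : S ∪ T = insert i S ∪ T.erase i := by
          ext a
          by_cases ha : a = i
          · subst ha; simp [hi]
          · simp [ha]
        have h4 := h (by rw [Nat.add_mul, Nat.one_mul]; omega)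
        rw [h3, show d - (t + 1) * (m - k) = d - (m - k) - t * (m - k) by
          rw [Nat.add_mul, Nat.one_mul]; omega] at h4
        exact h4

end Bounds

/-! ## Numerical classes -/

namespace PlaneClass

variable {n : ℕ}

theorem two_mul_vdim (D : PlaneClass n) :
    2 * D.vdim = D.deg * (D.deg + 3) - ∑ i, D.mult i * (D.mult i + 1) := by
  have h1 : 2 * (D.deg * (D.deg + 3) / 2) = D.deg * (D.deg + 3) := by
    apply Int.mul_ediv_cancel'
    rcases Int.even_or_odd' D.deg with ⟨c, h | h⟩ <;> rw [h]
    · exact ⟨c * (2 * c + 3), by ring⟩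
    · exact ⟨(2 * c + 1) * (c + 2), by ring⟩
  have h2 : ∀ i, 2 * (D.mult i * (D.mult i + 1) / 2) = D.mult i * (D.mult i + 1) := fun i =>
    Int.mul_ediv_cancel' (Int.even_mul_succ_self _).two_dvd
  rw [vdim, mul_sub, h1, Finset.mul_sum]
  simp only [h2]

theorem two_mul_genus (D : PlaneClass n) :
    2 * D.genus = (D.deg - 1) * (D.deg - 2) - ∑ i, D.mult i * (D.mult i - 1) := by
  have h1 : 2 * ((D.deg - 1) * (D.deg - 2) / 2) = (D.deg - 1) * (D.deg - 2) := by
    apply Int.mul_ediv_cancel'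
    rcases Int.even_or_odd' D.deg with ⟨c, h | h⟩ <;> rw [h]
    · exact ⟨(2 * c - 1) * (c - 1), by ring⟩
    · exact ⟨c * (2 * c - 1), by ring⟩
  have h2 : ∀ i, 2 * (D.mult i * (D.mult i - 1) / 2) = D.mult i * (D.mult i - 1) := fun i =>
    Int.mul_ediv_cancel' (Int.even_mul_pred_self _).two_dvd
  rw [genus, mul_sub, h1, Finset.mul_sum]
  simp only [h2]

end PlaneClass

open PlaneClass

theorem two_mul_vdim_quasiHomClass (d m₀ n m : ℕ) :
    2 * (quasiHomClass d m₀ n m).vdim = d * (d + 3) - m₀ * (m₀ + 1) - n * (m * (m + 1)) := by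
  rw [two_mul_vdim, Fin.sum_univ_succ]
  simp [quasiHomClass, quasiHomMult, deg, mult]
  ring

/-- The list of the special systems `𝓛(d, m₀, n, m)` with `m ∈ {2, 3}` and `m₀ ≥ d - m - 1`. -/
def Listed (d m₀ n m : ℕ) : Prop :=
  1 ≤ n ∧ ((m₀ = d ∧ n * m ≤ d) ∨ (m = 3 ∧ d = m₀ + 1 ∧ 5 * n ≤ 2 * d) ∨
    (∃ e, n = 2 * e ∧ d = m₀ + m ∧ m * e ≤ d ∧ d + 2 ≤ m * e + m) ∨
    (m = 3 ∧ d = m₀ + 2 ∧ ∃ e, n = 2 * e ∧ d = 4 * e) ∨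
    (m = 3 ∧ d = m₀ + 4 ∧ (d = 4 ∧ n = 2 ∨ d = 6 ∧ n = 4)))

theorem quasiHomMult_eq_mfun (m₀ n m k : ℕ) :
    quasiHomMult m₀ n m = mfun 0 m₀ (Finset.univ.erase 0) m ∅ k := by
  ext i
  refine Fin.cases ?_ (fun j => ?_) i <;> simp [quasiHomMult, mfun]

theorem quasiHomMult_eq_mfun_option (m₀ n m k : ℕ) (i : Fin (n + 1)) :
    quasiHomMult m₀ n m i =
      mfun (some 0) m₀ ((Finset.univ.erase 0).map Function.Embedding.some) m ∅ k (some i) := by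
  refine Fin.cases ?_ (fun j => ?_) i <;> simp [quasiHomMult, mfun]

/-- The systems that are not in the list have the expected dimension. -/
theorem gen_of_not_listed [Infinite K] {d m₀ n m : ℕ} (hm : m = 2 ∨ m = 3) (hd : d ≤ m₀ + m + 1)
    (h : ¬ Listed d m₀ n m) {r : ℕ} (hr : (quasiHomClass d m₀ n m).vdim + 1 ≤ r) :
    Gen K d (quasiHomMult m₀ n m) r := by
  have hv := two_mul_vdim_quasiHomClass d m₀ n m
  have hcard : (Finset.univ.erase (0 : Fin (n + 1))).card = n := by simp
  rcases Nat.lt_or_ge d m₀ with h0 | h0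
  · exact Gen.of_degree_lt (i := 0) (by simpa [quasiHomMult] using h0) r
  obtain ⟨k, rfl⟩ : ∃ k, d = m₀ + k := ⟨d - m₀, by omega⟩
  rcases Nat.lt_or_ge k m with hkm | hkm
  -- The added index `none` supplies the auxiliary point needed to split off lines; it has
  -- multiplicity `0` and is dropped at the end.
  · let T : Finset (Option (Fin (n + 1))) := (Finset.univ.erase 0).map Function.Embedding.some
    have hTc : T.card = n := by simp [T]
    have hT0 : some 0 ∉ T := by simp [T]
    have hTn : none ∉ T := by simp [T]
    have key : Gen K (m₀ + k) (mfun (some 0) (m₀ + k - k) T m ∅ k) r := by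
      refine Gen.mfun_lines (x := none) (by simp) hkm.le n T ∅ hTc hT0 hTn (by simp) _ _ (by omega)
        fun hle => ?_
      obtain ⟨d', hd'⟩ : ∃ d', m₀ + k = d' + n * (m - k) := ⟨m₀ + k - n * (m - k), by omega⟩
      rw [show m₀ + k - n * (m - k) = d' by omega]
      rcases Nat.eq_zero_or_pos k with rfl | hk
      · have hn : n = 0 := by
          by_contra hn
          exact h ⟨by omega, Or.inl ⟨rfl, by rw [Nat.sub_zero] at hle; omega⟩⟩
        subst hn
        have e : mfun (some 0) (d' - 0) ∅ m (∅ ∪ T) 0 = mfun (some 0) d' ∅ m ∅ 0 := by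
          ext i; simp [mfun]
        rw [e]
        refine Gen.mfun_base (by simp) (by simp) ?_
        have h1 : (2 : ℤ) * (quasiHomClass (m₀ + 0) m₀ 0 m).vdim = 2 * m₀ := by
          rw [hv]; push_cast; ring
        rw [tri_add, tri_one]
        simp
        omega
      · rw [show mfun (some 0) (d' - k) ∅ m (∅ ∪ T) k = mfun (some 0) (d' - k) T k ∅ 1 by
          ext i; simp [mfun]]
        refine gen_sub_eq (by omega) _ n T hTc hT0 d' r (by omega) ?_ ?_
        -- A line split off once leaves the expected dimension unchanged. For `m = 3`, `k = 1` the
        -- lines are split off twice; then, unless `n = 0`, not being listed means `5 * n > 2 * d`,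
        -- and the residual system is empty.
        · rcases hm with rfl | rfl <;> interval_cases k
          · have h1 : (2 : ℤ) * (quasiHomClass (m₀ + 1) m₀ n 2).vdim = 4 * m₀ + 4 - 6 * n := by
              rw [hv]; push_cast; ring
            simp [tri_one]
            omega
          · have h1 : (2 : ℤ) * (quasiHomClass (m₀ + 1) m₀ n 3).vdim = 4 * m₀ + 4 - 12 * n := by
              rw [hv]; push_cast; ring
            have h2 : ¬ (1 ≤ n ∧ 5 * n ≤ 2 * (m₀ + 1)) := fun h3 =>
              h ⟨h3.1, Or.inr (Or.inl ⟨rfl, rfl, h3.2⟩)⟩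
            simp [tri_one]
            omega
          · have h1 : (2 : ℤ) * (quasiHomClass (m₀ + 2) m₀ n 3).vdim = 6 * m₀ + 10 - 12 * n := by
              rw [hv]; push_cast; ring
            simp [tri_one, tri_two]
            omega
        · rintro e rfl ⟨h1, h2⟩
          rcases hm with rfl | rfl <;> interval_cases k
          · omega
          · omega
          · rcases Nat.eq_zero_or_pos e with rfl | he
            · omega
            · exact h ⟨by omega, Or.inr (Or.inr (Or.inr (Or.inl ⟨rfl, rfl, e, rfl, by omega⟩)))⟩
    rw [Nat.add_sub_cancel] at key
    have e : quasiHomMult m₀ n m = fun i => mfun (some 0) m₀ T m ∅ k (some i) := by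
      ext i; exact quasiHomMult_eq_mfun_option m₀ n m k i
    rw [e]
    exact key.of_option (by simp [mfun, hTn])
  · rw [quasiHomMult_eq_mfun m₀ n m 1]
    have h0T : (0 : Fin (n + 1)) ∉ Finset.univ.erase (0 : Fin (n + 1)) := by simp
    obtain rfl | rfl : k = m ∨ k = m + 1 := by omega
    · have := gen_sub_eq (K := K) (μ := k) (by omega) 0 n _ hcard h0T (m₀ + k) r (by omega) ?_ ?_
      · rwa [Nat.add_sub_cancel] at this
      · rcases hm with rfl | rfl
        · have h1 : (2 : ℤ) * (quasiHomClass (m₀ + 2) m₀ n 2).vdim = 6 * m₀ + 10 - 6 * n := by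
            rw [hv]; push_cast; ring
          simp [tri_one, tri_two]
          omega
        · have h1 : (2 : ℤ) * (quasiHomClass (m₀ + 3) m₀ n 3).vdim = 8 * m₀ + 18 - 12 * n := by
            rw [hv]; push_cast; ring
          simp [tri_two, tri_three]
          omega
      · rintro e rfl ⟨h1, h2⟩
        rcases Nat.eq_zero_or_pos e with rfl | he
        · omega
        · exact h ⟨by omega, Or.inr (Or.inr (Or.inl ⟨e, rfl, rfl, h1, h2⟩))⟩
    · rcases hm with rfl | rfl
      · have h1 : (2 : ℤ) * (quasiHomClass (m₀ + (2 + 1)) m₀ n 2).vdim = 8 * m₀ + 18 - 6 * n := by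
          rw [hv]; push_cast; ring
        have := gen_sub_three_two (K := K) 0 n _ ∅ hcard h0T (by simp) (by simp) (m₀ + 3) r
          (by omega) (by simp; omega)
        rwa [Nat.add_sub_cancel] at this
      · have h1 : (2 : ℤ) * (quasiHomClass (m₀ + (3 + 1)) m₀ n 3).vdim = 10 * m₀ + 28 - 12 * n := by
          rw [hv]; push_cast; ring
        have := gen_sub_four_three (K := K) 0 n _ ∅ hcard h0T (by simp) (by simp) (m₀ + 4) r
          (by omega) (by simp; omega) ?_
        · rwa [Nat.add_sub_cancel] at this
        · rintro ⟨h2, ⟨e, rfl⟩, h4, h5⟩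
          simp at h5
          exact h ⟨by omega, Or.inr (Or.inr (Or.inr (Or.inr ⟨rfl, rfl, by omega⟩)))⟩

/-! ## Forms in two and three variables -/

theorem finSuccEquiv_rename_succ {n : ℕ} (B : MvPolynomial (Fin n) K) :
    finSuccEquiv K n (rename Fin.succ B) = Polynomial.C B := by
  have : ((finSuccEquiv K n).toAlgHom.comp (rename Fin.succ)) = Polynomial.CAlgHom := by
    apply MvPolynomial.algHom_ext
    intro i
    simp [finSuccEquiv_X_succ]
  exact congrArg (fun f => f B) this

/-- A form which is at most linear in the first variable. -/
theorem exists_eq_X_mul_add {F : MvPolynomial (Fin 3) K} {e : ℕ} (he : 1 ≤ e)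
    (hF : F.IsHomogeneous e) (h : ∀ s ∈ F.support, s 0 ≤ 1) :
    ∃ B C : MvPolynomial (Fin 2) K, B.IsHomogeneous (e - 1) ∧ C.IsHomogeneous e ∧
      F = X 0 * rename Fin.succ B + rename Fin.succ C := by
  refine ⟨(finSuccEquiv K 2 F).coeff 1, (finSuccEquiv K 2 F).coeff 0,
    hF.finSuccEquiv_coeff_isHomogeneous 1 (e - 1) (by omega),
    hF.finSuccEquiv_coeff_isHomogeneous 0 e (by omega), ?_⟩
  apply (finSuccEquiv K 2).injective
  rw [map_add, map_mul, finSuccEquiv_X_zero, finSuccEquiv_rename_succ, finSuccEquiv_rename_succ]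
  have hd : (finSuccEquiv K 2 F).natDegree ≤ 1 := by
    rw [natDegree_finSuccEquiv, degreeOf_le_iff]
    exact h
  conv_lhs => rw [Polynomial.eq_X_add_C_of_natDegree_le_one hd]
  ring

theorem aeval_X_mul_add {A : Type*} [CommRing A] [Algebra K A] (B C : MvPolynomial (Fin 2) K)
    (x y z : A) : aeval ![x, y, z] (X 0 * rename Fin.succ B + rename Fin.succ C) =
      x * aeval ![y, z] B + aeval ![y, z] C := by
  have : (![x, y, z] ∘ Fin.succ : Fin 2 → A) = ![y, z] := by
    ext i; fin_cases i <;> rfl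
  rw [map_add, map_mul, aeval_X, aeval_rename, aeval_rename, this]
  simp

theorem eval_X_mul_add (B C : MvPolynomial (Fin 2) K) (x y z : K) :
    eval ![x, y, z] (X 0 * rename Fin.succ B + rename Fin.succ C) =
      x * eval ![y, z] B + eval ![y, z] C := by
  have := aeval_X_mul_add B C x y z
  simpa [aeval_eq_eval] using this

theorem eval_mul_of_isHomogeneous {σ : Type*} {F : MvPolynomial σ K} {d : ℕ}
    (hF : F.IsHomogeneous d) (a : K) (x : σ → K) :
    eval (fun i => a * x i) F = a ^ d * eval x F := by
  have := aeval_mul_of_isHomogeneous hF a x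
  simpa [aeval_eq_eval] using this

/-- A binary form vanishing at `(1, t)` for all `t` is zero. -/
theorem eq_zero_of_eval_one [Infinite K] {B : MvPolynomial (Fin 2) K} {e : ℕ}
    (hB : B.IsHomogeneous e) (h : ∀ t, eval ![1, t] B = 0) : B = 0 := by
  have h1 : X 0 * B = 0 := by
    apply MvPolynomial.funext
    intro x
    rw [map_mul, eval_X, map_zero]
    by_cases hx : x 0 = 0
    · simp [hx]
    · have h2 := eval_mul_of_isHomogeneous hB (x 0) ![1, x 1 / x 0]
      have h3 : (fun i => x 0 * ![1, x 1 / x 0] i) = x := by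
        ext i
        fin_cases i
        · simp
        · simp; field_simp
      rw [h3, h, mul_zero] at h2
      rw [h2, mul_zero]
  exact (mul_eq_zero.1 h1).resolve_left (X_ne_zero 0)

/-- A binary form of positive degree has a nontrivial zero. -/
theorem exists_zero_of_isHomogeneous [IsAlgClosed K] {B : MvPolynomial (Fin 2) K} {e : ℕ}
    (he : 1 ≤ e) (hB : B.IsHomogeneous e) : ∃ a b : K, (a ≠ 0 ∨ b ≠ 0) ∧ eval ![a, b] B = 0 := by
  have : Infinite K := IsAlgClosed.instInfinite
  let p : Polynomial K := aeval ![1, Polynomial.X] B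
  have hp : ∀ t, p.eval t = eval ![1, t] B := by
    intro t
    have h1 : (Polynomial.aeval t).comp
        (aeval ![1, Polynomial.X] : MvPolynomial (Fin 2) K →ₐ[K] Polynomial K) =
        aeval ![1, t] := by
      apply MvPolynomial.algHom_ext
      intro i
      fin_cases i <;> simp
    have := congrArg (fun f => f B) h1
    simpa [p, aeval_eq_eval, Polynomial.aeval_def, Polynomial.eval₂_eq_eval_map] using this
  by_cases hr : ∃ t, p.eval t = 0
  · obtain ⟨t, ht⟩ := hr
    exact ⟨1, t, Or.inl one_ne_zero, by rw [← hp, ht]⟩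
  -- Without a root the dehomogenised polynomial is constant, so `B` is a multiple of the power of
  -- the first variable and vanishes at `(0, 1)`.
  · refine ⟨0, 1, Or.inr one_ne_zero, ?_⟩
    have hdeg : p.degree ≤ 0 := by
      by_contra hd
      obtain ⟨t, ht⟩ := IsAlgClosed.exists_root p (by
        intro h0; rw [h0] at hd; exact hd le_rfl)
      exact hr ⟨t, ht⟩
    have hc := Polynomial.eq_C_of_degree_le_zero hdeg
    set c := p.coeff 0
    have h2 : B - C c * X 0 ^ e = 0 := by
      apply eq_zero_of_eval_one (e := e)
      · exact hB.sub (by simpa using isHomogeneous_C_mul_X_pow c (0 : Fin 2) e)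
      · intro t
        have := hp t
        rw [hc, Polynomial.eval_C] at this
        simp [← this]
    rw [sub_eq_zero.1 h2]
    simp
    right; omega

theorem linearIndependent_single_zero {a b : K} (h : a ≠ 0 ∨ b ≠ 0) :
    LinearIndependent K ![Pi.single 0 1, ![0, a, b]] := by
  rw [LinearIndependent.pair_iff]
  intro s t hst
  have h0 := congrFun hst 0
  have h1 := congrFun hst 1
  have h2 := congrFun hst 2
  simp at h0 h1 h2
  refine ⟨h0, ?_⟩
  rcases h with h | h
  · exact h1.resolve_right h
  · exact h2.resolve_right h

/-- A form not involving the first variable vanishes on a line through the first vertex. -/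
theorem exists_line_of_forall_support [IsAlgClosed K] {G : MvPolynomial (Fin 3) K} {a : ℕ}
    (ha : 1 ≤ a) (hG : G.IsHomogeneous a) (h : ∀ s ∈ G.support, s 0 = 0) :
    ∃ q : Fin 3 → K, LinearIndependent K ![Pi.single 0 1, q] ∧
      ∀ s : K, eval (q + s • Pi.single 0 1) G = 0 := by
  obtain ⟨B, C, -, hC, e⟩ := exists_eq_X_mul_add ha hG fun s hs => (h s hs).le.trans zero_le_one
  have hB : B = 0 := by
    have h1 : (finSuccEquiv K 2 G).coeff 1 = B := by
      rw [e, map_add, map_mul, finSuccEquiv_X_zero, finSuccEquiv_rename_succ,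
        finSuccEquiv_rename_succ]
      simp
    rw [← h1]
    apply Polynomial.coeff_eq_zero_of_natDegree_lt
    rw [natDegree_finSuccEquiv, Nat.lt_one_iff, ← Nat.le_zero, degreeOf_le_iff]
    exact fun s hs => (h s hs).le
  obtain ⟨b, c, hbc, h0⟩ := exists_zero_of_isHomogeneous ha hC
  refine ⟨![0, b, c], linearIndependent_single_zero hbc, fun s => ?_⟩
  have h2 : (![0, b, c] + s • Pi.single 0 1 : Fin 3 → K) = ![s, b, c] := by
    ext i; fin_cases i <;> simp
  rw [h2, e, eval_X_mul_add, hB, h0]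
  simp

/-- The restriction of a form, at most linear in the first variable, to the line joining the first
two vertices. -/
theorem eval_line {F : MvPolynomial (Fin 3) K} {e : ℕ} (hF : F.IsHomogeneous e)
    (h : ∀ s ∈ F.support, s 0 ≤ 1) (x : K) :
    eval ![x, 1, 0] F = x * coeff (Finsupp.equivFunOnFinite.symm ![1, e - 1, 0]) F +
      coeff (Finsupp.equivFunOnFinite.symm ![0, e, 0]) F := by
  have hne : (Finsupp.equivFunOnFinite.symm ![1, e - 1, 0] : Fin 3 →₀ ℕ) ≠
      Finsupp.equivFunOnFinite.symm ![0, e, 0] := fun h => by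
    have := congrArg (fun f => f 0) h
    simp at this
  have h1 : eval ![x, 1, 0] (F -
      monomial (Finsupp.equivFunOnFinite.symm ![1, e - 1, 0])
        (coeff (Finsupp.equivFunOnFinite.symm ![1, e - 1, 0]) F) -
      monomial (Finsupp.equivFunOnFinite.symm ![0, e, 0])
        (coeff (Finsupp.equivFunOnFinite.symm ![0, e, 0]) F)) = 0 := by
    rw [eval_eq']
    refine Finset.sum_eq_zero fun s hs => ?_
    have hs2 : s 2 ≠ 0 := by
      intro h2
      have hs' := mem_support_iff.1 hs
      rw [coeff_sub, coeff_sub, coeff_monomial, coeff_monomial] at hs'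
      by_cases e1 : Finsupp.equivFunOnFinite.symm ![1, e - 1, 0] = s
      · subst e1
        simp [hne.symm] at hs'
      by_cases e2 : Finsupp.equivFunOnFinite.symm ![0, e, 0] = s
      · subst e2
        simp [hne] at hs'
      rw [if_neg e1, if_neg e2, sub_zero, sub_zero] at hs'
      have h3 := h s (mem_support_iff.2 hs')
      have h4 := sum_of_mem_support hF (mem_support_iff.2 hs')
      rcases Nat.le_one_iff_eq_zero_or_eq_one.1 h3 with h5 | h5
      · apply e2
        ext i
        fin_cases i <;> simp <;> omega
      · apply e1
        ext i
        fin_cases i <;> simp <;> omega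
    rw [Fin.prod_univ_three]
    simp [hs2]
  rw [map_sub, map_sub, eval_monomial, eval_monomial, Finsupp.prod_fintype _ _ (by simp),
    Finsupp.prod_fintype _ _ (by simp), Fin.prod_univ_three, Fin.prod_univ_three] at h1
  simp at h1
  linear_combination h1

/-! ## Curves with a point of multiplicity one less than the degree -/

/-- `F` is a form of degree `e ≥ 1` with multiplicity at least `e - 1` at `v₀`, which does not
vanish on a line through `v₀`. -/
structure IsMonoidal (F : MvPolynomial (Fin 3) K) (v₀ : Fin 3 → K) (e : ℕ) : Prop where
  pos : 1 ≤ e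
  hom : F.IsHomogeneous e
  mult : F ∈ multGE v₀ (e - 1)
  line : ∀ q, LinearIndependent K ![v₀, q] → ∃ s : K, eval (q + s • v₀) F ≠ 0

namespace IsMonoidal

variable {F : MvPolynomial (Fin 3) K} {v₀ : Fin 3 → K} {e : ℕ}

theorem linSubst (hF : IsMonoidal F v₀ e) {g : (Fin 3 → K) ≃ₗ[K] (Fin 3 → K)} {u : Fin 3 → K}
    (hg : g u = v₀) : IsMonoidal (linSubst g F) u e where
  pos := hF.pos
  hom := isHomogeneous_linSubst g hF.hom
  mult := by rw [linSubst_mem_multGE_iff, hg]; exact hF.mult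
  line := fun q hq => by
    have h1 : LinearIndependent K ![v₀, g q] := by
      have := hq.map' g.toLinearMap g.ker
      convert! this using 1
      ext i j
      fin_cases i <;> simp [hg]
    obtain ⟨s, hs⟩ := hF.line _ h1
    refine ⟨s, ?_⟩
    rw [eval_linSubst, map_add, map_smul, hg]
    exact hs

theorem support_le (hF : IsMonoidal F (Pi.single 0 1) e) : ∀ s ∈ F.support, s 0 ≤ 1 := by
  intro s hs
  have h1 := (mem_multGE_single_iff hF.hom 0).1 hF.mult s hs
  have h2 := hF.pos
  omega

theorem ne_zero (hF : IsMonoidal F v₀ e) (hv : v₀ ≠ 0) : F ≠ 0 := by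
  rintro rfl
  obtain ⟨q, hq⟩ := exists_linearIndependent_two hv
  obtain ⟨s, hs⟩ := hF.line q hq
  simp at hs

/-- With `v₀` at a vertex, `F` is at most linear in the first variable, so one of any two factors
does not involve it. If non-constant, this factor is a cone and over an algebraically closed field
contains a line through `v₀`. -/
theorem irreducible [IsAlgClosed K] (hF : IsMonoidal F v₀ e) (hv : v₀ ≠ 0) : Irreducible F := by
  obtain ⟨g, hg⟩ := exists_linearEquiv_apply_single hv
  have hF' := hF.linSubst hg
  suffices h : Irreducible (PlaneSystem.linSubst g F) from
    (MulEquiv.irreducible_iff (linSubstEquiv g).toMulEquiv).1 h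
  generalize PlaneSystem.linSubst g F = G at hF'
  have hG0 := hF'.ne_zero (by simp)
  have key : ∀ A B : MvPolynomial (Fin 3) K, G = A * B → degreeOf 0 A = 0 → IsUnit A := by
    intro A B hAB hA
    have hA0 : A ≠ 0 := by rintro rfl; simp at hAB; exact hG0 hAB
    have hB0 : B ≠ 0 := by rintro rfl; simp at hAB; exact hG0 hAB
    obtain ⟨a, b, -, ha, -⟩ := isHomogeneous_factors hA0 hB0 (hAB ▸ hF'.hom)
    rcases Nat.eq_zero_or_pos a with rfl | hpos
    · rw [← totalDegree_zero_iff_isHomogeneous, totalDegree_eq_zero_iff_eq_C] at ha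
      rw [ha]
      refine (isUnit_iff_ne_zero.2 fun h0 => hA0 ?_).map C
      rw [ha, h0, map_zero]
    · obtain ⟨q, hq, h⟩ := exists_line_of_forall_support hpos ha fun s hs =>
        Nat.le_zero.1 (degreeOf_le_iff.1 hA.le s hs)
      obtain ⟨s, hs⟩ := hF'.line q hq
      rw [hAB, map_mul, h, zero_mul] at hs
      exact absurd rfl hs
  refine ⟨fun hu => ?_, fun A B hAB => ?_⟩
  · have h1 := eval_mul_of_isHomogeneous hF'.hom 0 0
    rw [zero_pow (by have := hF'.pos; omega), zero_mul] at h1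
    exact (hu.map (eval _)).ne_zero h1
  · have hA0 : A ≠ 0 := by rintro rfl; simp at hAB; exact hG0 hAB
    have hB0 : B ≠ 0 := by rintro rfl; simp at hAB; exact hG0 hAB
    have h1 : degreeOf 0 G ≤ 1 := degreeOf_le_iff.2 hF'.support_le
    rw [hAB, degreeOf_mul_eq hA0 hB0] at h1
    rcases Nat.eq_zero_or_pos (degreeOf 0 A) with h2 | h2
    · exact Or.inl (key A B hAB h2)
    · exact Or.inr (key B A (hAB.trans (mul_comm _ _)) (by omega))

/-- With multiplicity equal to the degree the curve would be a cone, hence a union of lines through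
`v₀`. -/
theorem notMem_multGE [IsAlgClosed K] (hF : IsMonoidal F v₀ e) (hv : v₀ ≠ 0) :
    F ∉ multGE v₀ e := by
  obtain ⟨g, hg⟩ := exists_linearEquiv_apply_single hv
  have hF' := hF.linSubst hg
  rw [← hg, ← linSubst_mem_multGE_iff, mem_multGE_single_iff hF'.hom]
  intro h
  obtain ⟨q, hq, h1⟩ := exists_line_of_forall_support hF'.pos hF'.hom fun s hs => by
    have := h s hs
    omega
  obtain ⟨s, hs⟩ := hF'.line q hq
  exact hs (h1 s)

/-- On the line joining `v₀` to a second double point, `F` would have zeros of total order at least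
`e + 1`, so it would vanish on the line. -/
theorem notMem_multGE_two (hF : IsMonoidal F v₀ e) {q : Fin 3 → K}
    (hq : LinearIndependent K ![v₀, q]) : F ∉ multGE q 2 := by
  obtain ⟨u, hu⟩ := exists_linearIndependent_three hq
  obtain ⟨g, hg, hgq, -⟩ := exists_linearEquiv hu
  have hF' := hF.linSubst hg
  rw [← hgq, ← linSubst_mem_multGE_iff, mem_multGE_single_iff hF'.hom]
  intro h
  obtain ⟨s, hs⟩ := hF'.line (Pi.single 1 1) (by
    have := linearIndependent_single_zero (K := K) (a := 1) (b := 0) (Or.inl one_ne_zero)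
    convert! this using 3
    ext i; fin_cases i <;> rfl)
  have h2 : (Pi.single 1 1 + s • Pi.single 0 1 : Fin 3 → K) = ![s, 1, 0] := by
    ext i; fin_cases i <;> simp
  rw [h2, eval_line hF'.hom hF'.support_le] at hs
  have hpos := hF.pos
  have h3 : ∀ t : Fin 3 →₀ ℕ, e < t 1 + 2 → coeff t (PlaneSystem.linSubst g F) = 0 := by
    intro t ht
    by_contra h4
    have := h t (mem_support_iff.2 h4)
    omega
  rw [h3 _ (by simp; omega), h3 _ (by simp)] at hs
  simp at hs

/-- The equation `x * B(y, z) + C(y, z) = 0` is solved for `x`: the point with parameter `t` is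
`(-C(1, t) : B(1, t) : t * B(1, t))`, and the inverse `z / y` is the projection from `v₀`. If `B`
were zero, the curve would be a cone. -/
theorem isRationalCurve [IsAlgClosed K] (hF : IsMonoidal F v₀ e) (hv : v₀ ≠ 0) :
    IsRationalCurve F := by
  have : Infinite K := IsAlgClosed.instInfinite
  obtain ⟨g, hg⟩ := exists_linearEquiv_apply_single hv
  have hF' := hF.linSubst hg
  obtain ⟨B, C, hB, hC, hBC⟩ := exists_eq_X_mul_add hF'.pos hF'.hom hF'.support_le
  let b : Polynomial K := aeval ![1, Polynomial.X] B
  let c : Polynomial K := aeval ![1, Polynomial.X] C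
  let G₀ : Fin 3 → Polynomial K := ![-c, b, b * Polynomial.X]
  have hb : b ≠ 0 := by
    intro hb
    have hB0 : B = 0 := by
      apply eq_zero_of_eval_one hB
      intro t
      have h1 : (Polynomial.aeval t).comp
          (aeval ![1, Polynomial.X] : MvPolynomial (Fin 2) K →ₐ[K] Polynomial K) =
          aeval ![1, t] := by
        apply MvPolynomial.algHom_ext
        intro i
        fin_cases i <;> simp
      have := congrArg (fun f => f B) h1
      simp only [AlgHom.comp_apply, aeval_eq_eval] at this
      change Polynomial.aeval t b = _ at this
      rw [hb, map_zero] at this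
      exact this.symm
    obtain ⟨x, y, hxy, h0⟩ := exists_zero_of_isHomogeneous hF'.pos hC
    obtain ⟨s, hs⟩ := hF'.line _ (linearIndependent_single_zero hxy)
    have h2 : (![0, x, y] + s • Pi.single 0 1 : Fin 3 → K) = ![s, x, y] := by
      ext i; fin_cases i <;> simp
    rw [h2, hBC, eval_X_mul_add, hB0, h0] at hs
    simp at hs
  refine ⟨fun i => ∑ j, algebraMap K (Polynomial K) (g (Pi.single j 1) i) * G₀ j, 1,
    PlaneSystem.linSubst g.symm (X 2), PlaneSystem.linSubst g.symm (X 1),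
    isHomogeneous_linSubst _ (isHomogeneous_X _ _), isHomogeneous_linSubst _ (isHomogeneous_X _ _),
    ?_, ?_, ?_⟩
  · rw [← aeval_linSubst, hBC]
    simp only [G₀]
    rw [aeval_X_mul_add]
    have h3 : (![b, b * Polynomial.X] : Fin 2 → Polynomial K) =
        fun i => b * ![1, Polynomial.X] i := by
      ext1 i; fin_cases i <;> simp
    rw [h3, aeval_mul_of_isHomogeneous hB, aeval_mul_of_isHomogeneous hC]
    change -c * (b ^ (e - 1) * b) + b ^ e * c = 0
    rw [← pow_succ, Nat.sub_add_cancel hF.pos]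
    ring
  · rw [← aeval_linSubst, linSubst_linSubst_symm, aeval_X]
    exact hb
  · rw [← aeval_linSubst, ← aeval_linSubst, linSubst_linSubst_symm,
      linSubst_linSubst_symm, aeval_X, aeval_X]
    simp [G₀, mul_comm]

end IsMonoidal

/-! ## Smoothness of strict transforms -/

/-- In the coordinates `(1 : s : s * t)` distinct monomials of a form of fixed degree stay distinct,
so each coefficient of the pullback is a single coefficient of the form. -/
theorem coeff_blowupPullback {F : MvPolynomial (Fin 3) K} {e : ℕ} (hF : F.IsHomogeneous e)
    {v w u : Fin 3 → K} {g : (Fin 3 → K) ≃ₗ[K] (Fin 3 → K)} (hv : g (Pi.single 0 1) = v)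
    (hw : g (Pi.single 1 1) = w) (hu : g (Pi.single 2 1) = u) {i j : ℕ} (hij : j ≤ i)
    (hi : i ≤ e) :
    (blowupPullback F v w u).coeff (Finsupp.single 0 i + Finsupp.single 1 j) =
      coeff (Finsupp.equivFunOnFinite.symm ![e - i, i - j, j]) (linSubst g F) := by
  have h1 : blowupPullback F v w u =
      aeval (![1, X 0, X 0 * X 1] : Fin 3 → MvPolynomial (Fin 2) K) (linSubst g F) := by
    rw [aeval_linSubst, blowupPullback]
    congr 2
    ext1 a
    rw [Fin.sum_univ_three, hv, hw, hu]
    simp [algebraMap_eq]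
    ring
  have hhom := isHomogeneous_linSubst g hF
  have hmon : ∀ (s : Fin 3 →₀ ℕ) (c : K),
      aeval (![1, X 0, X 0 * X 1] : Fin 3 → MvPolynomial (Fin 2) K) (monomial s c) =
        monomial (Finsupp.single 0 (s 1 + s 2) + Finsupp.single 1 (s 2)) c := by
    intro s c
    rw [aeval_monomial, monomial_eq, algebraMap_eq, Finsupp.prod_fintype _ _ (by simp),
      Finsupp.prod_fintype _ _ (by simp), Fin.prod_univ_three, Fin.prod_univ_two]
    simp
    left
    ring
  rw [h1]
  generalize linSubst g F = G at hhom
  conv_lhs => rw [G.as_sum]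
  rw [map_sum, coeff_sum, Finset.sum_eq_single
    (Finsupp.equivFunOnFinite.symm ![e - i, i - j, j] : Fin 3 →₀ ℕ)]
  · rw [hmon, coeff_monomial, if_pos]
    simp [hij]
  · intro s hs hne
    rw [hmon, coeff_monomial, if_neg]
    intro h2
    have h3 := congrArg (fun f => f 0) h2
    have h4 := congrArg (fun f => f 1) h2
    simp at h3 h4
    have h5 := sum_of_mem_support hhom hs
    apply hne
    ext a
    fin_cases a <;> simp <;> omega
  · intro h2
    rw [hmon, notMem_support_iff.1 h2]
    simp

/-- The coefficients of `s ^ (e - 1)` and `s ^ e` are the two coefficients of `F` on the line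
through `v₀` in direction `w`; if both vanished, the line would lie in the curve. -/
theorem IsMonoidal.strictTransformSmoothOver {F : MvPolynomial (Fin 3) K} {v₀ : Fin 3 → K} {e : ℕ}
    (hF : IsMonoidal F v₀ e) : StrictTransformSmoothOver F v₀ (e - 1) := by
  intro w u h
  obtain ⟨g, hg, hgw, hgu⟩ := exists_linearEquiv h
  have hF' := hF.linSubst hg
  have hpos := hF.pos
  have h1 := coeff_blowupPullback hF.hom hg hgw hgu (i := e - 1) (j := 0) (by omega) (by omega)
  have h2 := coeff_blowupPullback hF.hom hg hgw hgu (i := e - 1 + 1) (j := 0) (by omega) (by omega)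
  rw [Finsupp.single_zero, add_zero] at h1 h2
  rw [h1, h2]
  by_contra! hn
  obtain ⟨s, hs⟩ := hF'.line (Pi.single 1 1) (by
    have := linearIndependent_single_zero (K := K) (a := 1) (b := 0) (Or.inl one_ne_zero)
    convert! this using 3
    ext i; fin_cases i <;> rfl)
  have h2 : (Pi.single 1 1 + s • Pi.single 0 1 : Fin 3 → K) = ![s, 1, 0] := by
    ext i; fin_cases i <;> simp
  rw [h2, eval_line hF'.hom hF'.support_le] at hs
  have e1 : e - (e - 1) = 1 := by omega
  have e2 : e - (e - 1 + 1) = 0 := by omega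
  have e3 : e - 1 + 1 - 0 = e := by omega
  rw [e1, e2, e3, Nat.sub_zero] at hn
  rw [hn.1, hn.2.1] at hs
  simp at hs

theorem strictTransformSmoothOver_zero {F : MvPolynomial (Fin 3) K} {v : Fin 3 → K} {e : ℕ}
    (hF : F.IsHomogeneous e) (h : F ∉ multGE v 1) : StrictTransformSmoothOver F v 0 := by
  intro w u hi
  obtain ⟨g, hg, hgw, hgu⟩ := exists_linearEquiv hi
  have h1 := coeff_blowupPullback hF hg hgw hgu (i := 0) (j := 0) le_rfl (by omega)
  rw [Finsupp.single_zero (1 : Fin 2), add_zero] at h1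
  left
  rw [h1]
  rw [← hg, ← linSubst_mem_multGE_iff, mem_multGE_single_iff (isHomogeneous_linSubst g hF)] at h
  push Not at h
  obtain ⟨s, hs, h2⟩ := h
  have h3 := sum_of_mem_support (isHomogeneous_linSubst g hF) hs
  have h4 : s = Finsupp.equivFunOnFinite.symm ![e - 0, 0 - 0, 0] := by
    ext a; fin_cases a <;> simp <;> omega
  rw [← h4]
  exact mem_support_iff.1 hs

/-- The linear part of the local equation at a simple point gives the coefficients of `s` and `s *
t`, which cannot both vanish. -/
theorem strictTransformSmoothOver_one {F : MvPolynomial (Fin 3) K} {v : Fin 3 → K} {e : ℕ}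
    (hF : F.IsHomogeneous e) (h1 : F ∈ multGE v 1) (h : F ∉ multGE v 2) :
    StrictTransformSmoothOver F v 1 := by
  intro w u hi
  obtain ⟨g, hg, hgw, hgu⟩ := exists_linearEquiv hi
  have hhom := isHomogeneous_linSubst g hF
  rw [← hg, ← linSubst_mem_multGE_iff, mem_multGE_single_iff hhom] at h h1
  push Not at h
  obtain ⟨s, hs, h2⟩ := h
  have h3 := sum_of_mem_support hhom hs
  have h4 := h1 s hs
  have c1 := coeff_blowupPullback hF hg hgw hgu (i := 1) (j := 0) (by omega) (by omega)
  have c2 := coeff_blowupPullback hF hg hgw hgu (i := 1) (j := 1) (by omega) (by omega)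
  rw [Finsupp.single_zero, add_zero] at c1
  rcases Nat.eq_zero_or_pos (s 2) with h5 | h5
  · left
    have h6 : s = Finsupp.equivFunOnFinite.symm ![e - 1, 1 - 0, 0] := by
      ext a; fin_cases a <;> simp <;> omega
    rw [c1, ← h6]
    exact mem_support_iff.1 hs
  · right; right
    have h6 : s = Finsupp.equivFunOnFinite.symm ![e - 1, 1 - 1, 1] := by
      ext a; fin_cases a <;> simp <;> omega
    rw [c2, ← h6]
    exact mem_support_iff.1 hs

/-- A criterion for a monoidal curve to be a `(-1)`-curve of a given class. -/
theorem isNegOneCurve_of_isMonoidal [IsAlgClosed K] {n : ℕ} {p : Fin (n + 1) → ℙ K (Fin 3 → K)}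
    {F : MvPolynomial (Fin 3) K} {e : ℕ} {b : Fin 3 → K} {A : PlaneClass n}
    (hF : IsMonoidal F b e) (hb : b ≠ 0) (hbp : b = (p 0).rep ∨ e = 1) (hdeg : A.deg = e)
    (hself : A.inter A = -1)
    (hmult : ∀ i, (b = (p i).rep ∧ A.mult i = (e - 1 : ℕ)) ∨
      (A.mult i = 0 ∧ F ∉ multGE (p i).rep 1) ∨
      (A.mult i = 1 ∧ F ∈ multGE (p i).rep 1 ∧ F ∉ multGE (p i).rep 2)) :
    IsNegOneCurve p F A where
  irreducible := hF.irreducible hb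
  degree := ⟨e, hdeg, hF.hom⟩
  rational := hF.isRationalCurve hb
  smooth_away := fun q hq => by
    rcases hbp with hbp | rfl
    · apply hF.notMem_multGE_two
      rw [hbp]
      exact Projectivization.linearIndependent_pair_iff_ne.2 (hq 0).symm
    · intro h
      have := mult_le_degree (hF.ne_zero hb) hF.hom q.rep_nonzero h
      omega
  smooth_over := fun i => by
    rcases hmult i with ⟨h1, h2⟩ | ⟨h1, h2⟩ | ⟨h1, h2, h3⟩
    · refine ⟨e - 1, h2, ?_, ?_, ?_⟩ <;> rw [← h1]
      · exact hF.mult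
      · rw [Nat.sub_add_cancel hF.pos]
        exact hF.notMem_multGE hb
      · exact hF.strictTransformSmoothOver
    · exact ⟨0, h1, mem_multGE_zero, h2, strictTransformSmoothOver_zero hF.hom h2⟩
    · exact ⟨1, h1, h2, h3, strictTransformSmoothOver_one hF.hom h2 h3⟩
  self_inter := hself

/-! ## Some irreducible `(-1)`-classes -/

section Classes

variable {n : ℕ}

/-- The class of degree `δ` with multiplicity `a` at `p₀` and `b` at the points of `T`. -/
def cls (δ a b : ℤ) (T : Finset (Fin (n + 1))) : PlaneClass n :=
  (δ, fun i => if i = 0 then a else if i ∈ T then b else 0)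

@[simp] theorem deg_cls (δ a b : ℤ) (T : Finset (Fin (n + 1))) : (cls δ a b T).deg = δ := rfl

theorem mult_cls_zero (δ a b : ℤ) (T : Finset (Fin (n + 1))) : (cls δ a b T).mult 0 = a := by
  simp [cls, PlaneClass.mult]

theorem mult_cls_of_mem {δ a b : ℤ} {T : Finset (Fin (n + 1))} {i : Fin (n + 1)} (hi : i ∈ T)
    (h0 : 0 ∉ T) : (cls δ a b T).mult i = b := by
  have : i ≠ 0 := by rintro rfl; exact h0 hi
  simp [cls, PlaneClass.mult, this, hi]

theorem sum_mult_cls (f : Fin (n + 1) → ℤ → ℤ) (hf : ∀ i, f i 0 = 0) (δ a b : ℤ)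
    {T : Finset (Fin (n + 1))} (h0 : 0 ∉ T) :
    ∑ i, f i ((cls δ a b T).mult i) = f 0 a + ∑ i ∈ T, f i b := by
  have h : ∀ i, f i ((cls δ a b T).mult i) =
      (if i = 0 then f i a else 0) + (if i ∈ T then f i b else 0) := by
    intro i
    by_cases h1 : i = 0
    · subst h1; simp [cls, PlaneClass.mult, h0]
    · by_cases h2 : i ∈ T <;> simp [cls, PlaneClass.mult, h1, h2, hf]
  rw [Finset.sum_congr rfl fun i _ => h i, Finset.sum_add_distrib, Finset.sum_ite_eq',
    Finset.sum_ite_mem]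
  simp

theorem inter_cls (δ a b : ℤ) {T : Finset (Fin (n + 1))} (h0 : 0 ∉ T) (D : PlaneClass n) :
    D.inter (cls δ a b T) = D.deg * δ - D.mult 0 * a - ∑ i ∈ T, D.mult i * b := by
  rw [PlaneClass.inter, deg_cls, sum_mult_cls (fun i x => D.mult i * x) (by simp) δ a b h0]
  ring

theorem inter_cls_cls (δ a b δ' a' b' : ℤ) {T T' : Finset (Fin (n + 1))} (h0 : 0 ∉ T)
    (h0' : 0 ∉ T') (hT : T' ⊆ T) :
    (cls δ a b T).inter (cls δ' a' b' T') = δ * δ' - a * a' - T'.card * (b * b') := by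
  rw [inter_cls _ _ _ h0', deg_cls, mult_cls_zero, Finset.sum_congr rfl fun i hi => by
    rw [mult_cls_of_mem (hT hi) h0]]
  simp

theorem two_mul_genus_cls (δ a b : ℤ) {T : Finset (Fin (n + 1))} (h0 : 0 ∉ T) :
    2 * (cls δ a b T).genus =
      (δ - 1) * (δ - 2) - a * (a - 1) - T.card * (b * (b - 1)) := by
  rw [PlaneClass.two_mul_genus, deg_cls,
    sum_mult_cls (fun _ x => x * (x - 1)) (by simp) δ a b h0]
  simp
  ring

theorem two_mul_vdim_cls (δ a b : ℤ) {T : Finset (Fin (n + 1))} (h0 : 0 ∉ T) :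
    2 * (cls δ a b T).vdim =
      δ * (δ + 3) - a * (a + 1) - T.card * (b * (b + 1)) := by
  rw [PlaneClass.two_mul_vdim, deg_cls,
    sum_mult_cls (fun _ x => x * (x + 1)) (by simp) δ a b h0]
  simp
  ring

end Classes

/-- Two vectors in a plane with the first coordinate vector are dependent with it. -/
theorem not_linearIndependent_of_apply_two {a b : Fin 3 → K} (ha : a 2 = 0) (hb : b 2 = 0) :
    ¬ LinearIndependent K ![Pi.single 0 1, a, b] := by
  intro h
  rw [Fintype.linearIndependent_iff] at h
  have h1 := h ![-(b 1 * a 0 - a 1 * b 0), b 1, -a 1] (by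
    ext i
    fin_cases i <;> simp [Fin.sum_univ_three, ha, hb]
    ring)
  have h2 : a 1 = 0 := by simpa using h1 2
  have h3 := h ![-a 0, 1, 0] (by
    ext i
    fin_cases i <;> simp [Fin.sum_univ_three, ha, h2]) 1
  simp at h3

theorem exists_linearEquiv_three {v w u : Fin 3 → K} (h : LinearIndependent K ![v, w, u])
    (g : (Fin 3 → K) ≃ₗ[K] (Fin 3 → K)) : LinearIndependent K ![g v, g w, g u] := by
  have h1 : ![g v, g w, g u] = g ∘ ![v, w, u] := by
    ext a
    fin_cases a <;> rfl
  rw [h1]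
  exact h.map' g.toLinearMap g.ker

/-- Under genericity conditions, the curve of degree `e` with a point of multiplicity `e - 1` and
`2 e` simple base points exists and contains no line through the multiple point. -/
theorem exists_isMonoidal {ι : Type*} [Fintype ι] [DecidableEq ι] {o : ι} {T : Finset ι} {e : ℕ}
    (he : 1 ≤ e) (hT : o ∉ T) (hTc : T.card = 2 * e) {w : ι → Fin 3 → K} (hw : ∀ i, w i ≠ 0)
    (hind : ∀ i ∈ T, ∀ j ∈ T, i ≠ j → LinearIndependent K ![w o, w i, w j])
    (hemp : ∀ i ∈ T,
      Module.finrank K (sys (e - 1) (mfun o (e - 1 - 1) (T.erase i) 1 ∅ 1) w) ≤ 0) :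
    ∃ F, F ≠ 0 ∧ F ∈ sys e (mfun o (e - 1) T 1 ∅ 1) w ∧ IsMonoidal F (w o) e := by
  have hbot : ∀ i ∈ T, ∀ F ∈ sys (e - 1) (mfun o (e - 1 - 1) (T.erase i) 1 ∅ 1) w, F = 0 := by
    intro i hi F hF
    have h1 := Submodule.finrank_eq_zero.1 (Nat.le_zero.1 (hemp i hi))
    rw [h1] at hF
    exact (Submodule.mem_bot K).1 hF
  have hmf : mfun o (e - 1) T 1 ∅ 1 = mfun o (e - 1) T 1 ∅ 0 := by
    ext i; simp [mfun]
  -- The forms with multiplicity `e - 1` at one point have dimension `2 * e + 1`, one more than the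
  -- number of simple points.
  have hpos : 0 < Module.finrank K (sys e (mfun o (e - 1) T 1 ∅ 1) w) := by
    have h1 := tri_le_finrank_sys e (mfun o (e - 1) T 1 ∅ 1) hw
    rw [hmf, sum_mfun tri rfl _ _ hT, ← hmf, hTc, tri_one] at h1
    obtain ⟨c, rfl⟩ : ∃ c, e = c + 1 := ⟨e - 1, by omega⟩
    simp only [Nat.add_sub_cancel] at h1 ⊢
    rw [add_assoc, tri_add c, tri_two] at h1
    omega
  obtain ⟨⟨F, hF⟩, hF0⟩ := @Module.finrank_pos_iff_exists_ne_zero K _ _ _ _ _ _ _ |>.1 hpos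
  have hF0' : F ≠ 0 := fun h => hF0 (Subtype.ext h)
  refine ⟨F, hF0', hF, he, (mem_sys.1 hF).1, ?_, ?_⟩
  · have := (mem_sys.1 hF).2 o
    simpa [mfun] using this
  intro q hq
  by_contra! hn
  obtain ⟨u, hu⟩ := exists_linearIndependent_three hq
  obtain ⟨g, hgo, hgq, -⟩ := exists_linearEquiv hu
  have hhom := isHomogeneous_linSubst g (mem_sys.1 hF).1
  have hs0 : ∀ s ∈ (linSubst g F).support, s 0 ≤ 1 := by
    have h1 := (mem_sys.1 hF).2 o
    simp only [mfun, if_true] at h1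
    rw [← hgo, ← linSubst_mem_multGE_iff, mem_multGE_single_iff hhom] at h1
    intro s hs
    have := h1 s hs
    omega
  have hline : ∀ x : K, x * coeff (Finsupp.equivFunOnFinite.symm ![1, e - 1, 0]) (linSubst g F) +
      coeff (Finsupp.equivFunOnFinite.symm ![0, e, 0]) (linSubst g F) = 0 := by
    intro x
    have h1 := hn x
    rw [← hgo, ← hgq, ← map_smul, ← map_add] at h1
    rw [← eval_line hhom hs0, eval_linSubst,
      show (![x, 1, 0] : Fin 3 → K) = Pi.single 1 1 + x • Pi.single 0 1 by
        ext i; fin_cases i <;> simp]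
    exact h1
  have hc0 := hline 0
  have hc1 := hline 1
  rw [zero_mul, zero_add] at hc0
  rw [one_mul, hc0, add_zero] at hc1
  have hs2 : ∀ s ∈ (linSubst g F).support, s 2 ≠ 0 := by
    intro s hs h2
    have h3 := hs0 s hs
    have h4 := sum_of_mem_support hhom hs
    rw [mem_support_iff] at hs
    rcases Nat.le_one_iff_eq_zero_or_eq_one.1 h3 with h5 | h5
    · apply hs
      rw [← hc0]
      congr 1
      ext i; fin_cases i <;> simp <;> omega
    · apply hs
      rw [← hc1]
      congr 1
      ext i; fin_cases i <;> simp <;> omega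
  have hdvd : (X 2 : MvPolynomial (Fin 3) K) ∣ linSubst g F := by
    rw [(linSubst g F).as_sum]
    refine Finset.dvd_sum fun s hs => ?_
    exact X_dvd_monomial.2 (Or.inr (hs2 s hs))
  obtain ⟨H, hH⟩ := hdvd
  have hHhom : H.IsHomogeneous (e - 1) := by
    apply isHomogeneous_of_mul_left (X_ne_zero 2) (isHomogeneous_X K (2 : Fin 3))
    rw [← hH, Nat.add_sub_cancel' he]
    exact hhom
  have hFH : F = linSubst g.symm (X 2) * linSubst g.symm H := by
    rw [← map_mul, ← hH, linSubst_symm_linSubst]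
  have hev : ∀ j, eval (w j) (linSubst g.symm (X 2)) = g.symm (w j) 2 := by
    intro j
    rw [eval_linSubst, eval_X]
  -- A line through `w o` contains at most one further point of `T`. If it contains none, any `i`
  -- may be dropped. The cofactor of the line then passes through the other `2 * e - 1` points with
  -- multiplicity at least `e - 2` at `w o`, contradicting `hemp`.
  obtain ⟨i, hi, hij⟩ : ∃ i ∈ T, ∀ j ∈ T, j ≠ i → g.symm (w j) 2 ≠ 0 := by
    by_cases h1 : ∃ i ∈ T, g.symm (w i) 2 = 0
    · obtain ⟨i, hi, h2⟩ := h1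
      refine ⟨i, hi, fun j hj hne h3 => ?_⟩
      have h4 := exists_linearEquiv_three (hind i hi j hj hne.symm) g.symm
      rw [← hgo, LinearEquiv.symm_apply_apply] at h4
      exact not_linearIndependent_of_apply_two h2 h3 h4
    · push Not at h1
      obtain ⟨i, hi⟩ := Finset.card_pos.1 (show 0 < T.card by omega)
      exact ⟨i, hi, fun j hj _ => h1 j hj⟩
  have hmem : linSubst g.symm H ∈ sys (e - 1) (mfun o (e - 1 - 1) (T.erase i) 1 ∅ 1) w := by
    rw [mem_sys]
    refine ⟨isHomogeneous_linSubst _ hHhom, fun j => ?_⟩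
    by_cases hjo : j = o
    · subst hjo
      rw [linSubst_mem_multGE_iff, ← hgo, LinearEquiv.symm_apply_apply,
        mem_multGE_single_iff hHhom]
      intro s hs
      have h1 : s + Finsupp.single 2 1 ∈ (linSubst g F).support := by
        rw [mem_support_iff, hH, add_comm, coeff_X_mul]
        exact mem_support_iff.1 hs
      have h2 := hs0 _ h1
      have h3 := sum_of_mem_support hHhom hs
      simp at h2
      simp [mfun]
      omega
    · by_cases hjT : j ∈ T.erase i
      · have h1 := (mem_sys.1 hF).2 j
        have h2 := Finset.mem_erase.1 hjT
        simp only [mfun, hjo, if_false, h2.2, if_true] at h1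
        simp only [mfun, hjo, if_false, hjT, if_true]
        rw [hFH] at h1
        exact mem_multGE_of_mul_mem (by rw [hev]; exact hij j h2.2 h2.1) h1
      · simp [mfun, hjo, hjT, mem_multGE_zero]
  rw [hbot i hi _ hmem, mul_zero] at hFH
  exact hF0' hFH

/-! ### From chosen representatives of points to arbitrary vectors -/

theorem rep_mk_eq {n : ℕ} (v : Fin (n + 1) → Fin 3 → K) (hv : ∀ i, v i ≠ 0) :
    ∃ c : Fin (n + 1) → K, (∀ i, c i ≠ 0) ∧
      ∀ i, (Projectivization.mk K (v i) (hv i)).rep = c i • v i := by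
  choose a ha using fun i => Projectivization.exists_smul_eq_mk_rep K (v i) (hv i)
  exact ⟨fun i => (a i : K), fun i => (a i).ne_zero, fun i => (ha i).symm⟩

theorem linearIndependent_smul_two {c₀ c₁ : K} (h0 : c₀ ≠ 0) (h1 : c₁ ≠ 0)
    {x y : Fin 3 → K} (h : LinearIndependent K ![x, y]) :
    LinearIndependent K ![c₀ • x, c₁ • y] := by
  have := h.units_smul ![Units.mk0 c₀ h0, Units.mk0 c₁ h1]
  convert! this using 1
  ext i j
  fin_cases i <;> simp

theorem linearIndependent_smul_three {c₀ c₁ c₂ : K} (h0 : c₀ ≠ 0) (h1 : c₁ ≠ 0) (h2 : c₂ ≠ 0)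
    {x y z : Fin 3 → K} (h : LinearIndependent K ![x, y, z]) :
    LinearIndependent K ![c₀ • x, c₁ • y, c₂ • z] := by
  have := h.units_smul ![Units.mk0 c₀ h0, Units.mk0 c₁ h1, Units.mk0 c₂ h2]
  convert! this using 1
  ext i j
  fin_cases i <;> simp

section AlgClosed

variable [IsAlgClosed K]

/-- The curves of degree `e` with a point of multiplicity `e - 1` at `p₀` through `2 e` of the
other points. -/
theorem isIrreducibleNegOneClass_monoidal {n e : ℕ} (he : 1 ≤ e) {T : Finset (Fin (n + 1))}
    (h0 : 0 ∉ T) (hT : T.card = 2 * e) :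
    IsIrreducibleNegOneClass K (cls e (e - 1) 1 T) := by
  have : Infinite K := IsAlgClosed.instInfinite
  have hself : (cls e (e - 1) 1 T).inter (cls e (e - 1) 1 T) = -1 := by
    rw [inter_cls_cls _ _ _ _ _ _ h0 h0 subset_rfl, hT]
    push_cast
    ring
  refine ⟨⟨hself, ?_⟩, ?_⟩
  · have := two_mul_genus_cls (e : ℤ) (e - 1) 1 h0
    have h2 : 2 * (cls (e : ℤ) (e - 1) 1 T).genus = 0 := by rw [this]; ring
    omega
  have g1 : Generic fun v : Fin (n + 1) → Fin 3 → K => ∀ i, i ≠ 0 →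
      LinearIndependent K ![v 0, v i] :=
    Generic.all fun i => Generic.imp fun hi => Generic.linearIndependent_two (Ne.symm hi)
  have g2 : Generic fun v : Fin (n + 1) → Fin 3 → K => ∀ i j, (i ∈ T ∧ j ∈ T ∧ i ≠ j) →
      LinearIndependent K ![v 0, v i, v j] :=
    Generic.all fun i => Generic.all fun j => Generic.imp fun h =>
      Generic.linearIndependent_three (by rintro rfl; exact h0 h.1)
        (by rintro rfl; exact h0 h.2.1) h.2.2
  -- Used to exclude lines through `p₀`: a residual curve of degree `e - 1` would satisfy one
  -- condition too many. For `e = 1` it would be a nonzero constant with a zero.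
  have g3 : Generic fun v : Fin (n + 1) → Fin 3 → K => ∀ i, i ∈ T →
      Module.finrank K (sys (e - 1) (mfun 0 (e - 1 - 1) (T.erase i) 1 ∅ 1) v) ≤ 0 := by
    refine Generic.all fun i => Generic.imp fun hi => Gen.generic ?_
    have hc := Finset.card_erase_of_mem hi
    have h0' : 0 ∉ T.erase i := fun h => h0 (Finset.mem_of_mem_erase h)
    rcases Nat.lt_or_ge 1 e with h1 | h1
    · exact gen_sub_eq (Or.inl rfl) 0 _ _ rfl h0' _ _ (by omega)
        (by rw [hc, hT, tri_one]; simp; omega) (fun _ _ h => by omega)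
    · obtain ⟨j, hj⟩ := Finset.card_pos.1 (show 0 < (T.erase i).card by omega)
      have hj0 : j ≠ 0 := by rintro rfl; exact h0' hj
      refine Gen.of_degree_lt (i := j) ?_ 0
      simp only [mfun, hj0, if_false, hj, if_true]
      omega
  -- This ensures multiplicity exactly `0` at the points outside `T`: the curve is not expected to
  -- pass through an additional general point.
  have g4 : Generic fun v : Fin (n + 1) → Fin 3 → K => ∀ i, (i ≠ 0 ∧ i ∉ T) →
      Module.finrank K (sys e (mfun 0 (e - 1) (insert i T) 1 ∅ 1) v) ≤ 0 := by
    refine Generic.all fun i => Generic.imp fun hi => Gen.generic ?_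
    have hc := Finset.card_insert_of_notMem hi.2
    exact gen_sub_eq (Or.inl rfl) 0 _ _ rfl (by simp [hi.1.symm, h0]) _ _ he
      (by rw [hc, hT, tri_one]; simp; omega) (fun _ _ h => by omega)
  refine (((g1.and g2).and g3).and g4).forGeneralPoints
    fun v hv ⟨⟨⟨h1, h2⟩, h3⟩, h4⟩ => ?_
  obtain ⟨c, hc, hrep⟩ := rep_mk_eq v hv
  have hw0 : ∀ i, c i • v i ≠ 0 := fun i => smul_ne_zero (hc i) (hv i)
  obtain ⟨F, hF0, hF, hmon⟩ := exists_isMonoidal (w := fun i => c i • v i) he h0 hT hw0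
    (fun i hi j hj hij => linearIndependent_smul_three (hc _) (hc _) (hc _) (h2 i j ⟨hi, hj, hij⟩))
    (fun i hi => by rw [sys_smul _ _ _ hc]; exact h3 i hi)
  refine ⟨F, isNegOneCurve_of_isMonoidal hmon (hw0 0) (Or.inl (hrep 0).symm) rfl hself fun i => ?_⟩
  rw [hrep]
  by_cases hi0 : i = 0
  · subst hi0
    left
    refine ⟨rfl, ?_⟩
    rw [mult_cls_zero]
    omega
  right
  by_cases hiT : i ∈ T
  · right
    refine ⟨mult_cls_of_mem hiT h0, ?_, ?_⟩
    · have := (mem_sys.1 hF).2 i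
      simpa [mfun, hi0, hiT] using this
    · exact hmon.notMem_multGE_two (linearIndependent_smul_two (hc _) (hc _) (h1 i hi0))
  · left
    refine ⟨by simp [cls, PlaneClass.mult, hi0, hiT], fun hmem => hF0 ?_⟩
    have h5 := h4 i ⟨hi0, hiT⟩
    rw [← sys_smul _ _ v hc] at h5
    have h6 := Submodule.finrank_eq_zero.1 (Nat.le_zero.1 h5)
    rw [← Submodule.mem_bot K, ← h6, mem_sys]
    refine ⟨(mem_sys.1 hF).1, fun j => ?_⟩
    have h7 := (mem_sys.1 hF).2 j
    by_cases hj : j = i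
    · subst hj
      simpa [mfun, hi0] using hmem
    · simpa [mfun, hj] using h7

/-- The line through `p₀` and `pᵢ`. -/
theorem isIrreducibleNegOneClass_line {n : ℕ} {i : Fin (n + 1)} (hi : i ≠ 0) :
    IsIrreducibleNegOneClass K (cls 1 1 1 {i}) := by
  have : Infinite K := IsAlgClosed.instInfinite
  have h0 : 0 ∉ ({i} : Finset (Fin (n + 1))) := by simpa using hi.symm
  have hself : (cls 1 1 1 {i}).inter (cls 1 1 1 {i}) = -1 := by
    rw [inter_cls_cls _ _ _ _ _ _ h0 h0 subset_rfl]
    simp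
  refine ⟨⟨hself, ?_⟩, ?_⟩
  · have := two_mul_genus_cls 1 1 1 h0
    have h2 : 2 * (cls 1 1 1 {i}).genus = 0 := by rw [this]; ring
    omega
  have g1 : Generic fun v : Fin (n + 1) → Fin 3 → K => LinearIndependent K ![v 0, v i] :=
    Generic.linearIndependent_two (Ne.symm hi)
  have g2 : Generic fun v : Fin (n + 1) → Fin 3 → K => ∀ j, (j ≠ 0 ∧ j ≠ i) →
      LinearIndependent K ![v 0, v i, v j] :=
    Generic.all fun j => Generic.imp fun h =>
      Generic.linearIndependent_three (Ne.symm hi) h.1.symm h.2.symm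
  refine (g1.and g2).forGeneralPoints fun v hv ⟨h1, h2⟩ => ?_
  obtain ⟨c, hc, hrep⟩ := rep_mk_eq v hv
  obtain ⟨u, hu⟩ := exists_linearIndependent_three
    (linearIndependent_smul_two (hc 0) (hc i) h1)
  obtain ⟨g, hg0, hgi, hgu⟩ := exists_linearEquiv hu
  have hev : ∀ x, eval x (linSubst g.symm (X 2)) = g.symm x 2 := fun x => by
    rw [eval_linSubst, eval_X]
  have hl : (linSubst g.symm (X 2)).IsHomogeneous 1 :=
    isHomogeneous_linSubst _ (isHomogeneous_X _ _)
  have hl0 : linSubst g.symm (X 2) ≠ 0 := fun h =>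
    X_ne_zero (R := K) (2 : Fin 3) (linSubst_injective g.symm (h.trans (map_zero _).symm))
  have hu0 : u ≠ 0 := hu.ne_zero 2
  -- A line is monoidal with respect to a point off it. The point `p₀` would not do as vertex, since
  -- the line through `p₀` is the curve itself.
  have hmon : IsMonoidal (linSubst g.symm (X 2)) u 1 := by
    refine ⟨le_rfl, hl, mem_multGE_zero, fun q _ => ?_⟩
    refine ⟨1 - g.symm q 2, ?_⟩
    rw [hev, map_add, map_smul, ← hgu, LinearEquiv.symm_apply_apply]
    simp
  have hnot : ∀ j, linSubst g.symm (X 2) ∉ multGE (Projectivization.mk K (v j) (hv j)).rep 2 :=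
    fun j h => by
      have := mult_le_degree hl0 hl (Projectivization.rep_nonzero _) h
      omega
  refine ⟨_, isNegOneCurve_of_isMonoidal hmon hu0 (Or.inr rfl) rfl hself fun j => Or.inr ?_⟩
  by_cases hj0 : j = 0
  · subst hj0
    right
    refine ⟨mult_cls_zero _ _ _ _, ?_, hnot 0⟩
    rw [mem_multGE_one, hev, hrep, ← hg0, LinearEquiv.symm_apply_apply]
    simp
  by_cases hji : j = i
  · subst hji
    right
    refine ⟨mult_cls_of_mem (by simp) h0, ?_, hnot j⟩
    rw [mem_multGE_one, hev, hrep, ← hgi, LinearEquiv.symm_apply_apply]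
    simp
  · left
    refine ⟨by simp [cls, PlaneClass.mult, hj0, hji], ?_⟩
    rw [mem_multGE_one, hev, hrep]
    have h3 := linearIndependent_smul_three (hc 0) (hc i) (hc j) (h2 j ⟨hj0, hji⟩)
    have h4 := exists_linearEquiv_three h3 g.symm
    rw [← hg0, ← hgi, LinearEquiv.symm_apply_apply, LinearEquiv.symm_apply_apply] at h4
    exact apply_ne_zero_of_linearIndependent_two h4

end AlgClosed

/-! ## Systems with `(-1)`-curves in the base locus -/

namespace PlaneClass

variable {n : ℕ}

theorem inter_comm (D D' : PlaneClass n) : D.inter D' = D'.inter D := by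
  simp only [inter, mul_comm]

theorem inter_add_left (D D' E : PlaneClass n) :
    (D + D').inter E = D.inter E + D'.inter E := by
  simp only [inter, deg, mult, Prod.fst_add, Prod.snd_add, Pi.add_apply, add_mul,
    Finset.sum_add_distrib]
  ring

theorem inter_zero_left (E : PlaneClass n) : (0 : PlaneClass n).inter E = 0 := by
  simp [inter, deg, mult]

theorem inter_nsmul_left (k : ℕ) (D E : PlaneClass n) : (k • D).inter E = k * D.inter E := by
  induction k with
  | zero => simp [inter_zero_left]
  | succ k ih => rw [succ_nsmul, inter_add_left, ih]; push_cast; ring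

theorem inter_sum_left {α : Type*} (S : Finset α) (f : α → PlaneClass n) (E : PlaneClass n) :
    (∑ A ∈ S, f A).inter E = ∑ A ∈ S, (f A).inter E := by
  classical
  induction S using Finset.induction_on with
  | empty => simp [inter_zero_left]
  | insert a S ha ih => rw [Finset.sum_insert ha, Finset.sum_insert ha, inter_add_left, ih]

/-- The intersection number with the anticanonical class `(3; 1, …, 1)`. -/
def antiK (D : PlaneClass n) : ℤ := D.inter (3, fun _ => 1)

/-- The Riemann-Roch formula `2v = D · (D - K)`, which reduces comparisons of virtual dimensions to
bilinear algebra. -/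
theorem two_mul_vdim_eq (D : PlaneClass n) : 2 * D.vdim = D.inter D + D.antiK := by
  rw [two_mul_vdim, antiK, inter, inter]
  simp only [deg, mult, mul_one, mul_add, Finset.sum_add_distrib]
  ring

/-- This is adjunction for genus `0` and self-intersection `-1`. -/
theorem IsNegOneClass.antiK_eq {D : PlaneClass n} (h : D.IsNegOneClass) : D.antiK = 1 := by
  have h1 := two_mul_genus D
  have h2 : D.inter D = -1 := h.1
  rw [h.2] at h1
  rw [antiK, inter]
  rw [inter] at h2
  simp only [deg, mult, mul_one, mul_sub, Finset.sum_sub_distrib] at *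
  linarith

/-- Removing the `(-1)`-curves with negative intersection number raises the virtual dimension. -/
theorem vdim_lt_of_inter {L M : PlaneClass n} {S : Finset (PlaneClass n)} {N : PlaneClass n → ℕ}
    (hM : M = L - ∑ A ∈ S, N A • A) (hneg : ∀ A ∈ S, A.IsNegOneClass)
    (hN : ∀ A ∈ S, 1 ≤ N A) (hL : ∀ A ∈ S, L.inter A = -(N A : ℤ))
    (hpos : ∀ A ∈ S, ∀ B ∈ S, A ≠ B → 0 ≤ A.inter B) (h2 : ∃ A ∈ S, 2 ≤ N A) :
    L.vdim < M.vdim := by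
  have hLM : L = M + ∑ A ∈ S, N A • A := by rw [hM]; abel
  have hE : ∀ D : PlaneClass n, (∑ A ∈ S, N A • A).inter D = ∑ A ∈ S, (N A : ℤ) * A.inter D := by
    intro D
    rw [inter_sum_left]
    simp only [inter_nsmul_left]
  -- The self-intersection of `A` cancels `L · A = -N A` exactly, and the other fixed curves only
  -- subtract. The curves need not be disjoint.
  have hMA : ∀ A ∈ S, A.inter M ≤ 0 := by
    classical
    intro A hA
    have h1 : L.inter A = M.inter A + ∑ B ∈ S, (N B : ℤ) * B.inter A := by
      rw [← hE, ← inter_add_left, ← hLM]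
    rw [← Finset.add_sum_erase _ _ hA, hL A hA, (hneg A hA).1] at h1
    have h3 : 0 ≤ ∑ B ∈ S.erase A, (N B : ℤ) * B.inter A := by
      refine Finset.sum_nonneg fun B hB => mul_nonneg (Int.natCast_nonneg _) ?_
      exact hpos B (Finset.mem_of_mem_erase hB) A hA (Finset.ne_of_mem_erase hB)
    rw [inter_comm]
    linarith
  have h3 : L.inter L = M.inter M + ∑ A ∈ S, (N A : ℤ) * A.inter M +
      ∑ A ∈ S, (N A : ℤ) * -(N A : ℤ) := by
    have e1 : L.inter L = M.inter L + ∑ A ∈ S, (N A : ℤ) * A.inter L := by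
      rw [← hE, ← inter_add_left, ← hLM]
    have e2 : M.inter L = M.inter M + ∑ A ∈ S, (N A : ℤ) * A.inter M := by
      rw [← hE, ← inter_add_left, ← hLM, inter_comm]
    rw [e1, e2]
    congr 1
    exact Finset.sum_congr rfl fun A hA => by rw [inter_comm, hL A hA]
  have h4 : L.antiK = M.antiK + ∑ A ∈ S, (N A : ℤ) := by
    have e1 : L.antiK = M.antiK + ∑ A ∈ S, (N A : ℤ) * A.antiK := by
      simp only [antiK]
      rw [← hE, ← inter_add_left, ← hLM]
    rw [e1]
    congr 1
    exact Finset.sum_congr rfl fun A hA => by rw [(hneg A hA).antiK_eq, mul_one]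
  have h5 : ∑ A ∈ S, (N A : ℤ) * A.inter M ≤ 0 :=
    Finset.sum_nonpos fun A hA => mul_nonpos_of_nonneg_of_nonpos (Int.natCast_nonneg _) (hMA A hA)
  -- Each curve contributes `-N (N - 1)`, which is strictly negative as soon as `N ≥ 2`.
  have h6 : ∑ A ∈ S, ((N A : ℤ) * -(N A : ℤ) + N A) < ∑ A ∈ S, (0 : ℤ) := by
    refine Finset.sum_lt_sum (fun A hA => ?_) ?_
    · have := hN A hA
      nlinarith
    · obtain ⟨A, hA, h7⟩ := h2
      exact ⟨A, hA, by nlinarith⟩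
  rw [Finset.sum_add_distrib, Finset.sum_const_zero] at h6
  have h7 := two_mul_vdim_eq L
  have h8 := two_mul_vdim_eq M
  omega

end PlaneClass

/-! ### Curves of given classes at general points, and comparison of dimensions -/

open PlaneClass

variable {n : ℕ}

/-- The form `F` is irreducible with the degree and the multiplicities of the class `A`. -/
def IsCurveOfClass (v : Fin (n + 1) → Fin 3 → K) (A : PlaneClass n)
    (F : MvPolynomial (Fin 3) K) : Prop :=
  Irreducible F ∧ ∃ (δ : ℕ) (μ : Fin (n + 1) → ℕ), A.deg = δ ∧ (∀ i, A.mult i = μ i) ∧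
    F ∈ sys δ μ v ∧ ∀ i, F ∉ multGE (v i) (μ i + 1)

/-- Nonzero pairwise independent vectors, i.e. coordinates of distinct points. -/
def Distinct (v : Fin (n + 1) → Fin 3 → K) : Prop :=
  (∀ i, v i ≠ 0) ∧ ∀ i j, i ≠ j → LinearIndependent K ![v i, v j]

theorem generic_distinct : Generic fun v : Fin (n + 1) → Fin 3 → K => Distinct v :=
  (Generic.all fun i => Generic.ne_zero i).and
    (Generic.all fun _ => Generic.all fun _ => Generic.imp fun h => Generic.linearIndependent_two h)

/-- Passes from projective points to vectors and keeps what the intersection arguments use: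
irreducibility, the degree and the exact multiplicities. -/
theorem IsIrreducibleNegOneClass.generic {A : PlaneClass n} (hA : IsIrreducibleNegOneClass K A) :
    Generic fun v : Fin (n + 1) → Fin 3 → K => ∃ F, IsCurveOfClass v A F := by
  obtain ⟨Φ, h0, h1⟩ := hA.2
  have hg : Generic fun v : Fin (n + 1) → Fin 3 → K => eval (fun ij => v ij.1 ij.2) Φ ≠ 0 :=
    ⟨Φ, h0, fun _ h => h⟩
  refine (hg.and generic_distinct).mono fun v ⟨h2, h3⟩ => ?_
  obtain ⟨F, hF⟩ := h1 v h3.1 h2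
  obtain ⟨δ, hδ, hhom⟩ := hF.degree
  choose μ hμ h4 h5 _ using hF.smooth_over
  obtain ⟨c, hc, hrep⟩ := rep_mk_eq v h3.1
  simp only [hrep, mem_multGE_smul hhom (hc _)] at h4 h5
  exact ⟨F, hF.irreducible, δ, μ, hδ, hμ, mem_sys.2 ⟨hhom, h4⟩, h5⟩

theorem IsCurveOfClass.mult_nonneg {v : Fin (n + 1) → Fin 3 → K} {A : PlaneClass n}
    {F : MvPolynomial (Fin 3) K} (h : IsCurveOfClass v A F) (i : Fin (n + 1)) : 0 ≤ A.mult i := by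
  obtain ⟨-, δ, μ, -, hμ, -⟩ := h
  have := hμ i
  omega

theorem IsCurveOfClass.mult_le_deg {v : Fin (n + 1) → Fin 3 → K} (hv : Distinct v)
    {A : PlaneClass n} {F : MvPolynomial (Fin 3) K} (h : IsCurveOfClass v A F)
    (i : Fin (n + 1)) : A.mult i ≤ A.deg := by
  obtain ⟨h0, δ, μ, hδ, hμ, hF, -⟩ := h
  rw [mem_sys] at hF
  rw [hδ, hμ]
  exact_mod_cast mult_le_degree h0.ne_zero hF.1 (hv.1 i) (hF.2 i)

theorem mem_multGE_of_associated {F G : MvPolynomial (Fin 3) K} (h : Associated F G)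
    {v : Fin 3 → K} {m : ℕ} (hF : F ∈ multGE v m) : G ∈ multGE v m := by
  obtain ⟨u, rfl⟩ := h
  have := mul_mem_multGE hF (mem_multGE_zero (v := v) (F := (u : MvPolynomial (Fin 3) K)))
  rwa [add_zero] at this

/-- Distinct irreducible curves have nonnegative intersection number. -/
theorem IsCurveOfClass.inter_nonneg {v : Fin (n + 1) → Fin 3 → K} (hv : Distinct v)
    {A B : PlaneClass n} (hAB : A ≠ B) {F G : MvPolynomial (Fin 3) K} (hF : IsCurveOfClass v A F)
    (hG : IsCurveOfClass v B G) : 0 ≤ A.inter B := by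
  obtain ⟨hF0, a, μ, ha, hμ, hFs, hFn⟩ := hF
  obtain ⟨hG0, b, ν, hb, hν, hGs, hGn⟩ := hG
  -- Irreducible forms with a common factor are associated; they have the same degree and the same
  -- exact multiplicities, hence the same class.
  have hrel : IsRelPrime F G := by
    rw [hF0.isRelPrime_iff_not_dvd]
    intro hdvd
    have hass : Associated F G := hF0.associated_of_dvd hG0 hdvd
    apply hAB
    rw [mem_sys] at hFs hGs
    refine Prod.ext ?_ (funext fun i => ?_)
    · show A.deg = B.deg
      rw [ha, hb]
      congr 1
      obtain ⟨u, hu⟩ := hass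
      have hFG : F.totalDegree = G.totalDegree := by
        apply le_antisymm
        · exact totalDegree_le_of_dvd_of_isDomain hdvd hG0.ne_zero
        · exact totalDegree_le_of_dvd_of_isDomain (Associated.symm ⟨u, hu⟩).dvd hF0.ne_zero
      rwa [hFs.1.totalDegree hF0.ne_zero, hGs.1.totalDegree hG0.ne_zero] at hFG
    · show A.mult i = B.mult i
      rw [hμ, hν]
      congr 1
      apply le_antisymm
      · by_contra! h
        exact hGn i (multGE_antitone _ h (mem_multGE_of_associated hass (hFs.2 i)))
      · by_contra! h
        exact hFn i (multGE_antitone _ h (mem_multGE_of_associated hass.symm (hGs.2 i)))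
  have h1 := sum_mul_le_of_coprime hv.1 hv.2 hFs hGs hF0.ne_zero hG0.ne_zero hrel
  rw [inter, ha, hb]
  simp only [hμ, hν]
  have h2 : ((∑ i, μ i * ν i : ℕ) : ℤ) ≤ ((a * b : ℕ) : ℤ) := by exact_mod_cast h1
  push_cast at h2
  linarith

/-- The intersection number depends only on the classes, so one tuple carrying both curves suffices;
nonempty open sets intersect. -/
theorem IsIrreducibleNegOneClass.inter_nonneg [Infinite K] {A B : PlaneClass n}
    (hA : IsIrreducibleNegOneClass K A) (hB : IsIrreducibleNegOneClass K B) (hAB : A ≠ B) :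
    0 ≤ A.inter B := by
  obtain ⟨v, ⟨⟨F, hF⟩, ⟨G, hG⟩⟩, hv⟩ := ((hA.generic.and hB.generic).and generic_distinct).exists_vec
  exact hF.inter_nonneg hv hAB hG

theorem IsIrreducibleNegOneClass.mult_nonneg [Infinite K] {A : PlaneClass n}
    (hA : IsIrreducibleNegOneClass K A) (i : Fin (n + 1)) : 0 ≤ A.mult i := by
  obtain ⟨v, F, hF⟩ := hA.generic.exists_vec
  exact hF.mult_nonneg i

theorem IsIrreducibleNegOneClass.mult_le_deg [Infinite K] {A : PlaneClass n}
    (hA : IsIrreducibleNegOneClass K A) (i : Fin (n + 1)) : A.mult i ≤ A.deg := by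
  obtain ⟨v, ⟨F, hF⟩, hv⟩ := (hA.generic.and generic_distinct).exists_vec
  exact hF.mult_le_deg hv i

/-- The lower bound for the dimension, for multiplicities that may be negative. -/
theorem vdim_add_one_le_finrank_sys {M : PlaneClass n} (h0 : 0 ≤ M.deg)
    {v : Fin (n + 1) → Fin 3 → K} (hv : ∀ i, v i ≠ 0) :
    M.vdim + 1 ≤ Module.finrank K (sys M.deg.toNat (fun i => (M.mult i).toNat) v) := by
  have h1 := tri_le_finrank_sys M.deg.toNat (fun i => (M.mult i).toNat) hv
  have h2 := two_mul_vdim M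
  have h3 := two_mul_tri_int (M.deg.toNat + 1)
  have h4 : ∑ i, 2 * (tri (M.mult i).toNat : ℤ) ≤ ∑ i, M.mult i * (M.mult i + 1) := by
    refine Finset.sum_le_sum fun i _ => ?_
    rw [two_mul_tri_int]
    -- A negative integer `x` satisfies `x * (x + 1) ≥ 0`, so truncating it to `0` does not increase
    -- the number of conditions.
    rcases le_total 0 (M.mult i) with h | h
    · rw [Int.toNat_of_nonneg h]
    · rw [Int.toNat_of_nonpos h]
      rcases h.eq_or_lt with h | h
      · simp [h]
      · rw [Nat.cast_zero, zero_mul]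
        nlinarith
  rw [← Finset.mul_sum] at h4
  rw [Nat.cast_add, Int.toNat_of_nonneg h0] at h3
  have h5 : (tri (M.deg.toNat + 1) : ℤ) ≤
      Module.finrank K (sys M.deg.toNat (fun i => (M.mult i).toNat) v) +
        ∑ i, (tri (M.mult i).toNat : ℤ) := by exact_mod_cast h1
  push_cast at h3
  linarith

/-- Adding fixed components to a system. -/
theorem finrank_sys_le_of_curves {S : Finset (PlaneClass n)} {N : PlaneClass n → ℕ}
    {L M : PlaneClass n} (hM : M = L - ∑ A ∈ S, N A • A) (h0 : 0 ≤ M.deg)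
    {d : ℕ} {m : Fin (n + 1) → ℕ} (hd : L.deg = d) (hm : ∀ i, L.mult i = m i)
    {v : Fin (n + 1) → Fin 3 → K} (hS : ∀ A ∈ S, ∃ F, IsCurveOfClass v A F) :
    Module.finrank K (sys M.deg.toNat (fun i => (M.mult i).toNat) v) ≤
      Module.finrank K (sys d m v) := by
  choose! F hF using hS
  have hF0 : ∏ A ∈ S, F A ^ N A ≠ 0 :=
    Finset.prod_ne_zero_iff.2 fun A hA => pow_ne_zero _ (hF A hA).1.ne_zero
  choose! hirr δ μ hδ hμ hsys _ using hF
  have hhom : (∏ A ∈ S, F A ^ N A).IsHomogeneous (∑ A ∈ S, N A * δ A) := by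
    refine IsHomogeneous.prod _ _ _ fun A hA => ?_
    rw [mul_comm]
    exact (mem_sys.1 (hsys A hA)).1.pow _
  have hmul : ∀ i, ∏ A ∈ S, F A ^ N A ∈ multGE (v i) (∑ A ∈ S, N A * μ A i) := by
    intro i
    rw [mem_multGE_iff, ← Finset.prod_pow_eq_pow_sum]
    refine Ideal.prod_mem_prod fun A hA => ?_
    rw [mul_comm, pow_mul]
    exact Ideal.pow_mem_pow ((mem_multGE_iff).1 ((mem_sys.1 (hsys A hA)).2 i)) _
  have hdeg : M.deg = d - ∑ A ∈ S, (N A : ℤ) * δ A := by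
    have h1 : M.deg = L.deg - ∑ A ∈ S, N A • A.deg := by
      rw [hM]
      simp [deg, Prod.fst_sub, Prod.fst_sum]
    rw [h1, hd]
    congr 1
    exact Finset.sum_congr rfl fun A hA => by rw [hδ A hA]; simp
  have hmult : ∀ i, M.mult i = m i - ∑ A ∈ S, (N A : ℤ) * μ A i := by
    intro i
    have h1 : M.mult i = L.mult i - ∑ A ∈ S, N A • A.mult i := by
      rw [hM]
      simp [mult, Prod.snd_sub, Prod.snd_sum, Finset.sum_apply]
    rw [h1, hm]
    congr 1
    exact Finset.sum_congr rfl fun A hA => by rw [hμ A hA]; simp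
  rw [← finrank_map_mulLeft hF0]
  refine Submodule.finrank_mono ?_
  rintro _ ⟨G, hG, rfl⟩
  rw [SetLike.mem_coe, mem_sys] at hG
  rw [LinearMap.mulLeft_apply, mem_sys]
  constructor
  · have := hhom.mul hG.1
    convert this using 1
    zify
    rw [Int.toNat_of_nonneg h0, hdeg]
    ring
  · intro i
    refine multGE_antitone _ ?_ (mul_mem_multGE (hmul i) (hG.2 i))
    zify
    have := hmult i
    have := Int.self_le_toNat (M.mult i)
    linarith

theorem Distinct.injective {v : Fin (n + 1) → Fin 3 → K} (hv : Distinct v) :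
    Function.Injective fun i => Projectivization.mk K (v i) (hv.1 i) := by
  intro i j hij
  by_contra hne
  obtain ⟨a, ha⟩ := (Projectivization.mk_eq_mk_iff' K _ _ (hv.1 i) (hv.1 j)).1 hij
  have h1 := LinearIndependent.pair_iff.1 (hv.2 i j hne) 1 (-a) (by simp [ha])
  exact one_ne_zero h1.1

theorem finrank_linearSystem_mk (d : ℕ) (m : Fin (n + 1) → ℕ) (v : Fin (n + 1) → Fin 3 → K)
    (hv : ∀ i, v i ≠ 0) :
    Module.finrank K (linearSystem d m fun i => Projectivization.mk K (v i) (hv i)) =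
      Module.finrank K (sys d m v) := by
  obtain ⟨c, hc, hrep⟩ := rep_mk_eq v hv
  rw [← sys_smul d m v hc]
  exact congrArg (fun w => Module.finrank K (sys d m w)) (funext hrep)

/-- `Gen` allows coinciding or zero vectors and `dimension` does not; by semicontinuity the bound
also holds at some tuple of distinct points. -/
theorem dimension_lt_of_gen [Infinite K] {d r : ℕ} {m : Fin (n + 1) → ℕ} (h : Gen K d m r) :
    dimension K d m < r := by
  obtain ⟨v, h1, hv⟩ := (h.generic.and generic_distinct).exists_vec
  have h2 : sInf {r : ℕ | ∃ p : Fin (n + 1) → ℙ K (Fin 3 → K), Function.Injective p ∧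
      Module.finrank K (linearSystem d m p) = r} ≤ Module.finrank K (sys d m v) :=
    Nat.sInf_le ⟨_, hv.injective, finrank_linearSystem_mk d m v hv.1⟩
  rw [dimension]
  omega

theorem gen_of_dimension_lt [Infinite K] {d r : ℕ} {m : Fin (n + 1) → ℕ}
    (h : dimension K d m < r) : Gen K d m r := by
  obtain ⟨v, hv⟩ := (generic_distinct (K := K) (n := n)).exists_vec
  obtain ⟨p, -, hp⟩ := Nat.sInf_mem (s := {r : ℕ | ∃ p : Fin (n + 1) → ℙ K (Fin 3 → K),
    Function.Injective p ∧ Module.finrank K (linearSystem d m p) = r}) ⟨_, _, hv.injective, rfl⟩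
  refine ⟨fun i => (p i).rep, ?_⟩
  rw [← linearSystem_eq_sys, hp]
  rw [dimension] at h
  omega

/-- `(-1)`-special systems are special. -/
theorem IsNegOneSpecialClass.vdim_lt_dimension [Infinite K] {L : PlaneClass n}
    (h : IsNegOneSpecialClass K L) {d : ℕ} {m : Fin (n + 1) → ℕ} (hd : L.deg = d)
    (hm : ∀ i, L.mult i = m i) : max (-1) L.vdim < dimension K d m := by
  obtain ⟨S, N, M, hS, h2, hM, h0, hv0, -⟩ := h
  have hlt : L.vdim < M.vdim := vdim_lt_of_inter hM (fun A hA => (hS A hA).1.1)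
    (fun A hA => (hS A hA).2.1) (fun A hA => (hS A hA).2.2)
    (fun A hA B hB hAB => (hS A hA).1.inter_nonneg (hS B hB).1 hAB) h2
  have hge : M.vdim ≤ dimension K d m := by
    -- A tuple is chosen where the system of `L` is too small while all fixed curves exist. The
    -- product of their equations embeds the system of `M` there, which is too large.
    by_contra! hn
    have hgen : Gen K d m M.vdim.toNat := gen_of_dimension_lt (by omega)
    have hcur : Generic fun v : Fin (n + 1) → Fin 3 → K => ∀ A ∈ S, ∃ F, IsCurveOfClass v A F :=
      Generic.ball S fun A hA => (hS A hA).1.generic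
    obtain ⟨v, ⟨h3, h4⟩, h5⟩ := ((hgen.generic.and hcur).and generic_distinct).exists_vec
    have h6 := vdim_add_one_le_finrank_sys h0 h5.1
    have h7 := finrank_sys_le_of_curves hM h0 hd hm h4
    omega
  exact lt_of_lt_of_le (max_lt (by omega) hlt) hge

/-! ## The listed systems are `(-1)`-special -/

section Listed

open PlaneClass

variable {n : ℕ}

theorem planeClass_ext {D D' : PlaneClass n} (hd : D.deg = D'.deg) (h0 : D.mult 0 = D'.mult 0)
    (h : ∀ i, i ≠ 0 → D.mult i = D'.mult i) : D = D' := by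
  refine Prod.ext hd (funext fun i => ?_)
  by_cases hi : i = 0
  · subst hi; exact h0
  · exact h i hi

theorem deg_add (D D' : PlaneClass n) : (D + D').deg = D.deg + D'.deg := rfl

theorem mult_add (D D' : PlaneClass n) (i : Fin (n + 1)) :
    (D + D').mult i = D.mult i + D'.mult i := rfl

theorem mult_cls_of_ne (δ a b : ℤ) (T : Finset (Fin (n + 1))) {i : Fin (n + 1)} (hi : i ≠ 0) :
    (cls δ a b T).mult i = if i ∈ T then b else 0 := by
  simp [cls, PlaneClass.mult, hi]

theorem deg_sum_nsmul {α : Type*} (s : Finset α) (k : α → ℕ) (A : α → PlaneClass n) :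
    (∑ i ∈ s, k i • A i).deg = ∑ i ∈ s, (k i : ℤ) * (A i).deg := by
  simp [deg, Prod.fst_sum]

theorem mult_sum_nsmul {α : Type*} (s : Finset α) (k : α → ℕ) (A : α → PlaneClass n)
    (j : Fin (n + 1)) :
    (∑ i ∈ s, k i • A i).mult j = ∑ i ∈ s, (k i : ℤ) * (A i).mult j := by
  simp [mult, Prod.snd_sum, Finset.sum_apply]

variable (K) in
/-- Nonnegative intersection with all `(-1)`-curves. -/
def NefOnNegOneCurves (M : PlaneClass n) : Prop :=
  ∀ A : PlaneClass n, IsIrreducibleNegOneClass K A → 0 ≤ M.inter A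

/-- Injectivity lets the multiplicities, given on indices, be transported to the set of classes. -/
theorem isNegOneSpecialClass_of_family {α : Type*} {s : Finset α} {A : α → PlaneClass n}
    {k : α → ℕ} {L M : PlaneClass n} (hinj : Set.InjOn A s)
    (hA : ∀ i ∈ s, IsIrreducibleNegOneClass K (A i) ∧ 1 ≤ k i ∧ L.inter (A i) = -(k i : ℤ))
    (h2 : ∃ i ∈ s, 2 ≤ k i) (hM : L = M + ∑ i ∈ s, k i • A i) (h0 : 0 ≤ M.deg)
    (hv : 0 ≤ M.vdim) (hnef : NefOnNegOneCurves K M) : IsNegOneSpecialClass K L := by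
  classical
  obtain ⟨i₀, hi₀, h3⟩ := h2
  have : Nonempty α := ⟨i₀⟩
  obtain ⟨N, hN⟩ : ∃ N : PlaneClass n → ℕ, ∀ i ∈ s, N (A i) = k i :=
    ⟨fun B => k (Function.invFunOn A s B), fun i hi => congrArg k (hinj.leftInvOn_invFunOn hi)⟩
  refine ⟨s.image A, N, M, ?_, ?_, ?_, h0, hv, hnef⟩
  · intro B hB
    obtain ⟨i, hi, rfl⟩ := Finset.mem_image.1 hB
    rw [hN i hi]
    exact hA i hi
  · exact ⟨A i₀, Finset.mem_image_of_mem A hi₀, by rwa [hN i₀ hi₀]⟩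
  · rw [Finset.sum_image hinj, Finset.sum_congr rfl fun i hi => by rw [hN i hi], hM]
    abel

/-- The usual test on components: an irreducible curve different from them meets every summand
non-negatively. Each disjunction allows for `A` being the component itself, where `M · A ≥ 0` is
checked directly. -/
theorem NefOnNegOneCurves.of_add {M B B' R : PlaneClass n} (h : M = B + B' + R)
    (hB : ∀ A, IsIrreducibleNegOneClass K A → 0 ≤ M.inter A ∨ 0 ≤ B.inter A)
    (hB' : ∀ A, IsIrreducibleNegOneClass K A → 0 ≤ M.inter A ∨ 0 ≤ B'.inter A)
    (hR : NefOnNegOneCurves K R) : NefOnNegOneCurves K M := by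
  intro A hA
  rcases hB A hA with h1 | h1
  · exact h1
  rcases hB' A hA with h2 | h2
  · exact h2
  rw [h, inter_add_left, inter_add_left]
  have := hR A hA
  omega

theorem inter_cls_empty (δ a b : ℤ) (A : PlaneClass n) :
    (cls δ a b ∅).inter A = δ * A.deg - a * A.mult 0 := by
  rw [inter_comm, inter_cls _ _ _ (by simp)]
  simp
  ring

/-- For a `(-1)`-curve `0 ≤ mult 0 ≤ deg`, so subtracting `a ≤ δ` times its multiplicity leaves a
non-negative number. -/
theorem nefOnNegOneCurves_cls_empty [Infinite K] {δ a b : ℤ} (h0 : 0 ≤ δ) (ha : a ≤ δ) :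
    NefOnNegOneCurves K (cls δ a b (∅ : Finset (Fin (n + 1)))) := by
  intro A hA
  rw [inter_cls_empty]
  have h1 := hA.mult_nonneg 0
  have h2 := hA.mult_le_deg 0
  nlinarith [mul_nonneg h0 (sub_nonneg.2 h2), mul_nonneg h1 (sub_nonneg.2 ha)]

theorem IsIrreducibleNegOneClass.inter_nonneg_or [Infinite K] {B M : PlaneClass n}
    (hB : IsIrreducibleNegOneClass K B) (hM : 0 ≤ M.inter B) (A : PlaneClass n)
    (hA : IsIrreducibleNegOneClass K A) : 0 ≤ M.inter A ∨ 0 ≤ B.inter A := by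
  by_cases h : B = A
  · subst h; exact Or.inl hM
  · exact Or.inr (hB.inter_nonneg hA h)

theorem notMem_erase_zero : (0 : Fin (n + 1)) ∉ Finset.univ.erase 0 := by simp

theorem card_erase_zero : (Finset.univ.erase (0 : Fin (n + 1))).card = n := by simp

theorem quasiHomClass_eq_cls (d m₀ n m : ℕ) :
    quasiHomClass d m₀ n m = cls (d : ℤ) m₀ m (Finset.univ.erase 0) := by
  refine planeClass_ext rfl ?_ fun i hi => ?_
  · rw [mult_cls_zero]; simp [quasiHomClass, quasiHomMult, mult]
  · rw [mult_cls_of_ne _ _ _ _ hi]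
    obtain ⟨j, rfl⟩ := Fin.exists_succ_eq.2 hi
    simp [quasiHomClass, quasiHomMult, mult]

/-- The curve of degree `e` through all the points, for `i = 0`, and the line through `p₀` and
`pᵢ`, for `i ≠ 0`. -/
def monoidalOrLine (e : ℕ) (i : Fin (n + 1)) : PlaneClass n :=
  if i = 0 then cls e (e - 1) 1 (Finset.univ.erase 0) else cls 1 1 1 {i}

theorem monoidalOrLine_zero (e : ℕ) :
    monoidalOrLine e (0 : Fin (n + 1)) = cls e (e - 1) 1 (Finset.univ.erase 0) := if_pos rfl

theorem monoidalOrLine_of_ne (e : ℕ) {i : Fin (n + 1)} (hi : i ≠ 0) :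
    monoidalOrLine e i = cls 1 1 1 {i} := if_neg hi

theorem monoidalOrLine_injective (e : ℕ) :
    Function.Injective (monoidalOrLine e : Fin (n + 1) → PlaneClass n) := by
  have key : ∀ j : Fin (n + 1), j ≠ 0 →
      cls (e : ℤ) (e - 1) 1 (Finset.univ.erase 0) ≠ cls 1 1 1 {j} := by
    intro j _ h
    have h1 := congrArg deg h
    have h2 := congrArg (fun D => mult D 0) h
    simp only [deg_cls, mult_cls_zero] at h1 h2
    omega
  intro i j hij
  by_cases hi : i = 0 <;> by_cases hj : j = 0
  · rw [hi, hj]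
  · rw [hi, monoidalOrLine_zero, monoidalOrLine_of_ne e hj] at hij
    exact absurd hij (key j hj)
  · rw [hj, monoidalOrLine_zero, monoidalOrLine_of_ne e hi] at hij
    exact absurd hij.symm (key i hi)
  · rw [monoidalOrLine_of_ne e hi, monoidalOrLine_of_ne e hj] at hij
    have h2 := congrArg (fun D => mult D i) hij
    simp only [mult_cls_of_ne _ _ _ _ hi] at h2
    by_contra hne
    simp [hne] at h2

theorem inter_line (d a b : ℤ) {i : Fin (n + 1)} (hi : i ≠ 0) :
    (cls d a b (Finset.univ.erase 0)).inter (cls 1 1 1 {i}) = d - a - b := by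
  rw [inter_cls_cls _ _ _ _ _ _ notMem_erase_zero (by simpa using hi.symm) (by simpa using hi)]
  simp

theorem inter_monoidal (d a b : ℤ) (e : ℤ) :
    (cls d a b (Finset.univ.erase (0 : Fin (n + 1)))).inter
      (cls e (e - 1) 1 (Finset.univ.erase 0)) = d * e - a * (e - 1) - n * b := by
  rw [inter_cls_cls _ _ _ _ _ _ notMem_erase_zero notMem_erase_zero subset_rfl, card_erase_zero]
  ring

/-- Sums of the lines and a multiple of the curve through all the points. -/
theorem sum_monoidalOrLine (e k l : ℕ) :
    ∑ i : Fin (n + 1), (if i = 0 then k else l) • monoidalOrLine e i =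
      cls (k * e + l * n) (k * (e - 1) + l * n) (k + l) (Finset.univ.erase 0) := by
  refine planeClass_ext ?_ ?_ fun j hj => ?_
  · rw [deg_sum_nsmul, Fin.sum_univ_succ, monoidalOrLine_zero]
    simp [monoidalOrLine_of_ne, Fin.succ_ne_zero]
    ring
  · rw [mult_sum_nsmul, Fin.sum_univ_succ, monoidalOrLine_zero]
    simp [monoidalOrLine_of_ne, Fin.succ_ne_zero, mult_cls_zero]
    ring
  · rw [mult_sum_nsmul, Fin.sum_univ_succ, monoidalOrLine_zero]
    obtain ⟨j, rfl⟩ := Fin.exists_succ_eq.2 hj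
    simp [monoidalOrLine_of_ne, Fin.succ_ne_zero, mult_cls_of_ne]

theorem sum_monoidalOrLine_of_ne (e l : ℕ) :
    ∑ i ∈ Finset.univ.erase (0 : Fin (n + 1)), l • monoidalOrLine e i =
      cls (l * n) (l * n) l (Finset.univ.erase 0) := by
  have h1 := sum_monoidalOrLine (n := n) e 0 l
  rw [← Finset.add_sum_erase _ _ (Finset.mem_univ 0)] at h1
  rw [Finset.sum_congr rfl fun i hi => by
    rw [if_neg (Finset.ne_of_mem_erase hi)]] at h1
  simpa using h1

theorem cls_add (d a b d' a' b' : ℤ) (T : Finset (Fin (n + 1))) :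
    cls d a b T + cls d' a' b' T = cls (d + d') (a + a') (b + b') T := by
  refine planeClass_ext rfl ?_ fun i hi => ?_
  · simp [mult_add, mult_cls_zero]
  · rw [mult_add, mult_cls_of_ne _ _ _ _ hi, mult_cls_of_ne _ _ _ _ hi, mult_cls_of_ne _ _ _ _ hi]
    split <;> simp

theorem cls_mult_zero (d a : ℤ) (b : ℤ) (T : Finset (Fin (n + 1))) :
    cls d a 0 T = cls d a b ∅ := by
  refine planeClass_ext rfl ?_ fun i hi => ?_
  · simp [mult_cls_zero]
  · simp [mult_cls_of_ne, hi]

/-- Special systems are listed. -/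
theorem listed_of_isSpecial [Infinite K] {d m₀ m : ℕ} (hm : m = 2 ∨ m = 3) (hd : d ≤ m₀ + m + 1)
    (h : IsSpecial K d m₀ n m) : Listed d m₀ n m := by
  by_contra hn
  have h1 := dimension_lt_of_gen
    (gen_of_not_listed (K := K) hm hd hn (r := ((quasiHomClass d m₀ n m).vdim + 1).toNat) (by omega))
  rw [IsSpecial, expectedDimension] at h
  omega

/-! ### Explicit fixed parts of the listed systems -/

variable [IsAlgClosed K]

theorem isIrreducibleNegOneClass_monoidalOrLine {e : ℕ} (he : 1 ≤ e) (hn : n = 2 * e)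
    (i : Fin (n + 1)) : IsIrreducibleNegOneClass K (monoidalOrLine e i) := by
  by_cases hi : i = 0
  · rw [hi, monoidalOrLine_zero]
    exact isIrreducibleNegOneClass_monoidal he notMem_erase_zero (by rw [card_erase_zero, hn])
  · rw [monoidalOrLine_of_ne e hi]
    exact isIrreducibleNegOneClass_line hi

/-- Systems with a fixed part consisting of lines through `p₀`. -/
theorem isNegOneSpecial_of_lines {d m₀ m l : ℕ} {δ a b : ℤ} (hn : 1 ≤ n) (hl : 2 ≤ l)
    (hdm : (d : ℤ) - m₀ - m = -l) (hd : (d : ℤ) = δ + l * n) (ha : (m₀ : ℤ) = a + l * n)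
    (hb : (m : ℤ) = b + l) (h0 : 0 ≤ δ)
    (hv : 0 ≤ δ * (δ + 3) - a * (a + 1) - n * (b * (b + 1)))
    (hnef : NefOnNegOneCurves K (cls δ a b (Finset.univ.erase (0 : Fin (n + 1))))) :
    IsNegOneSpecial K d m₀ n m := by
  have hvd := two_mul_vdim_cls δ a b (notMem_erase_zero (n := n))
  rw [card_erase_zero] at hvd
  refine isNegOneSpecialClass_of_family (s := Finset.univ.erase 0) (A := monoidalOrLine 0)
    (k := fun _ => l) (M := cls δ a b (Finset.univ.erase 0)) (monoidalOrLine_injective 0).injOn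
    (fun i hi => ?_) ⟨⟨1, by omega⟩, by simp [Fin.ext_iff], hl⟩ ?_ h0 (by omega) hnef
  · have hi0 := Finset.ne_of_mem_erase hi
    rw [monoidalOrLine_of_ne 0 hi0, quasiHomClass_eq_cls, inter_line _ _ _ hi0]
    exact ⟨isIrreducibleNegOneClass_line hi0, by omega, hdm⟩
  · rw [sum_monoidalOrLine_of_ne, cls_add, quasiHomClass_eq_cls, hd, ha, hb]

/-- Systems with a multiple of the curve of degree `e` as a fixed part. -/
theorem isNegOneSpecial_of_monoidal {d m₀ m e k : ℕ} {δ a b : ℤ} (he : 1 ≤ e) (hn : n = 2 * e)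
    (hk : 2 ≤ k) (hdm : (d : ℤ) * e - m₀ * (e - 1) - n * m = -k) (hd : (d : ℤ) = δ + k * e)
    (ha : (m₀ : ℤ) = a + k * (e - 1)) (hb : (m : ℤ) = b + k) (h0 : 0 ≤ δ)
    (hv : 0 ≤ δ * (δ + 3) - a * (a + 1) - n * (b * (b + 1)))
    (hnef : NefOnNegOneCurves K (cls δ a b (Finset.univ.erase (0 : Fin (n + 1))))) :
    IsNegOneSpecial K d m₀ n m := by
  have hvd := two_mul_vdim_cls δ a b (notMem_erase_zero (n := n))
  rw [card_erase_zero] at hvd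
  refine isNegOneSpecialClass_of_family (s := {0}) (A := monoidalOrLine e)
    (k := fun _ => k) (M := cls δ a b (Finset.univ.erase 0)) (monoidalOrLine_injective e).injOn
    (fun i hi => ?_) ⟨0, by simp, hk⟩ ?_ h0 (by omega) hnef
  · refine ⟨isIrreducibleNegOneClass_monoidalOrLine he hn i, by omega, ?_⟩
    rw [Finset.mem_singleton.1 hi, monoidalOrLine_zero, quasiHomClass_eq_cls, inter_monoidal]
    exact hdm
  · have h1 := sum_monoidalOrLine (n := n) e k 0
    rw [← Finset.add_sum_erase _ _ (Finset.mem_univ 0)] at h1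
    rw [Finset.sum_eq_zero (s := Finset.univ.erase 0) fun i hi => by
      rw [if_neg (Finset.ne_of_mem_erase hi), zero_smul]] at h1
    rw [Finset.sum_singleton, quasiHomClass_eq_cls, hd, ha, hb]
    simp only [if_true, add_zero] at h1
    rw [h1, cls_add]
    simp

/-- Systems fixed up to multiples of the lines and of the curve of degree `e`. -/
theorem isNegOneSpecial_of_eq {d m₀ m e k l : ℕ} (he : 1 ≤ e) (hn : n = 2 * e)
    (hk : 1 ≤ k) (hl : 1 ≤ l) (hkl : 2 ≤ k ∨ 2 ≤ l)
    (h1 : (d : ℤ) * e - m₀ * (e - 1) - n * m = -k) (h2 : (d : ℤ) - m₀ - m = -l)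
    (hd : (d : ℤ) = k * e + l * n) (ha : (m₀ : ℤ) = k * (e - 1) + l * n) (hb : (m : ℤ) = k + l) :
    IsNegOneSpecial K d m₀ n m := by
  refine isNegOneSpecialClass_of_family (s := Finset.univ) (A := monoidalOrLine e)
    (k := fun i => if i = 0 then k else l) (M := 0) (monoidalOrLine_injective e).injOn
    (fun i _ => ⟨isIrreducibleNegOneClass_monoidalOrLine he hn i, ?_, ?_⟩) ?_ ?_ le_rfl
    (by simp [vdim, deg, mult]) (fun A _ => (inter_zero_left A).ge)
  · split <;> omega
  · by_cases hi : i = 0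
    · rw [hi, if_pos rfl, monoidalOrLine_zero, quasiHomClass_eq_cls, inter_monoidal, h1]
    · rw [if_neg hi, monoidalOrLine_of_ne e hi, quasiHomClass_eq_cls, inter_line _ _ _ hi, h2]
  · rcases hkl with h | h
    · exact ⟨0, by simp, by simpa using h⟩
    · exact ⟨⟨1, by omega⟩, by simp, by simpa [Fin.ext_iff] using h⟩
  · rw [sum_monoidalOrLine, zero_add, quasiHomClass_eq_cls, hd, ha, hb]

/-- The curves of degree `δ` with multiplicity `δ - 1` at `p₀` through the other points. -/
theorem nefOnNegOneCurves_monoidal {δ : ℕ} (h : n < 2 * δ) :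
    NefOnNegOneCurves K (cls (δ : ℤ) (δ - 1) 1 (Finset.univ.erase (0 : Fin (n + 1)))) := by
  have : Infinite K := IsAlgClosed.instInfinite
  have hpencil : ∀ c : ℕ, NefOnNegOneCurves K (cls c c 0 (∅ : Finset (Fin (n + 1)))) := fun c =>
    nefOnNegOneCurves_cls_empty (Int.natCast_nonneg _) le_rfl
  -- The intersection number with the curve of degree `e` through `2 * e` points is `δ - e - 1`. For
  -- `e = 0` the class is the exceptional curve over `p₀`, and the claim is that multiplicities at
  -- `p₀` are non-negative.
  have hD : ∀ (e : ℕ) (T : Finset (Fin (n + 1))), 0 ∉ T → T.card = 2 * e → e < δ →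
      ∀ A, IsIrreducibleNegOneClass K A →
        0 ≤ (cls (δ : ℤ) (δ - 1) 1 (Finset.univ.erase (0 : Fin (n + 1)))).inter A ∨
          0 ≤ (cls (e : ℤ) (e - 1) 1 T).inter A := by
    intro e T hT hc he A hA
    rcases Nat.eq_zero_or_pos e with rfl | he0
    · right
      rw [Finset.card_eq_zero.1 (by omega : T.card = 0), inter_cls_empty]
      simpa using hA.mult_nonneg 0
    · refine (isIrreducibleNegOneClass_monoidal he0 hT hc).inter_nonneg_or ?_ A hA
      rw [inter_cls_cls _ _ _ _ _ _ notMem_erase_zero hT, hc]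
      · push_cast
        have : (e : ℤ) < δ := by exact_mod_cast he
        linarith
      · intro i hi
        exact Finset.mem_erase.2 ⟨fun h0 => hT (h0 ▸ hi), Finset.mem_univ i⟩
  -- For even `n` the class is the curve through all the points plus lines of the pencil at `p₀`;
  -- for odd `n` the last point is covered by its own line.
  rcases Nat.even_or_odd' n with ⟨e, hn | hn⟩
  · refine NefOnNegOneCurves.of_add (B := cls (e : ℤ) (e - 1) 1 (Finset.univ.erase 0))
      (B' := 0) (R := cls ((δ - e : ℕ) : ℤ) (δ - e : ℕ) 0 ∅) ?_
      (hD e _ notMem_erase_zero (by rw [card_erase_zero, hn]) (by omega))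
      (fun A _ => Or.inr (inter_zero_left A).ge) (hpencil _)
    rw [← cls_mult_zero _ _ _ (Finset.univ.erase 0), add_zero, cls_add]
    congr 1 <;> push_cast [show e ≤ δ by omega] <;> ring
  · have hl : (Fin.last n) ≠ 0 := by rw [Ne, Fin.ext_iff]; simp; omega
    refine NefOnNegOneCurves.of_add
      (B := cls (e : ℤ) (e - 1) 1 ((Finset.univ.erase 0).erase (Fin.last n)))
      (B' := cls 1 1 1 {Fin.last n}) (R := cls ((δ - e - 1 : ℕ) : ℤ) (δ - e - 1 : ℕ) 0 ∅) ?_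
      (hD e _ (by simp) ?_ (by omega))
      ((isIrreducibleNegOneClass_line hl).inter_nonneg_or ?_) (hpencil _)
    · refine planeClass_ext ?_ ?_ fun i hi => ?_
      · simp only [deg_add, deg_cls]
        omega
      · simp only [mult_add, mult_cls_zero]
        omega
      · simp only [mult_add, mult_cls_of_ne _ _ _ _ hi]
        by_cases h1 : i = Fin.last n
        · subst h1; simp [hl]
        · simp [h1, hi]
    · rw [Finset.card_erase_of_mem (by simpa using hl), card_erase_zero, hn]
      omega
    · rw [inter_line _ _ _ hl]
      linarith

theorem isNegOneSpecial_of_listed {d m₀ m : ℕ} (hm : m = 2 ∨ m = 3) (h : Listed d m₀ n m) :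
    IsNegOneSpecial K d m₀ n m := by
  have : Infinite K := IsAlgClosed.instInfinite
  obtain ⟨hn, ⟨rfl, h1⟩ | ⟨rfl, rfl, h1⟩ | ⟨e, he, rfl, h1, h2⟩ | ⟨rfl, h1, e, he, h2⟩ |
    ⟨rfl, h1, h2⟩⟩ := h
  -- For `m₀ = d` each line through `p₀` is fixed `m` times, and the residual system consists of
  -- unions of lines through `p₀`.
  · have h2 : ((n * m : ℕ) : ℤ) ≤ m₀ := by exact_mod_cast h1
    push_cast at h2
    refine isNegOneSpecial_of_lines (l := m) (δ := m₀ - m * n) (a := m₀ - m * n) (b := 0) hn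
      (by omega) (by ring) (by ring) (by ring) (by ring) (by linarith) (by nlinarith) ?_
    rw [cls_mult_zero _ _ 0]
    exact nefOnNegOneCurves_cls_empty (by linarith) le_rfl
  -- Each line is fixed twice, leaving the class `(δ; δ - 1, 1, …, 1)` with `n ≤ 2 * δ`. In the
  -- equality case this residual is itself a `(-1)`-curve and is removed too.
  · obtain ⟨δ, hδ⟩ : ∃ δ, m₀ + 1 = δ + 2 * n := ⟨m₀ + 1 - 2 * n, by omega⟩
    have hm₀ : (m₀ : ℤ) = δ - 1 + 2 * n := by omega
    by_cases h3 : 2 * δ ≤ n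
    · have h4 : n = 2 * δ := by omega
      refine isNegOneSpecial_of_eq (e := δ) (k := 1) (l := 2) (by omega) h4 le_rfl (by omega)
        (by omega) ?_ ?_ ?_ ?_ (by norm_num) <;> push_cast [hm₀, h4] <;> ring
    · refine isNegOneSpecial_of_lines (l := 2) (δ := δ) (a := δ - 1) (b := 1) hn le_rfl
        (by push_cast; ring) (by push_cast [hm₀]; ring) (by push_cast [hm₀]; ring)
        (by norm_num) (by omega) ?_ (nefOnNegOneCurves_monoidal (by omega))
      have : (n : ℤ) < 2 * δ := by omega
      nlinarith
  · have he1 : 1 ≤ e := by omega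
    have hn2 : (n : ℤ) = 2 * e := by omega
    -- The intersection number with the curve of degree `e` is `d - m - m * e`. The allowed range
    -- gives `d = m * e`, where the curve is fixed `m` times and nothing remains, or `m = 3`, `d = 3
    -- * e + 1`, where it is fixed twice.
    rcases (by rcases hm with rfl | rfl <;> omega :
      m₀ + m = m * e ∨ m = 3 ∧ m₀ + 3 = 3 * e + 1) with h3 | ⟨rfl, h3⟩
    · have h4 : (m₀ : ℤ) = m * e - m := by
        have : ((m₀ + m : ℕ) : ℤ) = ((m * e : ℕ) : ℤ) := by rw [h3]
        push_cast at this
        linarith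
      refine isNegOneSpecial_of_monoidal (k := m) (δ := 0) (a := 0) (b := 0) he1 he (by omega)
        ?_ ?_ ?_ (by ring) le_rfl (by simp) ?_
      · push_cast [h4, hn2]; ring
      · push_cast [h4]; ring
      · rw [h4]; ring
      · rw [cls_mult_zero _ _ 0]
        exact nefOnNegOneCurves_cls_empty le_rfl le_rfl
    · have h4 : (m₀ : ℤ) = 3 * e - 2 := by omega
      refine isNegOneSpecial_of_monoidal (k := 2) (δ := (e + 1 : ℕ)) (a := (e + 1 : ℕ) - 1) (b := 1)
        he1 he le_rfl ?_ ?_ ?_ (by norm_num) (by omega) ?_ (nefOnNegOneCurves_monoidal (by omega))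
      · push_cast [h4, hn2]; ring
      · push_cast [h4]; ring
      · push_cast [h4]; ring
      · push_cast [hn2]
        nlinarith
  -- The system is twice the curve of degree `e` plus all the lines once, with residual class zero.
  · have h4 : (m₀ : ℤ) = 4 * e - 2 := by omega
    have hd : (d : ℤ) = 4 * e := by omega
    have hn2 : (n : ℤ) = 2 * e := by omega
    refine isNegOneSpecial_of_eq (e := e) (k := 2) (l := 1) (by omega) he (by omega) le_rfl
      (by omega) ?_ ?_ ?_ ?_ (by norm_num) <;> push_cast [h4, hd, hn2] <;> ring
  -- The two sporadic systems are a double line and a double conic, respectively, plus the conics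
  -- through the `n` points outside `p₀`.
  · have hres : ∀ e, n = 2 * e → 1 ≤ e → e ≤ 2 →
        NefOnNegOneCurves K (cls 2 0 1 (Finset.univ.erase (0 : Fin (n + 1)))) := by
      intro e hn' he1 he2
      refine NefOnNegOneCurves.of_add (B := cls (e : ℤ) (e - 1) 1 (Finset.univ.erase 0))
        (B' := 0) (R := cls (2 - e) (1 - e) 0 ∅) ?_
        ((isIrreducibleNegOneClass_monoidal he1 notMem_erase_zero
          (by rw [card_erase_zero, hn'])).inter_nonneg_or ?_)
        (fun A _ => Or.inr (inter_zero_left A).ge)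
        (nefOnNegOneCurves_cls_empty (by omega) (by omega))
      · rw [← cls_mult_zero _ _ _ (Finset.univ.erase 0), add_zero, cls_add]
        congr 1 <;> ring
      · rw [inter_monoidal, hn']
        push_cast
        linarith
    rcases h2 with ⟨rfl, rfl⟩ | ⟨rfl, rfl⟩
    · obtain rfl : m₀ = 0 := by omega
      exact isNegOneSpecial_of_monoidal (e := 1) (k := 2) (δ := 2) (a := 0) (b := 1) le_rfl rfl
        le_rfl (by norm_num) (by norm_num) (by norm_num) (by norm_num) (by norm_num) (by norm_num)
        (hres 1 rfl le_rfl (by omega))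
    · obtain rfl : m₀ = 2 := by omega
      exact isNegOneSpecial_of_monoidal (e := 2) (k := 2) (δ := 2) (a := 0) (b := 1) (by omega) rfl
        le_rfl (by norm_num) (by norm_num) (by norm_num) (by norm_num) (by norm_num) (by norm_num)
        (hres 2 rfl (by omega) le_rfl)

end Listed

end PlaneSystem

end

theorem mainTheorem9 {K : Type*} [Field K] [IsAlgClosed K] [CharZero K]
    (d m₀ n m : ℕ) (hm : m = 2 ∨ m = 3) (hm₀ : (d : ℤ) - m - 1 ≤ m₀) :
    PlaneSystem.IsSpecial K d m₀ n m ↔ PlaneSystem.IsNegOneSpecial K d m₀ n m :=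
  have : Infinite K := IsAlgClosed.instInfinite
  ⟨fun h => PlaneSystem.isNegOneSpecial_of_listed hm
      (PlaneSystem.listed_of_isSpecial hm (by omega) h),
    fun h => h.vdim_lt_dimension rfl fun _ => rfl⟩
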